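/- **Setting.** Let $G$ be a (discrete) group, $\mathcal T\in\mathrm{Aut}(G)$ and $L\ge 1$ with $\mathcal T^L=\mathrm{id}$. A *symmetric injective MPS* consists of a unitary representation $U:G\to U(d)$ on a site and matrices $A^1,\dots,A^d\in M_\chi(\mathbb C)$ such that - $A$ is left-canonical and injective: $\sum_s A^{s\dagger}A^s=1$; the transfer map $\mathbb E(X)=\sum_sA^sXA^{s\dagger}$ has a positive definite fixed point $\rho$; its eigenvalue $1$ is nondegenerate and all its other eigenvalues have modulus $<1$; - for all $k\ge1$ and $g\in G$ the periodic state $|\psi_{kL}\rangle=\sum_{s}\mathrm{Tr}(A^{s_0}\cdots A^{s_{kL-1}})|s_0\dots s_{kL-1}\rangle$ satisfies $\bigotimes_{j=0}^{kL-1}U_{\mathcal T^{j}(g)}|\psi_{kL}\rangle=e^{i\theta}|\psi_{kL}\rangle$ for some phase $e^{i\theta}$ depending on $k$ and $g$. *Phases* are the classes of the equivalence relation generated by the following elementary deformations. The local spaces of two symmetric MPS are embedded isometrically and $G$-equivariantly in a common unitary representation $R$ of $G$, and there is a continuous path $(A_t)_{t\in[0,1]}$ of tensors of fixed size which, for $0<t<1$,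 are left-canonical, injective and symmetric with respect to $R$, such that $A_0$ and $A_1$ generate the two embedded states on all periodic chains of $n\ge1$ sites. *Push-through data* of a symmetric MPS are unitaries $v(g)\in U(\chi)$ and phases $e^{i\phi(g)}$ such that, with $v_j(g)=v(\mathcal T^j(g))$ and $\phi_j(g)=\phi(\mathcal T^j(g))$, $$U_{\mathcal T^j(g)}\cdot A=e^{i\phi_j(g)}\,v_j(g)^\dagger A\,v_{j+1}(g)\qquad\text{for all } j\ge0,\ g\in G .$$ A *weak SPT* is a symmetric MPS with trivial strong class, that is, $v$ can be chosen to be a linear representation of $G$. A *weak SPT phase* is a phase that contains a weak SPT. **Theorem (classification of weak SPT phases with modulated symmetry).** 1. Every symmetric injective MPS has push-through data, and being a weak SPT depends only on the phase. Any two symmetric MPS can be stacked (tensor product on physical and virtual legs) to a symmetric injective MPS. 2. If $v$ is linear, the push-through phase $e^{i\phi}$ can be taken to be a character of $G$, and its class in $$W=H^1(G,U(1))\big/\{e^{i\phi(g)}\sim e^{i\phi(\mathcal T(g))}\}$$ (the quotient of $H^1(G,U(1))=\mathrm{Hom}(G,U(1))$ by the subgroup of all $\phi\circ\mathcal T/\phi$)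 depends only on the phase of the MPS. This defines a bijection from the set of weak SPT phases to $W$, under which stacking corresponds to the group law of $W$. 3. (Agreement with the crystalline equivalence principle.) Let $\mathbb Z$ act on $G$ through $\mathcal T$ and let $t$ be the generator of $\mathbb Z$. For every symmetric MPS there are push-through data with $v(g)v(h)=\omega(g,h)v(gh)$ and a 2-cocycle $c$ of $G\rtimes_{\mathcal T}\mathbb Z$ with $c|_{G\times G}=\omega$ and $c(t,g)=e^{i\phi(g)}c(\mathcal T(g),t)$. The class of $c$ does not depend on the choices and depends only on the phase of the MPS. It defines an injection of the set of all phases into $H^2(G\rtimes_{\mathcal T}\mathbb Z,U(1))$, which is bijective if $G$ is finite. Moreover, there is an exact sequence $$0\to W\to H^2(G\rtimes_{\mathcal T}\mathbb Z,U(1))\to H^2(G,U(1))^{\mathcal T}\to0,$$ whose second map is restriction to $G$, with image the strong SPT classes $[\omega]=[\mathcal T^*\omega]$, and whose first map sends the weak index of part 2 to the class $[c]$ for every weak SPT. -/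

import Mathlib

noncomputable section

namespace ModulatedMPS

open scoped Matrix ComplexOrder
open CategoryTheory

/-! ### Matrix product states -/

/-- An MPS tensor with physical dimension `d` and bond dimension `χ`: matrices `A^s`. -/
abbrev MPSTensor (d χ : ℕ) := Fin d → Matrix (Fin χ) (Fin χ) ℂ

/-- The coefficient `Tr(A^{s_1} ⋯ A^{s_n})` of the periodic `n`-site state generated by `A`. -/
def amplitude {d χ : ℕ} (A : MPSTensor d χ) {n : ℕ} (s : Fin n → Fin d) : ℂ :=
  ((List.ofFn fun i => A (s i)).prod).trace

/-- The transfer matrix `∑ₛ A^s ⊗ (A^s)^*`, as a map on bond space matrices. -/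
def transfer {d χ : ℕ} (A : MPSTensor d χ) :
    Matrix (Fin χ) (Fin χ) ℂ →ₗ[ℂ] Matrix (Fin χ) (Fin χ) ℂ where
  toFun X := ∑ s, A s * X * (A s)ᴴ
  map_add' X Y := by simp [mul_add, add_mul, Finset.sum_add_distrib]
  map_smul' c X := by simp [Finset.smul_sum]

/-- A left-canonical injective MPS tensor: the identity is the left dominant eigenvector of the
transfer matrix, the right one `ρ` is positive definite, the dominant eigenvalue `1` is
nondegenerate, and it is separated from the other eigenvalues by a gap. -/
structure IsCanonicalInjective {d χ : ℕ} (A : MPSTensor d χ) : Prop where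
  left_canonical : ∑ s, (A s)ᴴ * A s = 1
  right_fixed : ∃ ρ : Matrix (Fin χ) (Fin χ) ℂ, ρ.PosDef ∧ transfer A ρ = ρ
  unique : Module.finrank ℂ (Module.End.eigenspace (transfer A) 1) = 1
  gap : ∀ μ : ℂ, Module.End.HasEigenvalue (transfer A) μ → μ ≠ 1 → ‖μ‖ < 1

/-- The action of a `d' × d` matrix on the physical leg: `(M · A)^s = ∑_{s'} M_{s s'} A^{s'}`. -/
def physAct {d d' χ : ℕ} (M : Matrix (Fin d') (Fin d) ℂ) (A : MPSTensor d χ) : MPSTensor d' χ :=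
  fun s => ∑ s', M s s' • A s'

/-- `A` and `B` generate the same state on every periodic chain of `n ≥ 1` sites. -/
def SameStates {d χ χ' : ℕ} (A : MPSTensor d χ) (B : MPSTensor d χ') : Prop :=
  ∀ n : ℕ, 1 ≤ n → ∀ s : Fin n → Fin d, amplitude A s = amplitude B s

/-! ### Modulated symmetries -/

variable {G : Type} [Group G]

/-- The states generated by `A` on chains of `k` unit cells of `L` sites, `k ≥ 1`, are
eigenstates of the modulated symmetry `⨂_j U_{T^j(g)}` for all `g`. -/
def IsSymmetric (T : MulAut G) (L : ℕ) {d χ : ℕ} (U : G →* Matrix.unitaryGroup (Fin d) ℂ)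
    (A : MPSTensor d χ) : Prop :=
  ∀ k : ℕ, 1 ≤ k → ∀ g : G, ∃ θ : Circle, ∀ s : Fin (k * L) → Fin d,
    ∑ s' : Fin (k * L) → Fin d,
      (∏ j : Fin (k * L), (U ((T ^ (j : ℕ)) g)).1 (s j) (s' j)) * amplitude A s' =
        (θ : ℂ) * amplitude A s

/-- A translation invariant injective MPS (in left-canonical form), with a linear unitary
representation `U` of `G` on each site, that is symmetric under the modulated symmetry. -/
structure SymMPS (T : MulAut G) (L : ℕ) where
  d : ℕ
  χ : ℕ
  U : G →* Matrix.unitaryGroup (Fin d) ℂ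
  A : MPSTensor d χ
  injective : IsCanonicalInjective A
  symmetric : IsSymmetric T L U A

variable {T : MulAut G} {L : ℕ}

/-- The generalized push-through condition at all sites `j`,
`U_{T^j(g)} · A = φ_j(g) v_j(g)† A v_{j+1}(g)`, with bond unitaries `v_j(g) = v(T^j(g))` and
push-through phases `φ_j(g) = φ(T^j(g))`. -/
def SymMPS.PushThrough (S : SymMPS T L) (v : G → Matrix.unitaryGroup (Fin S.χ) ℂ)
    (φ : G → Circle) : Prop :=
  ∀ (j : ℕ) (g : G) (s : Fin S.d),
    physAct (S.U ((T ^ j) g)).1 S.A s =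
      (φ ((T ^ j) g) : ℂ) • ((v ((T ^ j) g)).1ᴴ * S.A s * (v ((T ^ (j + 1)) g)).1)

/-! ### Phases -/

/-- An elementary deformation of symmetric MPS. The sites of `S₀` and `S₁` are embedded,
compatibly with the symmetry, in sites carrying a common representation `R` (adding ancillary
levels), and the embedded states are the end points of a continuous path of tensors whose
interior consists of symmetric injective MPS. The tensors of the path have a fixed size; those
at the end points need not be the minimal ones, which allows the bond dimension to change. -/
def Deformation (S₀ S₁ : SymMPS T L) : Prop :=
  ∃ (d χ : ℕ) (R : G →* Matrix.unitaryGroup (Fin d) ℂ)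
    (J₀ : Matrix (Fin d) (Fin S₀.d) ℂ) (J₁ : Matrix (Fin d) (Fin S₁.d) ℂ)
    (A : ℝ → MPSTensor d χ),
    J₀ᴴ * J₀ = 1 ∧ J₁ᴴ * J₁ = 1 ∧
    (∀ g, (R g).1 * J₀ = J₀ * (S₀.U g).1) ∧ (∀ g, (R g).1 * J₁ = J₁ * (S₁.U g).1) ∧
    ContinuousOn A (Set.Icc 0 1) ∧
    (∀ t ∈ Set.Ioo (0 : ℝ) 1, IsCanonicalInjective (A t) ∧ IsSymmetric T L R (A t)) ∧
    SameStates (A 0) (physAct J₀ S₀.A) ∧ SameStates (A 1) (physAct J₁ S₁.A)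

/-- SPT phases: classes of symmetric injective MPS under the equivalence relation generated by
elementary deformations. -/
def Phase (T : MulAut G) (L : ℕ) : Type := Quot (Deformation (T := T) (L := L))

def SymMPS.phase (S : SymMPS T L) : Phase T L := Quot.mk _ S

/-- The strong SPT class is trivial: the bond unitaries can be chosen to form linear
representations of `G`. -/
def SymMPS.IsWeak (S : SymMPS T L) : Prop :=
  ∃ (v : G →* Matrix.unitaryGroup (Fin S.χ) ℂ) (φ : G → Circle), S.PushThrough v φ

/-- Weak SPT phases: the phases of the symmetric MPS with trivial strong SPT class. -/
def WeakPhase (T : MulAut G) (L : ℕ) : Type :=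
  {p : Phase T L // ∃ S : SymMPS T L, S.IsWeak ∧ S.phase = p}

def SymMPS.weakPhase (S : SymMPS T L) (h : S.IsWeak) : WeakPhase T L := ⟨S.phase, S, h, rfl⟩

/-- `S` is the stack of `S₁` and `S₂`: tensor product on physical and on virtual legs. -/
def IsStack (S₁ S₂ S : SymMPS T L) : Prop :=
  ∃ (e : Fin S₁.d × Fin S₂.d ≃ Fin S.d) (f : Fin S₁.χ × Fin S₂.χ ≃ Fin S.χ),
    (∀ a b i k j l, S.A (e (a, b)) (f (i, k)) (f (j, l)) = S₁.A a i j * S₂.A b k l) ∧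
    (∀ g a b a' b',
      (S.U g).1 (e (a, b)) (e (a', b')) = (S₁.U g).1 a a' * (S₂.U g).1 b b')

/-! ### The classifying groups -/

/-- The endomorphism `φ ↦ (φ ∘ T) / φ` of `H¹(G, U(1)) = Hom(G, U(1))`. -/
def translationDefect (T : MulAut G) : (G →* Circle) →* (G →* Circle) where
  toFun φ := φ.comp T.toMonoidHom / φ
  map_one' := by ext g; simp
  map_mul' φ ψ := by ext g; simp [mul_div_mul_comm]

/-- The group `H¹(G, U(1)) / {φ ∼ φ ∘ T}`. -/
abbrev WeakSPTGroup (T : MulAut G) : Type := (G →* Circle) ⧸ (translationDefect T).range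

/-- The weak SPT index of `S` is `x`: for bond unitaries that form a linear representation,
the push-through phases are a character with class `x`. -/
def SymMPS.HasWeakIndex (S : SymMPS T L) (x : WeakSPTGroup T) : Prop :=
  ∃ (v : G →* Matrix.unitaryGroup (Fin S.χ) ℂ) (φ : G →* Circle),
    S.PushThrough v φ ∧ (QuotientGroup.mk φ : WeakSPTGroup T) = x

/-- `U(1)` with trivial `G`-action, written additively. -/
abbrev U1 (G : Type) [Group G] : Rep ℤ G := Rep.trivial ℤ G (Additive Circle)

/-- The pullback `H²(G, U(1)) → H²(H, U(1))` along `f : H → G`. -/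
def H2pullback {H : Type} [Group H] (f : H →* G) :
    groupCohomology.H2 (U1 G) →+ groupCohomology.H2 (U1 H) :=
  (groupCohomology.map (A := U1 G) (B := U1 H) f (𝟙 (U1 H)) 2).hom.toAddMonoidHom

/-- The full symmetry group `G ⋊ ℤ` of the infinite chain, the generator of `ℤ` (translation by
one site) acting on `G` by `T`. -/
abbrev FullGroup (T : MulAut G) : Type := G ⋊[zpowersHom (MulAut G) T] (Multiplicative ℤ)

/-- The value of a `U(1)`-valued `2`-cocycle, as a complex phase. -/
def phaseOf {H : Type} [Group H] (c : groupCohomology.cocycles₂ (U1 H)) (x y : H) : Circle :=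
  Additive.toMul (c (x, y) : Additive Circle)

/-- The class in `H²(G ⋊ ℤ, U(1))` encoded in the push-through data `(v, φ)` of `S`: it is
represented by a cocycle `c` which restricts on `G` to the bond cocycle, and for which
translation `t` multiplies by `φ(g)` when it is moved past `g`, that is `[t][g] = φ(g) [T(g)][t]`
in the extension with multiplication `[x][y] = c(x, y) [x y]`. -/
def SymMPS.HasCrystallineClass (S : SymMPS T L)
    (x : groupCohomology.H2 (U1 (FullGroup T))) : Prop :=
  ∃ (v : G → Matrix.unitaryGroup (Fin S.χ) ℂ) (φ : G → Circle)
    (c : groupCohomology.cocycles₂ (U1 (FullGroup T))),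
    S.PushThrough v φ ∧
    (∀ g h : G, (v g).1 * (v h).1 =
      (phaseOf c (SemidirectProduct.inl g) (SemidirectProduct.inl h) : ℂ) • (v (g * h)).1) ∧
    (∀ g : G, phaseOf c (SemidirectProduct.inr (Multiplicative.ofAdd 1)) (SemidirectProduct.inl g) =
      φ g * phaseOf c (SemidirectProduct.inl (T g))
        (SemidirectProduct.inr (Multiplicative.ofAdd 1))) ∧
    groupCohomology.H2π (U1 (FullGroup T)) c = x

end ModulatedMPS

end

open ModulatedMPS

noncomputable section

namespace ModulatedMPS

open scoped Matrix ComplexOrder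
open CategoryTheory

set_option linter.unusedSectionVars false

/-! ### Multiplicative description of `H²(H, U(1))` -/

section Cohomology

open groupCohomology

variable {H : Type} [Group H]

/-! The invariant behind all parts is the class in `H²(G ⋊ ℤ, U(1))`. Since `ℤ` is free, a central
extension of `G ⋊ ℤ` by `U(1)` is a central extension of `G` together with a lift of `T` to it. In
cochains this is a pair `(ω, φ)` satisfying `Compat`, modulo rescaling by functions `z : G → U(1)`
(`exists_encodes`, `exists_encodes_of_class`, `Encodes.eq_iff`). Push-through data of an injective
tensor form exactly such a pair (`PushesTo.exists_cocycle`). If `ω = 1`, then `φ` is a character,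
determined up to `z / z ∘ T`; this yields the exact sequence (`iota_exact`).

Push-through data exist because traces of iterated mixed transfer maps are overlaps of periodic
states (`trace_mixChain`). By symmetry the overlaps of the state with its rotated copy do not decay,
so the mixed map over a unit cell has an eigenvalue of modulus at least `1`. The operator Schwarz
inequality makes mixed maps contractions in the norm weighted by the fixed point; equality turns the
eigenvector into an intertwiner, unitary up to scale (`exists_bond_unitaries`). Its uniqueness up to
a phase, applied to a translate, produces `φ` (`exists_push`).

The class is constant along deformations although the tensors at the ends may fail to be injective.
A power bounded map whose powers have traces tending to `1` has a rank-one idempotent among the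
limit points of its powers, so every nearby map has a power with a unique dominant eigenvector
(`exists_dominant_eigenvector`). For mixed transfer maps this eigenvector intertwines the
push-through data of the two tensors, whatever their bond dimensions (`exists_match`), so the class
is locally constant (`eventually_class_eq`, `Deformation.class_eq`).

Conversely, if two tensors have the same class, rescaling makes their pairs `(ω, φ)` equal. Put them
on two diagonal blocks and couple the blocks by matrix units, whose physical space carries `φ · v̄ ⊗
(w ∘ T)`, a linear representation because the cocycles cancel. The resulting path is primitive in
the interior and block triangular at its ends, so it is a deformation (`deformation_of_push`).
Characters are realized by product states. For finite `G` every class is realized by matrix units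
over a twisted regular representation. -/

/-- The multiplicative cocycle identity for trivial coefficients. -/
def IsCocycle (f : H → H → Circle) : Prop :=
  ∀ g h j, f (g * h) j * f g h = f h j * f g (h * j)

/-- The class `x` is represented by the multiplicative cochain `f`. -/
def Represents (f : H → H → Circle) (x : H2 (U1 H)) : Prop :=
  ∃ c : cocycles₂ (U1 H), (∀ g h, phaseOf c g h = f g h) ∧ H2π (U1 H) c = x

lemma IsCocycle.one_left {f : H → H → Circle} (hf : IsCocycle f) (h : H) : f 1 h = f 1 1 := by
  have := hf 1 1 h
  simp only [one_mul] at this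
  exact (mul_left_cancel this).symm

lemma IsCocycle.one_right {f : H → H → Circle} (hf : IsCocycle f) (h : H) : f h 1 = f 1 1 := by
  have := hf h 1 1
  simp only [mul_one] at this
  exact mul_left_cancel (this.trans (mul_comm _ _))

lemma isCocycle_phaseOf (c : cocycles₂ (U1 H)) : IsCocycle (phaseOf c) := by
  intro g h j
  have := (mem_cocycles₂_iff c.1).1 c.2 g h j
  exact this

lemma IsCocycle.exists_represents {f : H → H → Circle} (hf : IsCocycle f) :
    ∃ x, Represents f x := by
  refine ⟨_, ⟨fun p => Additive.ofMul (f p.1 p.2), ?_⟩, fun g h => rfl, rfl⟩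
  exact (mem_cocycles₂_iff (A := U1 H) _).2 fun g h j => hf g h j

lemma Represents.isCocycle {f : H → H → Circle} {x : H2 (U1 H)} (h : Represents f x) :
    IsCocycle f := by
  obtain ⟨c, hc, -⟩ := h
  have := isCocycle_phaseOf c
  intro g h j
  simpa only [hc] using this g h j

lemma exists_represents (x : H2 (U1 H)) : ∃ f : H → H → Circle, Represents f x := by
  induction x using H2_induction_on with
  | h c => exact ⟨phaseOf c, c, fun _ _ => rfl, rfl⟩

lemma Represents.eq_iff {f f' : H → H → Circle} {x x' : H2 (U1 H)} (h : Represents f x)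
    (h' : Represents f' x') :
    x = x' ↔ ∃ b : H → Circle, ∀ g h, f g h = f' g h * (b g * b h / b (g * h)) := by
  obtain ⟨c, hc, rfl⟩ := h
  obtain ⟨c', hc', rfl⟩ := h'
  rw [H2π_eq_iff]
  constructor
  · rintro ⟨b, hb⟩
    refine ⟨fun g => Additive.toMul (b g : Additive Circle), fun g h => ?_⟩
    have h1 := congrFun hb (g, h)
    rw [← hc, ← hc', mul_comm, ← div_eq_iff_eq_mul]
    rw [d₁₂_hom_apply] at h1
    refine (congrArg (Additive.toMul (α := Circle)) h1).symm.trans ?_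
    change Additive.toMul (α := Circle) (b h) / Additive.toMul (α := Circle) (b (g * h)) *
      Additive.toMul (α := Circle) (b g) = _
    rw [div_mul_eq_mul_div, mul_comm]
  · rintro ⟨b, hb⟩
    refine ⟨fun g => Additive.ofMul (b g), ?_⟩
    funext ⟨g, h⟩
    refine (d₁₂_hom_apply (A := U1 H) _ _).trans ?_
    have h1 := hb g h
    rw [← hc, ← hc', mul_comm, ← div_eq_iff_eq_mul] at h1
    refine Eq.trans ?_ (congrArg (Additive.ofMul (α := Circle)) h1).symm
    change Additive.ofMul (b h / b (g * h) * b g) = _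
    rw [div_mul_eq_mul_div, mul_comm]

lemma Represents.add {f f' : H → H → Circle} {x x' : H2 (U1 H)} (h : Represents f x)
    (h' : Represents f' x') : Represents (fun g h => f g h * f' g h) (x + x') := by
  obtain ⟨c, hc, rfl⟩ := h
  obtain ⟨c', hc', rfl⟩ := h'
  exact ⟨c + c', fun g h => congrArg₂ (· * ·) (hc g h) (hc' g h), map_add _ _ _⟩

lemma represents_one_zero : Represents (fun _ _ : H => 1) (0 : H2 (U1 H)) :=
  ⟨0, fun _ _ => rfl, map_zero _⟩

lemma Represents.mul_coboundary {f : H → H → Circle} {x : H2 (U1 H)} (h : Represents f x)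
    (b : H → Circle) : Represents (fun g h => f g h * (b g * b h / b (g * h))) x := by
  have hc : IsCocycle (fun g h => f g h * (b g * b h / b (g * h))) := by
    intro g k j
    have := h.isCocycle g k j
    simp only [div_eq_mul_inv]
    calc _ = (f (g * k) j * f g k) * (b g * b k * b j * (b (g * (k * j)))⁻¹) *
          (b (g * k) * (b (g * k))⁻¹) := by rw [mul_assoc g k j]; ac_rfl
      _ = (f k j * f g (k * j)) * (b g * b k * b j * (b (g * (k * j)))⁻¹) *
          (b (k * j) * (b (k * j))⁻¹) := by rw [this, mul_inv_cancel, mul_inv_cancel]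
      _ = _ := by ac_rfl
  obtain ⟨y, hy⟩ := hc.exists_represents
  have : y = x := (hy.eq_iff h).2 ⟨b, fun _ _ => rfl⟩
  exact this ▸ hy

lemma Represents.pullback {K : Type} [Group K] (p : K →* H) {f : H → H → Circle}
    {x : H2 (U1 H)} (h : Represents f x) :
    Represents (fun g h => f (p g) (p h)) (H2pullback p x) := by
  obtain ⟨c, hc, rfl⟩ := h
  refine ⟨mapCocycles₂ (A := U1 H) (B := U1 K) p (𝟙 (U1 K)) c, fun g h => hc _ _, ?_⟩
  exact (H2π_comp_map_apply (A := U1 H) (B := U1 K) p (𝟙 (U1 K)) c).symm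

/-! ### Central extensions by `U(1)` -/

/-- The central extension of `H` by `U(1)` with cocycle `f`, as a type of pairs. -/
@[ext]
structure CentralExt (f : H → H → Circle) where
  /-- The phase. -/
  phase : Circle
  /-- The group element. -/
  base : H

/-- The group structure on the central extension: `(a, g) (b, h) = (a b f(g, h), g h)`. -/
@[reducible]
def CentralExt.group {f : H → H → Circle} (hf : IsCocycle f) : Group (CentralExt f) :=
  letI : Mul (CentralExt f) := ⟨fun x y => ⟨x.phase * y.phase * f x.base y.base, x.base * y.base⟩⟩
  -- Cocycles are not assumed normalized, so the unit and the inverses carry the correction `(f 1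
  -- 1)⁻¹`.
  letI : One (CentralExt f) := ⟨⟨(f 1 1)⁻¹, 1⟩⟩
  letI : Inv (CentralExt f) :=
    ⟨fun x => ⟨x.phase⁻¹ * (f x.base⁻¹ x.base)⁻¹ * (f 1 1)⁻¹, x.base⁻¹⟩⟩
  have mul_def (x y : CentralExt f) :
    x * y = ⟨x.phase * y.phase * f x.base y.base, x.base * y.base⟩ := rfl
  have one_def : (1 : CentralExt f) = ⟨(f 1 1)⁻¹, 1⟩ := rfl
  have inv_def (x : CentralExt f) :
    x⁻¹ = ⟨x.phase⁻¹ * (f x.base⁻¹ x.base)⁻¹ * (f 1 1)⁻¹, x.base⁻¹⟩ := rfl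
  Group.ofLeftAxioms
    (fun x y z => by
      simp only [mul_def, CentralExt.mk.injEq, mul_assoc, and_true]
      have := hf x.base y.base z.base
      calc _ = x.phase * y.phase * z.phase * (f (x.base * y.base) z.base * f x.base y.base) := by
            ac_rfl
        _ = _ := by rw [this]; ac_rfl)
    (fun x => by
      simp only [mul_def, one_def, one_mul, hf.one_left]
      ext1
      · simp [mul_comm]
      · rfl)
    (fun x => by
      simp only [mul_def, one_def, inv_def, inv_mul_cancel, CentralExt.mk.injEq, and_true]
      calc _ = (x.phase⁻¹ * x.phase) * ((f x.base⁻¹ x.base)⁻¹ * f x.base⁻¹ x.base) * (f 1 1)⁻¹ := by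
            ac_rfl
        _ = _ := by simp)

lemma CentralExt.mul_def {f : H → H → Circle} (hf : IsCocycle f) (x y : CentralExt f) :
    letI := CentralExt.group hf
    x * y = ⟨x.phase * y.phase * f x.base y.base, x.base * y.base⟩ := rfl

/-- A cocycle whose central extension splits is a coboundary. -/
lemma IsCocycle.isCoboundary_of_section {f : H → H → Circle} (hf : IsCocycle f)
    (s : letI := CentralExt.group hf; H →* CentralExt f) (hs : ∀ x, (s x).base = x) :
    ∃ b : H → Circle, ∀ x y, f x y = b x * b y / b (x * y) := by
  let := CentralExt.group hf
  -- For a section `x ↦ (a x, x)`, multiplicativity reads `a (x y) = a x · a y · f x y`, so `a⁻¹`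
  -- cobounds `f`.
  refine ⟨fun x => (s x).phase⁻¹, fun x y => ?_⟩
  have h := congrArg CentralExt.phase (map_mul s x y)
  rw [CentralExt.mul_def] at h
  simp only [hs] at h
  change f x y = (s x).phase⁻¹ * (s y).phase⁻¹ / (s (x * y)).phase⁻¹
  rw [h]
  simp only [div_inv_eq_mul, ← mul_assoc]
  rw [mul_assoc (s x).phase⁻¹, mul_comm (s y).phase⁻¹, ← mul_assoc]
  simp

end Cohomology

/-! ### Cohomology of `G ⋊ ℤ` through bond cocycles and translation phases -/

section Semidirect

variable {G : Type} [Group G] {T : MulAut G}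

/-- The translation generator of the full symmetry group. -/
abbrev FullGroup.t (T : MulAut G) : FullGroup T := SemidirectProduct.inr (Multiplicative.ofAdd 1)

lemma FullGroup.t_mul_inl (g : G) : FullGroup.t T * SemidirectProduct.inl g =
    SemidirectProduct.inl (T g) * FullGroup.t T := by
  ext <;> simp

open SemidirectProduct in
/-- A cocycle on `G ⋊ ℤ` that is trivialized on `G` compatibly with translation is a
coboundary. -/
lemma IsCocycle.isCoboundary_of_restrict {f : FullGroup T → FullGroup T → Circle}
    (hf : IsCocycle f) (z : G → Circle)
    (h₁ : ∀ g h, f (inl g) (inl h) = z g * z h / z (g * h))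
    (h₂ : ∀ g, f (FullGroup.t T) (inl g) * z (T g) = z g * f (inl (T g)) (FullGroup.t T)) :
    ∃ b : FullGroup T → Circle, ∀ x y, f x y = b x * b y / b (x * y) := by
  let := CentralExt.group hf
  have mul_def (x y : CentralExt f) :
    x * y = ⟨x.phase * y.phase * f x.base y.base, x.base * y.base⟩ := rfl
  let p : CentralExt f →* FullGroup T := MonoidHom.mk' CentralExt.base fun _ _ => rfl
  let sG : G →* CentralExt f := MonoidHom.mk' (fun g => ⟨(z g)⁻¹, inl g⟩) fun g h => by
    rw [mul_def, h₁, map_mul]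
    congr 1
    change (z (g * h))⁻¹ = (z g)⁻¹ * (z h)⁻¹ * (z g * z h / z (g * h))
    rw [← mul_inv, div_eq_mul_inv, inv_mul_cancel_left]
  -- Any lift of the generator of the free group `ℤ` extends to `ℤ`; the only constraint is that
  -- conjugation by it acts on the lifted `G` as `T`, which is `h₂`.
  let t' : CentralExt f := ⟨1, FullGroup.t T⟩
  have conj1 (g : G) : t' * sG g = sG (T g) * t' := by
    rw [mul_def, mul_def]
    ext1
    · change 1 * (z g)⁻¹ * f (FullGroup.t T) (inl g) = (z (T g))⁻¹ * 1 * f (inl (T g)) _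
      rw [one_mul, mul_one, inv_mul_eq_iff_eq_mul, ← mul_assoc, mul_comm (z g), mul_assoc, ← h₂]
      simp [mul_comm]
    · exact FullGroup.t_mul_inl g
  have conj2 (n : ℤ) (g : G) : sG ((T ^ n) g) = t' ^ n * sG g * (t' ^ n)⁻¹ := by
    induction n generalizing g with
    | zero => simp
    | succ n ih =>
      rw [zpow_add_one, MulAut.mul_apply, ih, zpow_add_one, eq_mul_inv_of_mul_eq (conj1 g).symm]
      group
    | pred n ih =>
      have := conj1 (T⁻¹ g)
      rw [MulAut.apply_inv_self] at this
      rw [zpow_sub_one, MulAut.mul_apply, ih, zpow_sub_one, eq_inv_mul_of_mul_eq this]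
      group
  let s : FullGroup T →* CentralExt f := lift sG (zpowersHom _ t') fun n => by
    ext1 g
    exact conj2 (Multiplicative.toAdd n) g
  refine hf.isCoboundary_of_section s fun x => ?_
  have : p.comp s = MonoidHom.id _ := by
    refine SemidirectProduct.hom_ext ?_ ?_
    · ext1 g
      simp [s, sG, p]
    · ext1
      simp [s, p, t']
  exact DFunLike.congr_fun this x

/-- Compatibility of a bond cocycle with push-through phases. -/
def Compat (T : MulAut G) (ω : G → G → Circle) (φ : G → Circle) : Prop :=
  ∀ g h, φ (g * h) * ω g h = φ g * φ h * ω (T g) (T h)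

/-- `f` extends the pair of a bond cocycle and push-through phases to the full group. -/
def Extends (T : MulAut G) (f : FullGroup T → FullGroup T → Circle) (ω : G → G → Circle)
    (φ : G → Circle) : Prop :=
  (∀ g h, f (SemidirectProduct.inl g) (SemidirectProduct.inl h) = ω g h) ∧
  ∀ g, f (FullGroup.t T) (SemidirectProduct.inl g) =
    φ g * f (SemidirectProduct.inl (T g)) (FullGroup.t T)

/-- The condition `Compat` says precisely that `(a, g) ↦ (a φ(g), T g)` is an automorphism `τ` of
the central extension of `G`. The semidirect product of that extension with `ℤ` acting by `τ` is a
central extension of `G ⋊ ℤ`, and its cocycle is the required `f`. -/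
lemma IsCocycle.exists_extends {ω : G → G → Circle} (hω : IsCocycle ω) {φ : G → Circle}
    (hφ : Compat T ω φ) : ∃ f, IsCocycle f ∧ Extends T f ω φ := by
  let := CentralExt.group hω
  have mul_def (x y : CentralExt ω) :
    x * y = ⟨x.phase * y.phase * ω x.base y.base, x.base * y.base⟩ := rfl
  let τ : MulAut (CentralExt ω) :=
    { toFun := fun x => ⟨x.phase * φ x.base, T x.base⟩
      invFun := fun x => ⟨x.phase * (φ (T⁻¹ x.base))⁻¹, T⁻¹ x.base⟩
      left_inv := fun x => by simp
      right_inv := fun x => by simp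
      map_mul' := fun x y => by
        simp only [mul_def, map_mul, CentralExt.mk.injEq, and_true]
        have := hφ x.base y.base
        calc _ = x.phase * y.phase * (φ (x.base * y.base) * ω x.base y.base) := by ac_rfl
          _ = _ := by rw [this]; ac_rfl }
  have hτ (x : CentralExt ω) : τ x = ⟨x.phase * φ x.base, T x.base⟩ := rfl
  have hτ' (x : CentralExt ω) : τ⁻¹ x = ⟨x.phase * (φ (T⁻¹ x.base))⁻¹, T⁻¹ x.base⟩ := rfl
  -- The phase accumulated by `n` translations; for negative `n` it comes from the inverse
  -- automorphism.
  let ψ : ℤ → G → Circle := fun n h => ((τ ^ n) ⟨1, h⟩).phase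
  have hψ (n : ℤ) (a : Circle) (h : G) : (τ ^ n) ⟨a, h⟩ = ⟨a * ψ n h, (T ^ n) h⟩ := by
    have key : ∀ (a : Circle) (h : G), (τ ^ n) ⟨a, h⟩ = ⟨a * ψ n h, (T ^ n) h⟩ := by
      induction n with
      | zero => intro a h; simp [ψ]
      | succ n ih =>
        have h1 (a : Circle) (h : G) : (τ ^ ((n : ℤ) + 1)) ⟨a, h⟩ =
            ⟨a * φ h * ψ n (T h), (T ^ ((n : ℤ) + 1)) h⟩ := by
          rw [zpow_add_one, MulAut.mul_apply, hτ, ih, zpow_add_one, MulAut.mul_apply]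
        intro a h
        have h2 : ψ (n + 1) h = φ h * ψ n (T h) := by
          change ((τ ^ ((n : ℤ) + 1)) ⟨1, h⟩).phase = _
          rw [h1, one_mul]
        rw [h1, h2, mul_assoc]
      | pred n ih =>
        have h1 (a : Circle) (h : G) : (τ ^ (-(n : ℤ) - 1)) ⟨a, h⟩ =
            ⟨a * (φ (T⁻¹ h))⁻¹ * ψ (-n) (T⁻¹ h), (T ^ (-(n : ℤ) - 1)) h⟩ := by
          rw [zpow_sub_one, MulAut.mul_apply, hτ', ih, zpow_sub_one, MulAut.mul_apply]
        intro a h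
        have h2 : ψ (-n - 1) h = (φ (T⁻¹ h))⁻¹ * ψ (-n) (T⁻¹ h) := by
          change ((τ ^ (-(n : ℤ) - 1)) ⟨1, h⟩).phase = _
          rw [h1, one_mul]
        rw [h1, h2, mul_assoc]
    exact key a h
  have hψadd (n m : ℤ) (h : G) : ψ (n + m) h = ψ m h * ψ n ((T ^ m) h) := by
    have := hψ (n + m) 1 h
    rw [zpow_add, MulAut.mul_apply, hψ, hψ] at this
    simpa using (congrArg CentralExt.phase this).symm
  have hψmul (n : ℤ) (g h : G) :
      ψ n (g * h) * ω g h = ψ n g * ψ n h * ω ((T ^ n) g) ((T ^ n) h) := by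
    have := map_mul (τ ^ n) ⟨1, g⟩ ⟨1, h⟩
    rw [mul_def, mul_def, hψ, hψ, hψ] at this
    simpa [mul_comm] using congrArg CentralExt.phase this
  have hψ0 (h : G) : ψ 0 h = 1 := by simp [ψ]
  have hψ1 (h : G) : ψ 1 h = φ h := by simp [ψ, hτ]
  -- This is the cocycle of the section `(g, n) ↦ ((1, g), n)`, read off from the product `(1, g) ·
  -- τⁿ(1, h)`.
  refine ⟨fun x y => ψ (Multiplicative.toAdd x.right) y.left *
    ω x.left ((T ^ Multiplicative.toAdd x.right) y.left), ?_, ?_, ?_⟩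
  · rintro ⟨g, n⟩ ⟨h, m⟩ ⟨k, l⟩
    obtain ⟨n, rfl⟩ := Multiplicative.ofAdd.surjective n
    obtain ⟨m, rfl⟩ := Multiplicative.ofAdd.surjective m
    simp only [SemidirectProduct.mul_left, SemidirectProduct.mul_right, toAdd_mul, toAdd_ofAdd,
      zpowersHom_apply, hψadd, map_mul, zpow_add, MulAut.mul_apply]
    have h1 := hψmul n h ((T ^ m) k)
    have h2 := hω g ((T ^ n) h) ((T ^ n) ((T ^ m) k))
    calc _ = ψ m k * ψ n ((T ^ m) k) * ψ n h * (ω (g * (T ^ n) h) ((T ^ n) ((T ^ m) k)) *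
            ω g ((T ^ n) h)) := by ac_rfl
      _ = ψ m k * (ψ n h * ψ n ((T ^ m) k) * ω ((T ^ n) h) ((T ^ n) ((T ^ m) k))) *
            ω g ((T ^ n) h * (T ^ n) ((T ^ m) k)) := by rw [h2]; ac_rfl
      _ = _ := by rw [← h1]; ac_rfl
  · intro g h
    simp [hψ0]
  · intro g
    simp [hψ1, hψ0, hω.one_left, hω.one_right]

lemma Extends.isCocycle {f : FullGroup T → FullGroup T → Circle} (hf : IsCocycle f)
    {ω : G → G → Circle} {φ : G → Circle} (h : Extends T f ω φ) : IsCocycle ω := by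
  intro a b c
  simpa only [← map_mul, h.1] using
    hf (SemidirectProduct.inl a) (SemidirectProduct.inl b) (SemidirectProduct.inl c)

open SemidirectProduct FullGroup in
-- Translation can be moved past `ab` at once or past `a` and `b` in turn. The cocycle identity for
-- `(t, a, b)`, `(Ta, t, b)` and `(Ta, Tb, t)` equates the two phases.
lemma Extends.compat {f : FullGroup T → FullGroup T → Circle} (hf : IsCocycle f)
    {ω : G → G → Circle} {φ : G → Circle} (h : Extends T f ω φ) : Compat T ω φ := by
  intro a b
  have h1 := hf (t T) (inl a) (inl b)
  have h2 := hf (inl (T a)) (t T) (inl b)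
  have h3 := hf (inl (T a)) (inl (T b)) (t T)
  rw [t_mul_inl, ← map_mul, h.1, h.2, h.2] at h1
  rw [t_mul_inl, h.2] at h2
  rw [← map_mul, ← map_mul, h.1] at h3
  refine mul_right_cancel (b := f (inl (T (a * b))) (t T)) ?_
  calc _ = ω a b * (φ (a * b) * f (inl (T (a * b))) (t T)) := by ac_rfl
    _ = φ a * (f (inl (T a) * t T) (inl b) * f (inl (T a)) (t T)) := by rw [← h1]; ac_rfl
    _ = φ a * φ b * (f (inl (T b)) (t T) * f (inl (T a)) (inl (T b) * t T)) := by
      rw [h2]; ac_rfl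
    _ = _ := by rw [← h3]; ac_rfl

/-- The class `x` of the full group is given by the bond cocycle `ω` and phases `φ`. -/
def Encodes (T : MulAut G) (x : groupCohomology.H2 (U1 (FullGroup T))) (ω : G → G → Circle)
    (φ : G → Circle) : Prop :=
  ∃ f, Represents f x ∧ Extends T f ω φ

lemma exists_encodes {ω : G → G → Circle} (hω : IsCocycle ω) {φ : G → Circle}
    (hφ : Compat T ω φ) : ∃ x, Encodes T x ω φ := by
  obtain ⟨f, hf, h⟩ := hω.exists_extends hφ
  obtain ⟨x, hx⟩ := hf.exists_represents
  exact ⟨x, f, hx, h⟩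

lemma exists_encodes_of_class (x : groupCohomology.H2 (U1 (FullGroup T))) :
    ∃ ω φ, IsCocycle ω ∧ Compat T ω φ ∧ Encodes T x ω φ := by
  obtain ⟨f, hf⟩ := exists_represents x
  have h : Extends T f (fun g h => f (SemidirectProduct.inl g) (SemidirectProduct.inl h))
      (fun g => f (FullGroup.t T) (SemidirectProduct.inl g) /
        f (SemidirectProduct.inl (T g)) (FullGroup.t T)) :=
    ⟨fun _ _ => rfl, fun g => by simp⟩
  exact ⟨_, _, h.isCocycle hf.isCocycle, h.compat hf.isCocycle, f, hf, h⟩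

variable {x x' : groupCohomology.H2 (U1 (FullGroup T))} {ω ω' : G → G → Circle}
  {φ φ' : G → Circle}

lemma Encodes.compat (h : Encodes T x ω φ) : Compat T ω φ := by
  obtain ⟨f, hf, h⟩ := h
  exact h.compat hf.isCocycle

lemma encodes_zero : Encodes T (0 : groupCohomology.H2 (U1 (FullGroup T)))
    (fun _ _ => 1) (fun _ => 1) :=
  ⟨_, represents_one_zero, fun _ _ => rfl, fun _ => by simp⟩

lemma Encodes.add (h : Encodes T x ω φ) (h' : Encodes T x' ω' φ') :
    Encodes T (x + x') (fun g h => ω g h * ω' g h) (fun g => φ g * φ' g) := by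
  obtain ⟨f, hf, h⟩ := h
  obtain ⟨f', hf', h'⟩ := h'
  refine ⟨_, hf.add hf', fun a b => by simp only [h.1, h'.1], fun a => ?_⟩
  simp only [h.2, h'.2]
  ac_rfl

/-- Two encodings give the same class iff they differ by a change of the bond phases. -/
lemma Encodes.eq_iff (h : Encodes T x ω φ) (h' : Encodes T x' ω' φ') :
    x = x' ↔ ∃ z : G → Circle, (∀ a b, ω a b * z (a * b) = z a * z b * ω' a b) ∧
      ∀ a, φ a * z (T a) = z a * φ' a := by
  obtain ⟨f, hf, h⟩ := h
  obtain ⟨f', hf', h'⟩ := h'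
  rw [hf.eq_iff hf']
  constructor
  · rintro ⟨b, hb⟩
    refine ⟨fun g => b (SemidirectProduct.inl g), fun g k => ?_, fun g => ?_⟩
    · beta_reduce
      rw [← h.1, hb, h'.1, ← map_mul, mul_assoc, div_mul_cancel, mul_comm]
    · have h1 := h.2 g
      -- Because `t g = T(g) t`, the values of `b` at `t` and at `t g` occur on both sides and
      -- cancel; only `b` on `G` survives.
      rw [hb, hb, h'.2, ← FullGroup.t_mul_inl] at h1
      refine mul_right_cancel (b := f' (SemidirectProduct.inl (T g)) (FullGroup.t T) *
        (b (FullGroup.t T) / b (FullGroup.t T * SemidirectProduct.inl g))) ?_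
      simp only [div_eq_mul_inv] at h1 ⊢
      calc _ = φ g * (f' (SemidirectProduct.inl (T g)) (FullGroup.t T) *
          (b (SemidirectProduct.inl (T g)) * b (FullGroup.t T) *
            (b (FullGroup.t T * SemidirectProduct.inl g))⁻¹)) := by ac_rfl
        _ = _ := by rw [← h1]; ac_rfl
  · rintro ⟨z, hz₁, hz₂⟩
    -- The quotient cocycle is trivialized on `G` by `z`, compatibly with translation, hence is a
    -- coboundary on the whole group.
    have hc : IsCocycle (fun a b => f a b / f' a b) := fun a b c => by
      have h1 := hf.isCocycle a b c
      have h2 := hf'.isCocycle a b c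
      simp only [div_mul_div_comm, h1, h2]
    obtain ⟨b, hb⟩ := hc.isCoboundary_of_restrict z (fun g k => by
      rw [h.1, h'.1, div_eq_div_iff_mul_eq_mul, hz₁]) (fun g => by
      rw [h.2, h'.2, div_mul_eq_mul_div, ← mul_div_assoc, div_eq_div_iff_mul_eq_mul]
      calc _ = (φ g * z (T g)) * f (SemidirectProduct.inl (T g)) (FullGroup.t T) *
            f' (SemidirectProduct.inl (T g)) (FullGroup.t T) := by ac_rfl
        _ = _ := by rw [hz₂]; ac_rfl)
    exact ⟨b, fun a c => by rw [← hb, mul_div_cancel]⟩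

/-- Multiplication by the coboundary of `(g, n) ↦ z g`. Its value at `t` is `z 1`, which drops out
of the ratio that defines the phases. -/
lemma Encodes.twist (h : Encodes T x ω φ) (z : G → Circle) :
    Encodes T x (fun a b => ω a b * (z a * z b / z (a * b))) (fun a => φ a * (z a / z (T a))) := by
  obtain ⟨f, hf, h⟩ := h
  refine ⟨_, hf.mul_coboundary (fun y => z y.left), fun a b => by simp [h.1], fun a => ?_⟩
  simp only [h.2, div_eq_mul_inv, SemidirectProduct.left_inr, SemidirectProduct.left_inl,
    ← FullGroup.t_mul_inl]
  simp
  ac_rfl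

lemma Encodes.pullback (h : Encodes T x ω φ) :
    Represents ω (H2pullback (SemidirectProduct.inl : G →* FullGroup T) x) := by
  obtain ⟨f, hf, h⟩ := h
  have := hf.pullback (SemidirectProduct.inl : G →* FullGroup T)
  simpa only [h.1] using this

lemma compat_one (φ : G →* Circle) : Compat T (fun _ _ => 1) φ := fun g h => by simp

/-- The inflation of characters to classes of the full group. -/
lemma exists_iota (T : MulAut G) :
    ∃ ι : Additive (WeakSPTGroup T) →+ groupCohomology.H2 (U1 (FullGroup T)),
      ∀ φ : G →* Circle, Encodes T (ι (Additive.ofMul (QuotientGroup.mk φ))) (fun _ _ => 1) φ := by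
  have hone : IsCocycle (fun _ _ : G => (1 : Circle)) := fun _ _ _ => rfl
  choose F hF using fun φ : G →* Circle => exists_encodes (T := T) hone (compat_one φ)
  have hmul (φ ψ : G →* Circle) : F (φ * ψ) = F φ + F ψ :=
    ((hF _).eq_iff ((hF φ).add (hF ψ))).2 ⟨fun _ => 1, by simp, by simp⟩
  let f : (G →* Circle) →* Multiplicative (groupCohomology.H2 (U1 (FullGroup T))) :=
    MonoidHom.mk' (fun φ => Multiplicative.ofAdd (F φ)) fun φ ψ => by rw [hmul]; rfl
  have hf : (translationDefect T).range ≤ f.ker := by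
    rintro _ ⟨φ, rfl⟩
    -- Rescaling the bond phases by `φ⁻¹` keeps the bond cocycle trivial and removes `φ ∘ T / φ`.
    refine ((hF _).eq_iff encodes_zero).2 ⟨fun g => (φ g)⁻¹, ?_, fun g => ?_⟩
    · intro a b
      simp [mul_comm]
    · change φ (T g) / φ g * (φ (T g))⁻¹ = _
      rw [div_mul_eq_mul_div, mul_inv_cancel, one_div, mul_one]
  let f' := QuotientGroup.lift _ f hf
  refine ⟨AddMonoidHom.mk' (fun a => Multiplicative.toAdd (f' (Additive.toMul a))) fun a b => ?_,
    fun φ => hF φ⟩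
  rw [toMul_add, map_mul, toAdd_mul]

lemma translation_class {φ φ' : G →* Circle} {z : G →* Circle}
    (h : ∀ a, φ a * z (T a) = z a * φ' a) :
    (QuotientGroup.mk φ : WeakSPTGroup T) = QuotientGroup.mk φ' := by
  refine QuotientGroup.eq.2 ⟨z, ?_⟩
  ext1 a
  change z (T a) / z a = (φ a)⁻¹ * φ' a
  rw [div_eq_iff_eq_mul, eq_comm, mul_assoc, inv_mul_eq_iff_eq_mul, h, mul_comm]

/-- Classes that restrict to a trivial class on `G` come from characters. -/
lemma Encodes.exists_character (h : Encodes T x ω φ)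
    (h0 : H2pullback (SemidirectProduct.inl : G →* FullGroup T) x = 0) :
    ∃ (z : G → Circle) (χ : G →* Circle), (∀ a b, ω a b * (z a * z b) = z (a * b)) ∧
      (∀ a, χ a = φ a * (z a / z (T a))) ∧ Encodes T x (fun _ _ => 1) χ := by
  obtain ⟨b, hb⟩ := (h.pullback.eq_iff represents_one_zero).1 h0
  have h1 := h.twist fun a => (b a)⁻¹
  have hω : (fun a c => ω a c * ((b a)⁻¹ * (b c)⁻¹ / (b (a * c))⁻¹)) = fun _ _ => (1 : Circle) := by
    funext a c
    rw [hb, one_mul, ← mul_inv, ← inv_div', mul_inv_cancel]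
  rw [hω] at h1
  refine ⟨fun a => (b a)⁻¹, MonoidHom.mk' (fun a => φ a * ((b a)⁻¹ / (b (T a))⁻¹)) fun a c => ?_,
    fun a c => ?_, fun a => rfl, h1⟩
  · simpa using h1.compat a c
  · rw [hb, one_mul, ← mul_inv, div_mul_eq_mul_div, mul_inv_cancel, one_div]

/-- The exact sequence `0 → W → H²(G ⋊ ℤ, U(1)) → H²(G, U(1))^T → 0`. -/
lemma iota_exact {ι : Additive (WeakSPTGroup T) →+ groupCohomology.H2 (U1 (FullGroup T))}
    (hι : ∀ φ : G →* Circle,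
      Encodes T (ι (Additive.ofMul (QuotientGroup.mk φ))) (fun _ _ => 1) φ) :
    Function.Injective ι ∧
      (∀ x : groupCohomology.H2 (U1 (FullGroup T)),
        H2pullback (SemidirectProduct.inl : G →* FullGroup T) x = 0 ↔ ∃ y, ι y = x) ∧
      (∀ z : groupCohomology.H2 (U1 G),
        H2pullback T.toMonoidHom z = z ↔
          ∃ x, H2pullback (SemidirectProduct.inl : G →* FullGroup T) x = z) := by
  refine ⟨?_, ?_, ?_⟩
  · intro a b hab
    obtain ⟨φ, hφ⟩ := QuotientGroup.mk_surjective (Additive.toMul a)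
    obtain ⟨ψ, hψ⟩ := QuotientGroup.mk_surjective (Additive.toMul b)
    have h1 := hι φ
    have h2 := hι ψ
    rw [hφ] at h1
    rw [hψ] at h2
    obtain ⟨z, hz₁, hz₂⟩ := (h1.eq_iff h2).1 hab
    -- Both bond cocycles are `1`, so the rescaling `z` between the encodings is itself a character.
    have := translation_class (z := MonoidHom.mk' z fun a b => by simpa using hz₁ a b) hz₂
    rw [hφ, hψ] at this
    exact congrArg Additive.ofMul this
  · intro x
    constructor
    · intro h
      obtain ⟨ω, φ, hω, hφ, he⟩ := exists_encodes_of_class x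
      obtain ⟨z, χ, -, -, he'⟩ := he.exists_character h
      exact ⟨_, ((hι χ).eq_iff he').2 ⟨fun _ => 1, by simp, by simp⟩⟩
    · rintro ⟨y, rfl⟩
      obtain ⟨φ, hφ⟩ := QuotientGroup.mk_surjective (Additive.toMul y)
      have h1 := hι φ
      rw [hφ] at h1
      exact (h1.pullback.eq_iff represents_one_zero).2 ⟨fun _ => 1, by simp⟩
  · intro y
    obtain ⟨ω, hω⟩ := exists_represents y
    constructor
    · intro h
      -- A cochain relating `ω` to `T^*ω` is the same thing as phases compatible with `ω`, so an
      -- invariant class extends to the semidirect product.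
      obtain ⟨φ, hφ⟩ := (hω.eq_iff (hω.pullback T.toMonoidHom)).1 h.symm
      have hc : Compat T ω φ := fun a b => by
        rw [hφ, mul_comm, mul_assoc, div_mul_cancel, mul_comm]
        rfl
      obtain ⟨x, hx⟩ := exists_encodes hω.isCocycle hc
      exact ⟨x, (hx.pullback.eq_iff hω).2 ⟨fun _ => 1, by simp⟩⟩
    · rintro ⟨x, rfl⟩
      obtain ⟨ω', φ, hω', hφ, he⟩ := exists_encodes_of_class x
      refine ((he.pullback.pullback T.toMonoidHom).eq_iff he.pullback).2
        ⟨fun a => (φ a)⁻¹, fun a b => ?_⟩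
      have := hφ a b
      change ω' (T a) (T b) = _
      rw [div_inv_eq_mul, ← mul_inv, mul_comm (_)⁻¹, ← mul_assoc, eq_mul_inv_iff_mul_eq,
        mul_comm (ω' a b), this, mul_comm]

end Semidirect

/-! ### Powers of linear maps in finite dimension -/

section Powers

open Filter Topology

variable {V : Type*} [NormedAddCommGroup V] [NormedSpace ℂ V]

/-- Gelfand's formula bounds `‖aⁿ‖` eventually by `rⁿ` for some `r` strictly between the spectral
radius and `1`. -/
lemma tendsto_norm_pow_zero {A : Type*} [NormedRing A] [NormedAlgebra ℂ A] [CompleteSpace A]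
    (a : A) (h : spectralRadius ℂ a < 1) : Tendsto (fun n => a ^ n) atTop (𝓝 0) := by
  obtain ⟨r, hr, hr1⟩ := ENNReal.lt_iff_exists_nnreal_btwn.1 h
  have hr1' : r < 1 := by exact_mod_cast hr1
  have h1 := (spectrum.pow_nnnorm_pow_one_div_tendsto_nhds_spectralRadius a).eventually_lt_const hr
  refine squeeze_zero_norm' (a := fun n => (r : ℝ) ^ n) ?_
    (tendsto_pow_atTop_nhds_zero_of_lt_one r.2 (by exact_mod_cast hr1'))
  filter_upwards [h1, eventually_gt_atTop 0] with n hn h0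
  have h2 := ENNReal.rpow_le_rpow hn.le (Nat.cast_nonneg (α := ℝ) n)
  rw [← ENNReal.rpow_mul, one_div, inv_mul_cancel₀ (by positivity), ENNReal.rpow_one,
    ENNReal.rpow_natCast] at h2
  exact_mod_cast h2

/-- If all eigenvalues lie in the open unit disk then the powers tend to zero. -/
lemma tendsto_pow_zero_of_eigenvalues [FiniteDimensional ℂ V] (f : V →L[ℂ] V)
    (hf : ∀ (μ : ℂ) (x : V), x ≠ 0 → f x = μ • x → ‖μ‖ < 1) :
    Tendsto (fun n => f ^ n) atTop (𝓝 0) := by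
  have : CompleteSpace V := FiniteDimensional.complete ℂ V
  rcases subsingleton_or_nontrivial V with hV | hV
  · have : ∀ n, f ^ n = 0 := fun n => ContinuousLinearMap.ext fun x => Subsingleton.elim _ _
    simp [this]
  refine tendsto_norm_pow_zero f ?_
  refine spectrum.spectralRadius_lt_of_forall_lt (r := 1) f fun z hz => ?_
  have hz' : z ∈ spectrum ℂ (f : V →ₗ[ℂ] V) := by
    have h := AlgEquiv.spectrum_eq (Module.End.toContinuousLinearMap V (𝕜 := ℂ))
      (f : V →ₗ[ℂ] V)
    rw [← h]
    exact hz
  obtain ⟨x, hx⟩ := (Module.End.hasEigenvalue_iff_mem_spectrum.2 hz').exists_hasEigenvector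
  exact_mod_cast hf z x hx.2 hx.apply_eq_smul

/-! An operator near an idempotent. -/

variable {G P : V →L[ℂ] V}

/-- Since `(1 - P) P = 0`, one has `ν (1 - P) z = (1 - P)(G - P) z`: an eigenvector whose eigenvalue
is not small nearly lies in the range of `P`. -/
lemma norm_sub_apply_le_of_eigenvector (hP : P * P = P) (hG : (1 + ‖P‖) * ‖G - P‖ ≤ 1 / 8) {ν : ℂ}
    (hν : 1 / 2 < ‖ν‖) {z : V} (hz : G z = ν • z) : ‖z - P z‖ ≤ 1 / 3 * ‖P z‖ := by
  have hP' (x : V) : P (P x) = P x := DFunLike.congr_fun hP x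
  have h1 : ν • (z - P z) = (G - P) z - P ((G - P) z) := by
    simp [hz, hP', smul_sub]
  have h2 : ‖ν‖ * ‖z - P z‖ ≤ (1 + ‖P‖) * ‖G - P‖ * ‖z‖ := by
    rw [← norm_smul, h1]
    calc _ ≤ ‖(G - P) z‖ + ‖P‖ * ‖(G - P) z‖ :=
          (norm_sub_le _ _).trans (by gcongr; exact P.le_opNorm _)
      _ = (1 + ‖P‖) * ‖(G - P) z‖ := by ring
      _ ≤ (1 + ‖P‖) * (‖G - P‖ * ‖z‖) := by gcongr; exact (G - P).le_opNorm z
      _ = _ := by ring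
  have h3 : ‖z‖ ≤ ‖P z‖ + ‖z - P z‖ := by simpa using norm_add_le (P z) (z - P z)
  nlinarith [norm_nonneg z, norm_nonneg (z - P z)]

/-- The two eigenvalues may differ a priori. Applying `P` to the eigenvalue equations bounds `|μ -
ν| ‖P z‖` by a small multiple of `‖y - z‖`; inserting this in the equation for `y - z` gives `‖μ‖ ‖y
- z‖ ≤ ‖y - z‖ / 6`, which contradicts `1 / 2 < ‖μ‖` unless `y = z`. -/
lemma eq_of_eigenvectors (hP : P * P = P) (hG : (1 + ‖P‖) * ‖G - P‖ ≤ 1 / 8) {μ ν : ℂ}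
    (hμ : 1 / 2 < ‖μ‖) (hν : 1 / 2 < ‖ν‖) {y z : V} (hy : G y = μ • y) (hz : G z = ν • z)
    (h : P y = P z) : y = z := by
  have hP' (x : V) : P (P x) = P x := DFunLike.congr_fun hP x
  have hb := norm_sub_apply_le_of_eigenvector hP hG hν hz
  have hz' : ‖z‖ ≤ 4 / 3 * ‖P z‖ := by
    have : ‖z‖ ≤ ‖P z‖ + ‖z - P z‖ := by simpa using norm_add_le (P z) (z - P z)
    linarith
  have h0 : P (y - z) = 0 := by rw [map_sub, h, sub_self]
  have h1 : (μ - ν) • P z = P ((G - P) (y - z)) := by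
    simp [hy, hz, h, sub_smul]
  have h2 : ‖μ - ν‖ * ‖P z‖ ≤ ‖P‖ * ‖G - P‖ * ‖y - z‖ := by
    rw [← norm_smul, h1]
    calc _ ≤ ‖P‖ * ‖(G - P) (y - z)‖ := P.le_opNorm _
      _ ≤ ‖P‖ * (‖G - P‖ * ‖y - z‖) := by gcongr; exact (G - P).le_opNorm _
      _ = _ := by ring
  have h3 : μ • (y - z) = (G - P) (y - z) - (μ - ν) • z := by
    rw [sub_apply, h0, map_sub, hy, hz, smul_sub, sub_smul]
    abel
  have h4 : ‖μ‖ * ‖y - z‖ ≤ ‖G - P‖ * ‖y - z‖ + ‖μ - ν‖ * ‖z‖ := by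
    rw [← norm_smul μ (y - z), ← norm_smul (μ - ν) z, h3]
    exact (norm_sub_le _ _).trans (by gcongr; exact (G - P).le_opNorm _)
  have h5 : ‖μ - ν‖ * ‖z‖ ≤ 4 / 3 * (‖P‖ * ‖G - P‖ * ‖y - z‖) := by
    calc _ ≤ ‖μ - ν‖ * (4 / 3 * ‖P z‖) := by gcongr
      _ = 4 / 3 * (‖μ - ν‖ * ‖P z‖) := by ring
      _ ≤ _ := by gcongr
  have h6 : ‖G - P‖ * ‖y - z‖ + 4 / 3 * (‖P‖ * ‖G - P‖ * ‖y - z‖) ≤ 1 / 6 * ‖y - z‖ := by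
    calc _ ≤ 4 / 3 * ((1 + ‖P‖) * ‖G - P‖ * ‖y - z‖) := by
          have : 0 ≤ ‖G - P‖ * ‖y - z‖ := by positivity
          linarith
      _ ≤ 4 / 3 * (1 / 8 * ‖y - z‖) := by gcongr
      _ = _ := by ring
  have h7 : ‖y - z‖ = 0 := by
    have h8 := mul_le_mul_of_nonneg_right hμ.le (norm_nonneg (y - z))
    have := norm_nonneg (y - z)
    linarith
  exact sub_eq_zero.1 (norm_eq_zero.1 h7)

/-- The cone `‖x - P x‖ ≤ ‖P x‖` contains `e`, is mapped into itself by `G`, and `‖P x‖` shrinks on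
it at most by the factor `3 / 4` per step. This is incompatible with all eigenvalues having modulus
at most `1 / 2`. -/
lemma exists_eigenvector_of_near_idempotent [FiniteDimensional ℂ V] (hP : P * P = P)
    (hG : (1 + ‖P‖) * ‖G - P‖ ≤ 1 / 8) {e : V} (he : e ≠ 0) (hPe : P e = e) :
    ∃ (μ : ℂ) (y : V), y ≠ 0 ∧ G y = μ • y ∧ 1 / 2 < ‖μ‖ := by
  by_contra! hcon
  have hP' (x : V) : P (P x) = P x := DFunLike.congr_fun hP x
  -- The factor `5 / 3` brings eigenvalues of modulus at most `1 / 2` to at most `5 / 6 < 1`, while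
  -- the growth on the cone becomes `5 / 4 > 1`.
  have hlim : Tendsto (fun n => ((5 / 3 : ℂ) • G) ^ n) atTop (𝓝 0) := by
    refine tendsto_pow_zero_of_eigenvalues _ fun μ x hx hxe => ?_
    have h1 : G x = ((3 / 5 : ℂ) * μ) • x := by
      rw [mul_smul, ← hxe, smul_apply, smul_smul]
      norm_num
    have h2 := hcon _ x hx h1
    rw [norm_mul] at h2
    norm_num at h2
    linarith
  have hstep (x : V) (hx : ‖x - P x‖ ≤ ‖P x‖) :
      ‖G x - P (G x)‖ ≤ ‖P (G x)‖ ∧ 3 / 4 * ‖P x‖ ≤ ‖P (G x)‖ := by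
    have hx2 : ‖x‖ ≤ 2 * ‖P x‖ := by
      have : ‖x‖ ≤ ‖P x‖ + ‖x - P x‖ := by simpa using norm_add_le (P x) (x - P x)
      linarith
    have h0 : (1 + ‖P‖) * ‖(G - P) x‖ ≤ 1 / 4 * ‖P x‖ := by
      calc _ ≤ (1 + ‖P‖) * (‖G - P‖ * ‖x‖) := by gcongr; exact (G - P).le_opNorm x
        _ = (1 + ‖P‖) * ‖G - P‖ * ‖x‖ := by ring
        _ ≤ 1 / 8 * (2 * ‖P x‖) := by gcongr
        _ = _ := by ring
    have h1 : G x - P (G x) = (G - P) x - P ((G - P) x) := by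
      simp [hP']
    have h2 : P x = P (G x) - P ((G - P) x) := by simp [hP']
    have hle := P.le_opNorm ((G - P) x)
    have hn := norm_nonneg ((G - P) x)
    have h3 : ‖G x - P (G x)‖ ≤ 1 / 4 * ‖P x‖ := by
      rw [h1]
      refine (norm_sub_le _ _).trans ?_
      linarith
    have h4 : ‖P x‖ ≤ ‖P (G x)‖ + 1 / 4 * ‖P x‖ := by
      conv_lhs => rw [h2]
      refine (norm_sub_le _ _).trans ?_
      linarith
    constructor <;> linarith [norm_nonneg (P x)]
  have hiter (n : ℕ) : ‖(G ^ n) e - P ((G ^ n) e)‖ ≤ ‖P ((G ^ n) e)‖ ∧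
      (3 / 4) ^ n * ‖e‖ ≤ ‖P ((G ^ n) e)‖ := by
    induction n with
    | zero => simp [hPe]
    | succ n ih =>
      rw [pow_succ', mul_apply_eq_comp]
      refine ⟨(hstep _ ih.1).1, ?_⟩
      calc (3 / 4) ^ (n + 1) * ‖e‖ = 3 / 4 * ((3 / 4) ^ n * ‖e‖) := by ring
        _ ≤ 3 / 4 * ‖P ((G ^ n) e)‖ := by gcongr; exact ih.2
        _ ≤ _ := (hstep _ ih.1).2
  have hlim2 : Tendsto (fun n => ‖P ((((5 / 3 : ℂ) • G) ^ n) e)‖) atTop (𝓝 0) := by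
    have hc : Continuous fun F : V →L[ℂ] V => ‖P (F e)‖ := by fun_prop
    have h := (hc.tendsto 0).comp hlim
    rwa [zero_apply, map_zero, norm_zero] at h
  have hlow (n : ℕ) : ‖e‖ ≤ ‖P ((((5 / 3 : ℂ) • G) ^ n) e)‖ := by
    rw [smul_pow, smul_apply, map_smul, norm_smul, norm_pow]
    have h53 : ‖(5 / 3 : ℂ)‖ = 5 / 3 := by norm_num
    rw [h53]
    calc ‖e‖ ≤ (5 / 4) ^ n * ‖e‖ := by
          have : (1 : ℝ) ≤ (5 / 4) ^ n := one_le_pow₀ (by norm_num)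
          nlinarith [norm_nonneg e]
      _ = (5 / 3) ^ n * ((3 / 4) ^ n * ‖e‖) := by rw [← mul_assoc, ← mul_pow]; norm_num
      _ ≤ _ := by gcongr; exact (hiter n).2
  have := ge_of_tendsto' hlim2 hlow
  exact he (norm_le_zero_iff.1 this)

/-- A power bounded operator whose traces of powers tend to `1` has, together with all nearby
operators, a power with a unique eigenvector of dominant modulus. -/
theorem exists_dominant_eigenvector [FiniteDimensional ℂ V] (F₀ : V →L[ℂ] V) {C : ℝ} (hC : ∀ n, ‖F₀ ^ n‖ ≤ C)
    (htr : Tendsto (fun n => LinearMap.trace ℂ V (F₀ ^ n : V →L[ℂ] V)) atTop (𝓝 1)) {L : ℕ}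
    (hL : 1 ≤ L) :
    ∃ N : ℕ, 1 ≤ N ∧ L ∣ N ∧ ∀ᶠ F : V →L[ℂ] V in 𝓝 F₀, ∃ (μ : ℂ) (y : V), μ ≠ 0 ∧ y ≠ 0 ∧
      (F ^ N) y = μ • y ∧
      ∀ (ν : ℂ) (z : V), (F ^ N) z = ν • z → ‖ν‖ = ‖μ‖ → ∃ c : ℂ, z = c • y := by
  have : ProperSpace (V →L[ℂ] V) := FiniteDimensional.proper ℂ _
  let u : ℕ → V →L[ℂ] V := fun k => F₀ ^ (L * k)
  have hball : IsCompact (Metric.closedBall (0 : V →L[ℂ] V) C) := isCompact_closedBall _ _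
  have hu (k : ℕ) : u k ∈ Metric.closedBall (0 : V →L[ℂ] V) C := by simp [u, hC]
  -- The limit points of the powers `F₀^(L k)` form a nonempty compact semigroup, which therefore
  -- contains an idempotent.
  let S : Set (V →L[ℂ] V) := {P | MapClusterPt P atTop u}
  have hSc : IsClosed S := isClosed_setOfPred_clusterPt
  have hScomp : IsCompact S := hball.of_isClosed_subset hSc fun P hP =>
    hball.isClosed.mem_of_mapClusterPt (f := u) (b := atTop) hP (Eventually.of_forall hu)
  have hSne : S.Nonempty := by
    obtain ⟨P, -, hP⟩ := hball.exists_mapClusterPt (u := u) (f := atTop)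
      (tendsto_principal.2 (Eventually.of_forall hu))
    exact ⟨P, hP⟩
  have hSmul : ∀ᵉ (P ∈ S) (Q ∈ S), P * Q ∈ S := by
    intro P hP Q hQ
    refine mapClusterPt_iff_frequently.2 fun s hs => ?_
    have hs' : ∀ᶠ p : (V →L[ℂ] V) × (V →L[ℂ] V) in 𝓝 P ×ˢ 𝓝 Q, p.1 * p.2 ∈ s := by
      rw [← nhds_prod_eq]
      exact (continuous_mul.tendsto (P, Q)).eventually hs
    obtain ⟨pa, ha, pb, hb, hab⟩ := eventually_prod_iff.1 hs'
    rw [frequently_atTop]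
    intro m
    obtain ⟨k, hk, hka⟩ := frequently_atTop.1 (hP.frequently ha) m
    obtain ⟨l, hl, hlb⟩ := frequently_atTop.1 (hQ.frequently hb) m
    refine ⟨k + l, by omega, ?_⟩
    have := hab hka hlb
    simpa [u, mul_add, pow_add] using this
  obtain ⟨P, hPS, hP⟩ := exists_idempotent_in_compact_subsemigroup
    (fun R : V →L[ℂ] V => continuous_mul_const R) S hSne hScomp hSmul
  -- The trace passes to limit points, and the trace of an idempotent is its rank, so `P` has rank
  -- one.
  have htrP : LinearMap.trace ℂ V P = 1 := by
    let τ : (V →L[ℂ] V) →ₗ[ℂ] ℂ := LinearMap.trace ℂ V ∘ₗ ContinuousLinearMap.coeLM ℂ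
    have hτ : Continuous τ := LinearMap.continuous_of_finiteDimensional τ
    have h1 : MapClusterPt (τ P) atTop (τ ∘ u) := hPS.continuousAt_comp hτ.continuousAt
    have h2 : Tendsto (τ ∘ u) atTop (𝓝 1) :=
      htr.comp (tendsto_id.const_mul_atTop' (by omega : 0 < L))
    have h3 : ClusterPt (τ P) (𝓝 1) := ClusterPt.mono h1 h2
    exact eq_of_nhds_neBot h3
  have hidem : IsIdempotentElem (P : V →ₗ[ℂ] V) :=
    LinearMap.ext fun x => DFunLike.congr_fun hP x
  have hrank : Module.finrank ℂ (LinearMap.range (P : V →ₗ[ℂ] V)) = 1 := by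
    have := (LinearMap.IsIdempotentElem.isProj_range _ hidem).trace
    rw [htrP] at this
    exact_mod_cast this.symm
  obtain ⟨⟨e, he⟩, he0, hspan⟩ := finrank_eq_one_iff'.1 hrank
  have he0' : e ≠ 0 := fun h => he0 (Subtype.ext h)
  have hPe : P e = e := by
    obtain ⟨x, rfl⟩ := he
    exact DFunLike.congr_fun hP x
  have hspan' (x : V) : ∃ c : ℂ, P x = c • e := by
    obtain ⟨c, hc⟩ := hspan ⟨P x, ⟨x, rfl⟩⟩
    exact ⟨c, (congrArg Subtype.val hc).symm⟩
  have hnear : ∀ᶠ Q : V →L[ℂ] V in 𝓝 P, (1 + ‖P‖) * ‖Q - P‖ < 1 / 8 := by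
    have : ContinuousAt (fun Q : V →L[ℂ] V => (1 + ‖P‖) * ‖Q - P‖) P := by fun_prop
    exact this.eventually_lt_const (by simp)
  -- One fixed power of `F₀` is close to `P`, and by continuity so is the same power of every nearby
  -- `F`. Starting at `1` keeps the exponent positive.
  obtain ⟨k, hk, hk2⟩ := frequently_atTop.1 (hPS.frequently hnear) 1
  refine ⟨L * k, Nat.mul_pos hL hk, dvd_mul_right _ _, ?_⟩
  have hcont : ContinuousAt (fun F : V →L[ℂ] V => (1 + ‖P‖) * ‖F ^ (L * k) - P‖) F₀ := by fun_prop
  filter_upwards [hcont.eventually_lt_const hk2] with F hF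
  obtain ⟨μ, y, hy0, hy, hμ⟩ := exists_eigenvector_of_near_idempotent hP hF.le he0' hPe
  have hμ0 : μ ≠ 0 := by
    rintro rfl
    norm_num at hμ
  refine ⟨μ, y, hμ0, hy0, hy, fun ν z hz hν => ?_⟩
  obtain ⟨a, ha⟩ := hspan' y
  obtain ⟨b, hb⟩ := hspan' z
  have ha0 : a ≠ 0 := by
    rintro rfl
    refine hy0 (eq_of_eigenvectors hP hF.le hμ hμ hy (z := 0) (by simp) ?_)
    rw [ha, zero_smul, map_zero]
  refine ⟨b / a, eq_of_eigenvectors hP hF.le (hν ▸ hμ) hμ hz (z := (b / a) • y) ?_ ?_⟩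
  · rw [map_smul, hy, smul_comm]
  · rw [map_smul, ha, hb, smul_smul, div_mul_cancel₀ _ ha0]

end Powers

/-! ### Mixed transfer maps -/

section Mix

open Filter Topology

variable {ι κ κ' : Type*} [Fintype ι] [Fintype κ] [Fintype κ'] [DecidableEq κ] [DecidableEq κ']

/-- The mixed transfer map `X ↦ ∑ₛ (A^s)† X B^s`. -/
def mix (A : ι → Matrix κ κ ℂ) (B : ι → Matrix κ' κ' ℂ) : Module.End ℂ (Matrix κ κ' ℂ) where
  toFun X := ∑ s, (A s)ᴴ * X * B s
  map_add' X Y := by simp [Matrix.mul_add, Matrix.add_mul, Finset.sum_add_distrib]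
  map_smul' c X := by simp [Finset.smul_sum]

/-- The transfer map `X ↦ ∑ₛ A^s X (A^s)†` for arbitrary index types. -/
def transferMap (A : ι → Matrix κ κ ℂ) : Module.End ℂ (Matrix κ κ ℂ) where
  toFun X := ∑ s, A s * X * (A s)ᴴ
  map_add' X Y := by simp [mul_add, add_mul, Finset.sum_add_distrib]
  map_smul' c X := by simp [Finset.smul_sum]

lemma mix_apply (A : ι → Matrix κ κ ℂ) (B : ι → Matrix κ' κ' ℂ) (X : Matrix κ κ' ℂ) :
    mix A B X = ∑ s, (A s)ᴴ * X * B s := rfl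

lemma transferMap_apply (A : ι → Matrix κ κ ℂ) (X : Matrix κ κ ℂ) :
    transferMap A X = ∑ s, A s * X * (A s)ᴴ := rfl

lemma mix_conjTranspose (A : ι → Matrix κ κ ℂ) (B : ι → Matrix κ' κ' ℂ) (X : Matrix κ κ' ℂ) :
    (mix A B X)ᴴ = mix B A Xᴴ := by
  simp [mix_apply, Matrix.conjTranspose_sum, Matrix.mul_assoc]

lemma trace_mul_transferMap (A : ι → Matrix κ κ ℂ) (X Y : Matrix κ κ ℂ) :
    (Y * transferMap A X).trace = (mix A A Y * X).trace := by
  simp only [mix_apply, transferMap_apply, Matrix.mul_sum, Matrix.sum_mul, Matrix.trace_sum]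
  refine Finset.sum_congr rfl fun s _ => ?_
  rw [← Matrix.mul_assoc, Matrix.trace_mul_comm]
  simp only [Matrix.mul_assoc]

lemma trace_mul_transferMap_pow (A : ι → Matrix κ κ ℂ) (X Y : Matrix κ κ ℂ) (n : ℕ) :
    (Y * (transferMap A ^ n) X).trace = ((mix A A ^ n) Y * X).trace := by
  induction n generalizing Y with
  | zero => simp
  | succ n ih =>
    rw [pow_succ', Module.End.mul_apply, trace_mul_transferMap, ih, ← Module.End.mul_apply,
      ← pow_succ]

/-- The operator Cauchy–Schwarz inequality for mixed transfer maps, with its defect. -/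
lemma mix_schwarz {A : ι → Matrix κ κ ℂ} (hA : ∑ s, (A s)ᴴ * A s = 1) (B : ι → Matrix κ' κ' ℂ)
    (X : Matrix κ κ' ℂ) :
    ∑ s, (A s * mix A B X - X * B s)ᴴ * (A s * mix A B X - X * B s) =
      mix B B (Xᴴ * X) - (mix A B X)ᴴ * mix A B X := by
  set Y := mix A B X with hY
  have h1 : ∑ s, Yᴴ * ((A s)ᴴ * A s) * Y = Yᴴ * Y := by
    rw [← Matrix.sum_mul, ← Matrix.mul_sum, hA, Matrix.mul_one]
  have h2 : ∑ s, Yᴴ * ((A s)ᴴ * X * B s) = Yᴴ * Y := by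
    rw [← Matrix.mul_sum, hY, mix_apply]
  have h3 : ∑ s, ((B s)ᴴ * Xᴴ * A s) * Y = Yᴴ * Y := by
    rw [← Matrix.sum_mul, hY, mix_conjTranspose, mix_apply B A]
  have h4 : ∑ s, (A s * Y - X * B s)ᴴ * (A s * Y - X * B s) =
      ∑ s, (Yᴴ * ((A s)ᴴ * A s) * Y - Yᴴ * ((A s)ᴴ * X * B s) - ((B s)ᴴ * Xᴴ * A s) * Y +
        (B s)ᴴ * (Xᴴ * X) * B s) := by
    refine Finset.sum_congr rfl fun s _ => ?_
    simp only [Matrix.conjTranspose_sub, Matrix.conjTranspose_mul, Matrix.sub_mul, Matrix.mul_sub,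
      Matrix.mul_assoc]
    abel
  rw [h4, Finset.sum_add_distrib, Finset.sum_sub_distrib, Finset.sum_sub_distrib, h1, h2, h3,
    mix_apply]
  abel

/-- A left-canonical tensor whose transfer map has the positive definite density matrix `ρ` as a
globally attracting fixed point. -/
structure Primitive (A : ι → Matrix κ κ ℂ) (ρ : Matrix κ κ ℂ) : Prop where
  left : ∑ s, (A s)ᴴ * A s = 1
  posDef : ρ.PosDef
  trace_eq : ρ.trace = 1
  tendsto : ∀ X, Tendsto (fun n => (transferMap A ^ n) X) atTop (𝓝 (X.trace • ρ))

lemma trace_transferMap {A : ι → Matrix κ κ ℂ} (hA : ∑ s, (A s)ᴴ * A s = 1) (X : Matrix κ κ ℂ) :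
    (transferMap A X).trace = X.trace := by
  have h : mix A A 1 = 1 := by simpa [mix_apply] using hA
  have := trace_mul_transferMap A X 1
  rwa [h, one_mul, one_mul] at this

lemma trace_transferMap_pow {A : ι → Matrix κ κ ℂ} (hA : ∑ s, (A s)ᴴ * A s = 1)
    (X : Matrix κ κ ℂ) (n : ℕ) : ((transferMap A ^ n) X).trace = X.trace := by
  induction n with
  | zero => simp
  | succ n ih => rw [pow_succ', Module.End.mul_apply, trace_transferMap hA, ih]

lemma continuous_end (f : Module.End ℂ (Matrix κ κ' ℂ)) : Continuous f :=
  LinearMap.continuous_of_finiteDimensional f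

lemma tendsto_entry {α : Type*} {l : Filter α} {f : α → Matrix κ κ' ℂ} {M : Matrix κ κ' ℂ}
    (h : Tendsto f l (𝓝 M)) (i : κ) (j : κ') : Tendsto (fun a => f a i j) l (𝓝 (M i j)) :=
  tendsto_pi_nhds.1 (tendsto_pi_nhds.1 h i) j

section Prim

variable {A : ι → Matrix κ κ ℂ} {ρ : Matrix κ κ ℂ}

lemma Primitive.fixed (h : Primitive A ρ) : transferMap A ρ = ρ := by
  have h1 := h.tendsto ρ
  rw [h.trace_eq, one_smul] at h1
  have h2 := ((continuous_end (transferMap A)).tendsto ρ).comp h1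
  have h3 := h1.comp (tendsto_add_atTop_nat 1)
  refine tendsto_nhds_unique h2 (h3.congr fun n => ?_)
  simp only [Function.comp_apply, pow_succ', Module.End.mul_apply]

lemma Primitive.mix_one (h : Primitive A ρ) : mix A A 1 = 1 := by
  simpa [mix_apply] using h.left

lemma Primitive.trace_mul_mix (h : Primitive A ρ) (Z : Matrix κ κ ℂ) :
    (ρ * mix A A Z).trace = (ρ * Z).trace := by
  rw [Matrix.trace_mul_comm, ← trace_mul_transferMap, h.fixed, Matrix.trace_mul_comm]

/-- The dual of the convergence to `ρ`: under the trace pairing, `mix A A` is the transpose of the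
transfer map, and matrix units test the entries. -/
lemma Primitive.tendsto_mix (h : Primitive A ρ) (Y : Matrix κ κ ℂ) :
    Tendsto (fun n => (mix A A ^ n) Y) atTop (𝓝 ((ρ * Y).trace • 1)) := by
  refine tendsto_pi_nhds.2 fun i => tendsto_pi_nhds.2 fun j => ?_
  have h1 := h.tendsto (Matrix.single j i 1)
  have hc : Continuous fun Z : Matrix κ κ ℂ => (Y * Z).trace := by fun_prop
  have h2 := (hc.tendsto _).comp h1
  have h3 : (Y * ((Matrix.single j i (1 : ℂ)).trace • ρ : Matrix κ κ ℂ)).trace =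
      ((ρ * Y).trace • (1 : Matrix κ κ ℂ)) i j := by
    rw [Matrix.mul_smul, Matrix.trace_smul, Matrix.trace_mul_comm Y]
    rcases eq_or_ne i j with rfl | hij
    · simp
    · simp [Matrix.trace_single_eq_of_ne _ _ _ hij.symm, hij]
  rw [h3] at h2
  refine h2.congr fun n => ?_
  simp only [Function.comp_apply]
  rw [trace_mul_transferMap_pow, Matrix.trace_mul_single]
  simp

lemma Primitive.nonempty (h : Primitive A ρ) : Nonempty κ := by
  by_contra hne
  rw [not_nonempty_iff] at hne
  have := h.trace_eq
  rw [Matrix.trace_eq_zero_of_isEmpty] at this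
  exact zero_ne_one this

/-- A unimodular eigenvector of a power of the dual transfer map is a scalar. -/
lemma Primitive.eq_smul_one (h : Primitive A ρ) {L : ℕ} (hL : 1 ≤ L) {W : Matrix κ κ ℂ} {p : ℂ}
    (hp : ‖p‖ = 1) (hW : (mix A A ^ L) W = p • W) : ∃ c : ℂ, W = c • 1 := by
  have h1 (n : ℕ) : (mix A A ^ (L * n)) W = p ^ n • W := by
    induction n with
    | zero => simp
    | succ n ih =>
      rw [mul_add, mul_one, pow_add, Module.End.mul_apply, hW, map_smul, ih, smul_smul, pow_succ']
  have h2 := (h.tendsto_mix W).comp (tendsto_id.const_mul_atTop' (by omega : 0 < L))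
  have h3 : Tendsto (fun n => p ^ n • W) atTop (𝓝 ((ρ * W).trace • 1)) :=
    h2.congr fun n => by simp [h1]
  -- The iterates `pⁿ W` converge to a scalar matrix, yet their entries and the differences of their
  -- diagonal entries have constant modulus.
  have hoff (i j : κ) (hij : i ≠ j) : W i j = 0 := by
    have h5 := (tendsto_entry h3 i j).norm
    simp only [Matrix.smul_apply, norm_smul, norm_pow, hp, one_pow, one_mul,
      Matrix.one_apply_ne hij, norm_zero, mul_zero] at h5
    exact norm_eq_zero.1 (tendsto_nhds_unique tendsto_const_nhds h5)
  have hdiag (i j : κ) : W i i = W j j := by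
    have h5 := ((tendsto_entry h3 i i).sub (tendsto_entry h3 j j)).norm
    simp only [Matrix.smul_apply, ← smul_sub, norm_smul, norm_pow, hp, one_pow,
      one_mul, Matrix.one_apply_eq, sub_self, norm_zero] at h5
    exact sub_eq_zero.1 (norm_eq_zero.1 (tendsto_nhds_unique tendsto_const_nhds h5))
  obtain ⟨i₀⟩ := h.nonempty
  refine ⟨W i₀ i₀, ?_⟩
  ext i j
  rcases eq_or_ne i j with rfl | hij
  · simp [hdiag i i₀]
  · simp [hoff i j hij, hij]

end Prim

open scoped MatrixOrder in
/-- The weighted Hilbert–Schmidt norm of a positive definite weight. -/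
lemma exists_weight {ρ : Matrix κ' κ' ℂ} (hρ : ρ.PosDef) : ∃ K K' : Matrix κ' κ' ℂ, K * K' = 1 ∧
    ∀ Z : Matrix κ κ' ℂ, (ρ * (Zᴴ * Z)).trace = ((∑ i, ∑ j, ‖(Z * K) i j‖ ^ 2 : ℝ) : ℂ) := by
  obtain ⟨C, hC⟩ := CStarAlgebra.nonneg_iff_eq_star_mul_self.1 hρ.posSemidef.nonneg
  have hC' : ρ = Cᴴ * C := hC
  have hu : IsUnit (Cᴴ * C) := hC' ▸ hρ.isUnit
  obtain ⟨D, hD⟩ := hu.exists_right_inv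
  refine ⟨Cᴴ, C * D, by rw [← mul_assoc, hD], fun Z => ?_⟩
  have h1 : (ρ * (Zᴴ * Z)).trace = ((Z * Cᴴ) * (Z * Cᴴ)ᴴ).trace := by
    rw [hC', Matrix.trace_mul_comm, Matrix.mul_assoc, Matrix.trace_mul_comm,
      Matrix.conjTranspose_mul, Matrix.conjTranspose_conjTranspose]
    simp only [Matrix.mul_assoc]
  rw [h1]
  simp only [Matrix.trace, Matrix.diag, Matrix.mul_apply (M := Z * Cᴴ),
    Matrix.conjTranspose_apply (Z * Cᴴ)]
  push_cast
  refine Finset.sum_congr rfl fun i _ => Finset.sum_congr rfl fun j _ => ?_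
  exact Complex.mul_conj' _

lemma trace_weight_nonneg {ρ : Matrix κ' κ' ℂ} (hρ : ρ.PosDef) (Z : Matrix κ κ' ℂ) :
    0 ≤ (ρ * (Zᴴ * Z)).trace.re := by
  obtain ⟨K, K', -, h⟩ := exists_weight (κ := κ) hρ
  rw [h, Complex.ofReal_re]
  positivity

lemma eq_zero_of_trace_weight {ρ : Matrix κ' κ' ℂ} (hρ : ρ.PosDef) {Z : Matrix κ κ' ℂ}
    (hZ : (ρ * (Zᴴ * Z)).trace.re ≤ 0) : Z = 0 := by
  obtain ⟨K, K', hK, h⟩ := exists_weight (κ := κ) hρ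
  rw [h, Complex.ofReal_re] at hZ
  have h0 := le_antisymm hZ (by positivity)
  have h1 : Z * K = 0 := by
    ext i j
    rw [Finset.sum_eq_zero_iff_of_nonneg (fun i _ => by positivity)] at h0
    have h2 := h0 i (Finset.mem_univ _)
    rw [Finset.sum_eq_zero_iff_of_nonneg (fun i _ => by positivity)] at h2
    simpa using h2 j (Finset.mem_univ _)
  calc Z = Z * (K * K') := by rw [hK, Matrix.mul_one]
    _ = 0 := by rw [← Matrix.mul_assoc, h1, Matrix.zero_mul]

section Contraction

variable {A : ι → Matrix κ κ ℂ} {B : ι → Matrix κ' κ' ℂ} {ρ : Matrix κ' κ' ℂ}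

/-- The defect of the weighted norm under a mixed transfer map. -/
lemma trace_weight_mix (hA : ∑ s, (A s)ᴴ * A s = 1)
    (hB : ∀ Z : Matrix κ' κ' ℂ, (ρ * mix B B Z).trace = (ρ * Z).trace) (X : Matrix κ κ' ℂ) :
    (ρ * (Xᴴ * X)).trace.re = (ρ * ((mix A B X)ᴴ * mix A B X)).trace.re +
      ∑ s, (ρ * ((A s * mix A B X - X * B s)ᴴ * (A s * mix A B X - X * B s))).trace.re := by
  have h := mix_schwarz hA B X
  have h1 := congrArg (fun Z => (ρ * Z).trace) h
  beta_reduce at h1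
  rw [Matrix.mul_sum, Matrix.trace_sum, Matrix.mul_sub ρ, Matrix.trace_sub, hB] at h1
  have h2 := congrArg Complex.re h1
  rw [Complex.re_sum, Complex.sub_re] at h2
  linarith

lemma trace_weight_mix_le (hA : ∑ s, (A s)ᴴ * A s = 1) (hρ : ρ.PosDef)
    (hB : ∀ Z : Matrix κ' κ' ℂ, (ρ * mix B B Z).trace = (ρ * Z).trace) (X : Matrix κ κ' ℂ) :
    (ρ * ((mix A B X)ᴴ * mix A B X)).trace.re ≤ (ρ * (Xᴴ * X)).trace.re := by
  rw [trace_weight_mix hA hB X]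
  have : 0 ≤ ∑ s, (ρ * ((A s * mix A B X - X * B s)ᴴ * (A s * mix A B X - X * B s))).trace.re :=
    Finset.sum_nonneg fun s _ => trace_weight_nonneg hρ _
  linarith

/-- Equality in the contraction property means that `X` intertwines the tensors. -/
lemma mul_mix_eq_of_trace_weight (hA : ∑ s, (A s)ᴴ * A s = 1) (hρ : ρ.PosDef)
    (hB : ∀ Z : Matrix κ' κ' ℂ, (ρ * mix B B Z).trace = (ρ * Z).trace) {X : Matrix κ κ' ℂ}
    (h : (ρ * (Xᴴ * X)).trace.re ≤ (ρ * ((mix A B X)ᴴ * mix A B X)).trace.re) (s : ι) :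
    A s * mix A B X = X * B s := by
  rw [trace_weight_mix hA hB X] at h
  have h0 : ∑ s, (ρ * ((A s * mix A B X - X * B s)ᴴ * (A s * mix A B X - X * B s))).trace.re ≤ 0 :=
    by linarith
  have h1 := (Finset.single_le_sum (fun s _ => trace_weight_nonneg hρ _) (Finset.mem_univ s)).trans
    h0
  exact sub_eq_zero.1 (eq_zero_of_trace_weight hρ h1)

end Contraction

/-! ### Traces of mixed transfer maps and amplitudes -/

lemma trace_end (f : Module.End ℂ (Matrix κ κ' ℂ)) :
    LinearMap.trace ℂ _ f = ∑ i, ∑ j, (f (Matrix.single i j 1)) i j := by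
  rw [LinearMap.trace_eq_matrix_trace ℂ (Matrix.stdBasis ℂ κ κ')]
  simp only [Matrix.trace, Matrix.diag, LinearMap.toMatrix_apply, Fintype.sum_prod_type,
    Matrix.stdBasis_eq_single]
  rfl

/-- The product of matrices along a word, with tensors depending on the site. -/
def word (A : ℕ → ι → Matrix κ κ ℂ) {n : ℕ} (s : Fin n → ι) : Matrix κ κ ℂ :=
  (List.ofFn fun i : Fin n => A i (s i)).prod

/-- The composition of mixed transfer maps along sites `0, …, n - 1`. -/
def mixChain (A : ι → Matrix κ κ ℂ) (B : ℕ → ι → Matrix κ' κ' ℂ) :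
    ℕ → Module.End ℂ (Matrix κ κ' ℂ)
  | 0 => 1
  | n + 1 => mix A (B n) * mixChain A B n

lemma mixChain_const (A : ι → Matrix κ κ ℂ) (B : ι → Matrix κ' κ' ℂ) (n : ℕ) :
    mixChain A (fun _ => B) n = mix A B ^ n := by
  induction n with
  | zero => rfl
  | succ n ih => rw [mixChain, ih, pow_succ']

lemma mixChain_add (A : ι → Matrix κ κ ℂ) (B : ℕ → ι → Matrix κ' κ' ℂ) (m n : ℕ) :
    mixChain A B (m + n) = mixChain A (fun j => B (m + j)) n * mixChain A B m := by
  induction n with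
  | zero => simp [mixChain]
  | succ n ih => rw [← add_assoc, mixChain, ih, mixChain, mul_assoc]

lemma mixChain_mul (A : ι → Matrix κ κ ℂ) {B : ℕ → ι → Matrix κ' κ' ℂ} {L : ℕ}
    (hB : ∀ j, B (L + j) = B j) (k : ℕ) : mixChain A B (k * L) = mixChain A B L ^ k := by
  induction k with
  | zero => simp [mixChain]
  | succ k ih =>
    rw [add_mul, one_mul, add_comm, mixChain_add, funext hB, ih, pow_succ]

lemma mixChain_apply (A : ι → Matrix κ κ ℂ) (B : ℕ → ι → Matrix κ' κ' ℂ) (n : ℕ)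
    (X : Matrix κ κ' ℂ) : mixChain A B n X =
      ∑ s : Fin n → ι, (word (fun _ => A) s)ᴴ * X * word B s := by
  induction n with
  | zero => simp [mixChain, word]
  | succ n ih =>
    rw [mixChain, Module.End.mul_apply, ih, ← (Fin.snocEquiv fun _ => ι).sum_comp,
      Fintype.sum_prod_type, mix_apply]
    refine Finset.sum_congr rfl fun a _ => ?_
    rw [Matrix.mul_sum, Matrix.sum_mul]
    refine Finset.sum_congr rfl fun s _ => ?_
    have h (C : ℕ → ι → Matrix κ κ ℂ) :
        word C (Fin.snocEquiv (fun _ => ι) (a, s)) = word C s * C n a := by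
      rw [word, List.ofFn_succ_last]
      simp [word, Fin.snocEquiv]
    have h' (C : ℕ → ι → Matrix κ' κ' ℂ) :
        word C (Fin.snocEquiv (fun _ => ι) (a, s)) = word C s * C n a := by
      rw [word, List.ofFn_succ_last]
      simp [word, Fin.snocEquiv]
    rw [h, h', Matrix.conjTranspose_mul]
    simp only [Matrix.mul_assoc]

/-- The right side is the overlap of the two periodic states. Spectral information about mixed maps
thus depends only on the states, not on the tensors chosen to represent them. -/
lemma trace_mixChain (A : ι → Matrix κ κ ℂ) (B : ℕ → ι → Matrix κ' κ' ℂ) (n : ℕ) :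
    LinearMap.trace ℂ _ (mixChain A B n) =
      ∑ s : Fin n → ι, star (word (fun _ => A) s).trace * (word B s).trace := by
  have h (P : Matrix κ κ ℂ) (Q : Matrix κ' κ' ℂ) :
      ∑ i, ∑ j, (Pᴴ * (Matrix.single i j 1 : Matrix κ κ' ℂ) * Q) i j = star P.trace * Q.trace := by
    rw [← Matrix.trace_conjTranspose, Matrix.trace, Matrix.trace, Finset.sum_mul_sum]
    refine Finset.sum_congr rfl fun i _ => Finset.sum_congr rfl fun j _ => ?_
    simp [Matrix.mul_apply, Matrix.single_apply, ite_and]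
  rw [trace_end]
  simp only [mixChain_apply, Matrix.sum_apply]
  simp_rw [← h]
  exact (Finset.sum_congr rfl fun i _ => Finset.sum_comm).trans Finset.sum_comm

lemma Primitive.tendsto_trace {A : ι → Matrix κ κ ℂ} {ρ : Matrix κ κ ℂ} (h : Primitive A ρ) :
    Tendsto (fun n => LinearMap.trace ℂ _ (mix A A ^ n)) atTop (𝓝 1) := by
  simp only [trace_end]
  have h1 : ∑ i, ∑ j, ((ρ * Matrix.single i j 1).trace • (1 : Matrix κ κ ℂ)) i j = 1 := by
    have := h.trace_eq
    simpa [Matrix.one_apply, Matrix.trace, Matrix.mul_apply, Matrix.single_apply, ite_and] using this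
  have h2 := tendsto_finsetSum Finset.univ fun i (_ : i ∈ Finset.univ) =>
    tendsto_finsetSum Finset.univ fun j (_ : j ∈ Finset.univ) =>
      tendsto_entry (h.tendsto_mix (Matrix.single i j 1)) i j
  rwa [h1] at h2

end Mix

/-! ### Spectral consequences for transfer maps -/

section Dynamics

open Filter Topology

/-- A version of `exists_dominant_eigenvector` for continuous families of endomorphisms. -/
lemma exists_dominant_family {V α : Type*} [NormedAddCommGroup V] [NormedSpace ℂ V]
    [FiniteDimensional ℂ V] [TopologicalSpace α] (F : α → Module.End ℂ V)
    (hF : ∀ x, Continuous fun a => F a x) (a₀ : α) (hC : ∀ x, ∃ C, ∀ n, ‖(F a₀ ^ n) x‖ ≤ C)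
    (htr : Tendsto (fun n => LinearMap.trace ℂ V (F a₀ ^ n)) atTop (𝓝 1)) {L : ℕ} (hL : 1 ≤ L) :
    ∃ N : ℕ, 1 ≤ N ∧ L ∣ N ∧ ∀ᶠ a in 𝓝 a₀, ∃ (μ : ℂ) (y : V), μ ≠ 0 ∧ y ≠ 0 ∧
      (F a ^ N) y = μ • y ∧
      ∀ (ν : ℂ) (z : V), (F a ^ N) z = ν • z → ‖ν‖ = ‖μ‖ → ∃ c : ℂ, z = c • y := by
  have : CompleteSpace V := FiniteDimensional.complete ℂ _
  have hpow (f : Module.End ℂ V) (n : ℕ) (x : V) :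
      ((LinearMap.toContinuousLinearMap f) ^ n) x = (f ^ n) x := by
    induction n with
    | zero => rfl
    | succ n ih => rw [pow_succ', pow_succ', Module.End.mul_apply, ← ih]; rfl
  -- The uniform boundedness principle turns the vectorwise bounds into a bound on operator norms.
  obtain ⟨C, hC⟩ := banach_steinhaus (g := fun n => (LinearMap.toContinuousLinearMap (F a₀)) ^ n)
    fun x => by simpa only [hpow] using hC x
  obtain ⟨N, hN, hLN, hev⟩ := exists_dominant_eigenvector _ hC
    (htr.congr fun n => congrArg _ (by ext1 x; exact (hpow _ n x).symm)) hL
  refine ⟨N, hN, hLN, ?_⟩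
  have hc : Continuous fun a => LinearMap.toContinuousLinearMap (F a) :=
    continuous_clm_apply.2 hF
  filter_upwards [(hc.tendsto a₀).eventually hev] with a ha
  simpa only [hpow] using ha

attribute [local instance] Matrix.normedAddCommGroup Matrix.normedSpace

variable {ι κ κ' : Type*} [Fintype ι] [Fintype κ] [Fintype κ'] [DecidableEq κ] [DecidableEq κ']

lemma toCLM_pow_apply (f : Module.End ℂ (Matrix κ κ' ℂ)) (n : ℕ) (X : Matrix κ κ' ℂ) :
    ((LinearMap.toContinuousLinearMap f) ^ n) X = (f ^ n) X := by
  induction n with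
  | zero => rfl
  | succ n ih => rw [pow_succ', pow_succ', Module.End.mul_apply, ← ih]; rfl

lemma tendsto_end_pow_zero (f : Module.End ℂ (Matrix κ κ' ℂ))
    (hf : ∀ (μ : ℂ) (x : Matrix κ κ' ℂ), x ≠ 0 → f x = μ • x → ‖μ‖ < 1) (X : Matrix κ κ' ℂ) :
    Tendsto (fun n => (f ^ n) X) atTop (𝓝 0) := by
  have h := tendsto_pow_zero_of_eigenvalues (LinearMap.toContinuousLinearMap f) hf
  have hc : Continuous fun F : Matrix κ κ' ℂ →L[ℂ] Matrix κ κ' ℂ => F X := by fun_prop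
  have h2 := (hc.tendsto 0).comp h
  refine h2.congr fun n => toCLM_pow_apply f n X

/-- The spectral form of injectivity is equivalent to convergence of the transfer map. -/
theorem IsCanonicalInjective.exists_primitive {d χ : ℕ} {A : MPSTensor d χ}
    (h : IsCanonicalInjective A) : ∃ ρ, Primitive A ρ := by
  obtain ⟨ρ₀, hρ₀, hfix⟩ := h.right_fixed
  have hne : Nonempty (Fin χ) := by
    by_contra hne
    rw [not_nonempty_iff] at hne
    have h0 := h.unique
    rw [Module.finrank_zero_of_subsingleton] at h0
    exact zero_ne_one h0
  have htr : 0 < ρ₀.trace := hρ₀.trace_pos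
  have hρ : (ρ₀.trace⁻¹ • ρ₀).PosDef := hρ₀.smul (inv_pos_of_pos htr)
  set ρ := ρ₀.trace⁻¹ • ρ₀ with hρdef
  have htrρ : ρ.trace = 1 := by
    rw [hρdef, Matrix.trace_smul, smul_eq_mul, inv_mul_cancel₀ htr.ne']
  have hfixρ : transferMap A ρ = ρ := by
    rw [hρdef, map_smul]
    exact congrArg _ hfix
  refine ⟨ρ, h.left_canonical, hρ, htrρ, fun X => ?_⟩
  -- Subtracting the projection `X ↦ tr(X) ρ` removes the eigenvalue `1`. Eigenvectors of `f` with
  -- nonzero eigenvalue are traceless, hence eigenvectors of the transfer map, and nondegeneracy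
  -- excludes the eigenvalue `1` because `ρ` has trace `1`.
  let f : Module.End ℂ (Matrix (Fin χ) (Fin χ) ℂ) :=
    transferMap A - LinearMap.smulRight (Matrix.traceLinearMap (Fin χ) ℂ ℂ) ρ
  have hf (X : Matrix (Fin χ) (Fin χ) ℂ) : f X = transferMap A X - X.trace • ρ := rfl
  have hpow (n : ℕ) : (f ^ (n + 1)) X = (transferMap A ^ (n + 1)) X - X.trace • ρ := by
    induction n with
    | zero => simp [hf]
    | succ n ih =>
      rw [pow_succ', Module.End.mul_apply, ih, hf, map_sub, map_smul, hfixρ, Matrix.trace_sub,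
        Matrix.trace_smul, htrρ, trace_transferMap_pow h.left_canonical, pow_succ' _ (n + 1),
        Module.End.mul_apply]
      simp
  have hlim := tendsto_end_pow_zero f (fun μ x hx hxe => ?_) X
  · have h1 := (hlim.comp (tendsto_add_atTop_nat 1)).add_const (X.trace • ρ)
    rw [zero_add] at h1
    rw [← tendsto_add_atTop_iff_nat 1]
    refine h1.congr fun n => ?_
    rw [Function.comp_apply, hpow, sub_add_cancel]
  · rcases eq_or_ne μ 0 with rfl | hμ
    · simp
    have htrx : x.trace = 0 := by
      have h1 := congrArg Matrix.trace hxe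
      rw [hf, Matrix.trace_sub, trace_transferMap h.left_canonical, Matrix.trace_smul, htrρ,
        Matrix.trace_smul, smul_eq_mul, smul_eq_mul, mul_one, sub_self] at h1
      exact (mul_eq_zero.1 h1.symm).resolve_left hμ
    have hxe' : transfer A x = μ • x := by
      rw [hf, htrx, zero_smul, sub_zero] at hxe
      exact hxe
    refine h.gap μ (Module.End.hasEigenvalue_of_hasEigenvector
      ⟨Module.End.mem_eigenspace_iff.2 hxe', hx⟩) ?_
    rintro rfl
    obtain ⟨e, -, he⟩ := finrank_eq_one_iff'.1 h.unique
    obtain ⟨a, ha⟩ := he ⟨x, Module.End.mem_eigenspace_iff.2 hxe'⟩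
    obtain ⟨b, hb⟩ := he ⟨ρ, Module.End.mem_eigenspace_iff.2 (by rw [one_smul]; exact hfixρ)⟩
    have ha' : a • (e : Matrix (Fin χ) (Fin χ) ℂ) = x := congrArg Subtype.val ha
    have hb' : b • (e : Matrix (Fin χ) (Fin χ) ℂ) = ρ := congrArg Subtype.val hb
    have hetr : (e : Matrix (Fin χ) (Fin χ) ℂ).trace ≠ 0 := by
      intro h0
      rw [← hb', Matrix.trace_smul, h0, smul_zero] at htrρ
      exact zero_ne_one htrρ
    rw [← ha', Matrix.trace_smul, smul_eq_mul] at htrx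
    rw [(mul_eq_zero.1 htrx).resolve_right hetr, zero_smul] at ha'
    exact hx ha'.symm

/-- On an eigenvector `x` convergence reads `μⁿ x → tr(x) ρ`. For `μ = 1` this makes `x` a multiple
of `ρ`; for `μ ≠ 1` trace preservation gives `tr x = 0`, so `μⁿ → 0`. -/
theorem Primitive.isCanonicalInjective {d χ : ℕ} {A : MPSTensor d χ}
    {ρ : Matrix (Fin χ) (Fin χ) ℂ} (h : Primitive A ρ) : IsCanonicalInjective A := by
  have hpow (μ : ℂ) (x : Matrix (Fin χ) (Fin χ) ℂ) (hx : transfer A x = μ • x) (n : ℕ) :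
      (transferMap A ^ n) x = μ ^ n • x := by
    induction n with
    | zero => simp
    | succ n ih =>
      rw [pow_succ', Module.End.mul_apply, ih, map_smul]
      refine (congrArg (μ ^ n • ·) hx).trans ?_
      simp only [smul_smul, pow_succ]
  refine ⟨h.left, ⟨ρ, h.posDef, h.fixed⟩, ?_, fun μ hμ hμ1 => ?_⟩
  · have hρ0 : ρ ≠ 0 := by
      rintro rfl
      simpa using h.trace_eq
    refine finrank_eq_one_iff'.2 ⟨⟨ρ, Module.End.mem_eigenspace_iff.2
      (by rw [one_smul]; exact h.fixed)⟩, fun h0 => hρ0 (congrArg Subtype.val h0), fun w => ?_⟩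
    have hw := Module.End.mem_eigenspace_iff.1 w.2
    have h1 := h.tendsto w
    simp only [hpow 1 w hw, one_pow, one_smul] at h1
    exact ⟨_, Subtype.ext (tendsto_nhds_unique h1 tendsto_const_nhds)⟩
  · obtain ⟨x, hx⟩ := hμ.exists_hasEigenvector
    have hxe : transfer A x = μ • x := hx.apply_eq_smul
    have htrx : x.trace = 0 := by
      have h1 := (congrArg Matrix.trace hxe).symm.trans (trace_transferMap h.left x)
      rw [Matrix.trace_smul, smul_eq_mul] at h1
      by_contra h0
      exact hμ1 (mul_right_cancel₀ h0 (h1.trans (one_mul _).symm))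
    have h1 := h.tendsto x
    simp only [hpow μ x hxe, htrx, zero_smul] at h1
    have h2 := h1.norm
    simp only [norm_smul, norm_pow, norm_zero] at h2
    have hx0 : 0 < ‖x‖ := norm_pos_iff.2 hx.2
    have h3 : Tendsto (fun n => ‖μ‖ ^ n) atTop (𝓝 0) := by
      have := h2.mul_const ‖x‖⁻¹
      simpa [mul_assoc, hx0.ne'] using this
    exact (tendsto_pow_atTop_nhds_zero_iff.1 h3).trans_eq' (abs_of_nonneg (norm_nonneg μ))

/-- Mixed transfer maps between left-canonical tensors are power bounded. -/
lemma exists_norm_pow_le {A : ι → Matrix κ κ ℂ} {B : ι → Matrix κ' κ' ℂ} {ρ : Matrix κ' κ' ℂ}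
    (hA : ∑ s, (A s)ᴴ * A s = 1) (hB : Primitive B ρ) :
    ∀ X, ∃ C, ∀ n, ‖(mix A B ^ n) X‖ ≤ C := by
  intro X
  obtain ⟨K, K', hK, hw⟩ := exists_weight (κ := κ) hB.posDef
  -- Mixed maps contract the `ρ`-weighted Hilbert–Schmidt norm, which controls the entries because
  -- the weight is invertible.
  have hmono (n : ℕ) : (ρ * (((mix A B ^ n) X)ᴴ * (mix A B ^ n) X)).trace.re ≤
      (ρ * (Xᴴ * X)).trace.re := by
    induction n with
    | zero => simp
    | succ n ih =>
      rw [pow_succ', Module.End.mul_apply]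
      exact (trace_weight_mix_le hA hB.posDef hB.trace_mul_mix _).trans ih
  set w := (ρ * (Xᴴ * X)).trace.re
  have hw0 : 0 ≤ w := trace_weight_nonneg hB.posDef X
  refine ⟨∑ k, ∑ j, √w * ‖K' k j‖, fun n => ?_⟩
  set Z := (mix A B ^ n) X
  have hZ : Z = (Z * K) * K' := by rw [Matrix.mul_assoc, hK, Matrix.mul_one]
  have hZK (i : κ) (k : κ') : ‖(Z * K) i k‖ ≤ √w := by
    have h1 := hmono n
    rw [hw, Complex.ofReal_re] at h1
    refine Real.le_sqrt_of_sq_le (le_trans ?_ h1)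
    refine le_trans ?_ (Finset.single_le_sum (f := fun i => ∑ j, ‖(Z * K) i j‖ ^ 2)
      (fun _ _ => by positivity) (Finset.mem_univ i))
    exact Finset.single_le_sum (f := fun j => ‖(Z * K) i j‖ ^ 2)
      (fun _ _ => by positivity) (Finset.mem_univ k)
  refine (Matrix.norm_le_iff (by positivity)).2 fun i j => ?_
  rw [hZ, Matrix.mul_apply]
  refine (norm_sum_le _ _).trans (Finset.sum_le_sum fun k _ => ?_)
  rw [norm_mul]
  calc ‖(Z * K) i k‖ * ‖K' k j‖ ≤ √w * ‖K' k j‖ := by gcongr; exact hZK i k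
    _ ≤ _ := Finset.single_le_sum (f := fun j => √w * ‖K' k j‖)
      (fun _ _ => by positivity) (Finset.mem_univ j)

/-- Near a left-canonical tensor generating the states of an injective one, the mixed transfer
map has a dominant eigenvector. -/
lemma exists_dominant_mix {A₀ : ι → Matrix κ κ ℂ} {B : ι → Matrix κ' κ' ℂ} {ρ : Matrix κ' κ' ℂ}
    (hA : ∑ s, (A₀ s)ᴴ * A₀ s = 1) (hB : Primitive B ρ)
    (htr : Tendsto (fun n => LinearMap.trace ℂ _ (mix A₀ B ^ n)) atTop (𝓝 1)) {L : ℕ}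
    (hL : 1 ≤ L) :
    ∃ N : ℕ, 1 ≤ N ∧ L ∣ N ∧ ∀ᶠ A in 𝓝 A₀, ∃ (μ : ℂ) (y : Matrix κ κ' ℂ), μ ≠ 0 ∧ y ≠ 0 ∧
      (mix A B ^ N) y = μ • y ∧
      ∀ (ν : ℂ) (z : Matrix κ κ' ℂ), (mix A B ^ N) z = ν • z → ‖ν‖ = ‖μ‖ → ∃ c : ℂ, z = c • y := by
  have h0 : ∀ x : Matrix κ κ' ℂ, ∃ C, ∀ n, ‖(mix A₀ B ^ n) x‖ ≤ C := exists_norm_pow_le hA hB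
  have hc (X : Matrix κ κ' ℂ) : Continuous fun A : ι → Matrix κ κ ℂ => mix A B X := by
    change Continuous fun A : ι → Matrix κ κ ℂ => ∑ s, (A s)ᴴ * X * B s
    fun_prop
  have h1 := @exists_dominant_family (Matrix κ κ' ℂ) (ι → Matrix κ κ ℂ)
    Matrix.normedAddCommGroup Matrix.normedSpace inferInstance inferInstance (fun A => mix A B)
  exact h1 hc A₀ h0 htr hL

end Dynamics

/-! ### Push-through -/

section Push

open Filter Topology

variable {ι κ κ' : Type*} [Fintype ι] [Fintype κ] [Fintype κ'] [DecidableEq ι] [DecidableEq κ]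
  [DecidableEq κ']

/-- The action of a matrix on the physical leg, for arbitrary index types. -/
def physMap {ι' : Type*} (M : Matrix ι' ι ℂ) (A : ι → Matrix κ κ ℂ) : ι' → Matrix κ κ ℂ :=
  fun s => ∑ s', M s s' • A s'

lemma physMap_mul {ι' ι'' : Type*} [Fintype ι'] (M : Matrix ι'' ι' ℂ) (N : Matrix ι' ι ℂ) (A : ι → Matrix κ κ ℂ) :
    physMap (M * N) A = physMap M (physMap N A) := by
  funext s
  simp only [physMap, Matrix.mul_apply, Finset.smul_sum, Finset.sum_smul, smul_smul]
  exact Finset.sum_comm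

lemma physMap_smul_mul {ι' : Type*} (M : Matrix ι' ι ℂ) (A : ι → Matrix κ κ ℂ) (c : ℂ) (P Q : Matrix κ κ ℂ) :
    physMap M (fun s => c • (P * A s * Q)) = fun s => c • (P * physMap M A s * Q) := by
  funext s
  simp only [physMap, Matrix.mul_sum, Matrix.sum_mul, Finset.smul_sum, Matrix.mul_smul,
    Matrix.smul_mul]
  exact Finset.sum_congr rfl fun s' _ => smul_comm _ _ _

lemma mix_physMap {ι' : Type*} [Fintype ι'] {M : Matrix ι' ι ℂ} (hM : Mᴴ * M = 1) (A : ι → Matrix κ κ ℂ)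
    (B : ι → Matrix κ' κ' ℂ) : mix (physMap M A) (physMap M B) = mix A B := by
  ext1 X
  have h (s s' : ι) : ∑ r, star (M r s) * M r s' = if s = s' then 1 else 0 := by
    have := congrFun (congrFun hM s) s'
    simpa [Matrix.mul_apply, Matrix.one_apply] using this
  calc mix (physMap M A) (physMap M B) X =
        ∑ r, ∑ s, ∑ s', (star (M r s) * M r s') • ((A s)ᴴ * X * B s') := by
        simp only [mix_apply, physMap, Matrix.conjTranspose_sum, Matrix.conjTranspose_smul,
          Matrix.sum_mul, Matrix.mul_sum, Matrix.smul_mul, Matrix.mul_smul, Finset.smul_sum,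
          smul_smul]
        refine Finset.sum_congr rfl fun r _ => ?_
        rw [Finset.sum_comm]
        exact Finset.sum_congr rfl fun s _ => Finset.sum_congr rfl fun s' _ => by rw [mul_comm]
    _ = ∑ s, ∑ s', (∑ r, star (M r s) * M r s') • ((A s)ᴴ * X * B s') := by
        simp only [Finset.sum_smul]
        rw [Finset.sum_comm]
        exact Finset.sum_congr rfl fun s _ => Finset.sum_comm
    _ = _ := by
        simp only [h, ite_smul, one_smul, zero_smul, Finset.sum_ite_eq, Finset.mem_univ, if_true]
        rfl

lemma star_circle_mul_self (z : Circle) : star (z : ℂ) * z = 1 := by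
  have := Circle.coe_inv_eq_conj z
  rw [Complex.star_def, ← this, ← Circle.coe_mul, inv_mul_cancel, Circle.coe_one]

lemma unitary_mul_conjTranspose (v : Matrix.unitaryGroup κ ℂ) : v.1 * v.1ᴴ = 1 :=
  Matrix.mem_unitaryGroup_iff.1 v.2

lemma unitary_conjTranspose_mul (v : Matrix.unitaryGroup κ ℂ) : v.1ᴴ * v.1 = 1 :=
  Matrix.mem_unitaryGroup_iff'.1 v.2

variable {G : Type} [Group G]

/-- The push-through condition on site `0`, for arbitrary index types. -/
def PushesTo (T : MulAut G) (U : G → Matrix.unitaryGroup ι ℂ) (v : G → Matrix.unitaryGroup κ ℂ)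
    (φ : G → Circle) (A : ι → Matrix κ κ ℂ) : Prop :=
  ∀ g s, physMap (U g).1 A s = (φ g : ℂ) • ((v g).1ᴴ * A s * (v (T g)).1)

variable {T : MulAut G} {U : G → Matrix.unitaryGroup ι ℂ} {A : ι → Matrix κ κ ℂ}
  {B : ι → Matrix κ' κ' ℂ} {vA : G → Matrix.unitaryGroup κ ℂ} {vB : G → Matrix.unitaryGroup κ' ℂ}
  {φA φB : G → Circle}

lemma PushesTo.conjTranspose_mul (h : PushesTo T U vA φA A) (g : G) (s : ι) :
    (vA g).1ᴴ * A s = star (φA g : ℂ) • (physMap (U g).1 A s * (vA (T g)).1ᴴ) := by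
  rw [h g s, Matrix.smul_mul, smul_smul, star_circle_mul_self, one_smul, Matrix.mul_assoc _ _ (_ᴴ),
    unitary_mul_conjTranspose, Matrix.mul_one]

/-- The twisted action on bond matrices commutes with the mixed transfer map. -/
lemma mix_push (hA : PushesTo T U vA φA A) (hB : PushesTo T U vB φB B) (g : G)
    (X : Matrix κ κ' ℂ) : mix A B ((vA g).1 * X * (vB g).1ᴴ) =
      ((φA g : ℂ) * star (φB g : ℂ)) • ((vA (T g)).1 * mix A B X * (vB (T g)).1ᴴ) := by
  have h1 (s : ι) : (A s)ᴴ * (vA g).1 =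
      (φA g : ℂ) • ((vA (T g)).1 * (physMap (U g).1 A s)ᴴ) := by
    have := congrArg Matrix.conjTranspose (hA.conjTranspose_mul g s)
    simpa using this
  have h2 := hB.conjTranspose_mul g
  have h3 : mix A B X = ∑ s, (physMap (U g).1 A s)ᴴ * X * physMap (U g).1 B s :=
    DFunLike.congr_fun (mix_physMap (unitary_conjTranspose_mul (U g)) A B).symm X
  rw [h3, mix_apply A B, Matrix.mul_sum, Matrix.sum_mul, Finset.smul_sum]
  refine Finset.sum_congr rfl fun s _ => ?_
  calc _ = ((A s)ᴴ * (vA g).1) * X * ((vB g).1ᴴ * B s) := by simp only [Matrix.mul_assoc]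
    _ = _ := by
      rw [h1, h2]
      simp only [Matrix.smul_mul, Matrix.mul_smul, smul_smul, Matrix.mul_assoc, mul_comm]

lemma mix_push_pow (hA : PushesTo T U vA φA A) (hB : PushesTo T U vB φB B) (n : ℕ) (g : G)
    (X : Matrix κ κ' ℂ) : ∃ p : ℂ, ‖p‖ = 1 ∧ (mix A B ^ n) ((vA g).1 * X * (vB g).1ᴴ) =
      p • ((vA ((T ^ n) g)).1 * (mix A B ^ n) X * (vB ((T ^ n) g)).1ᴴ) := by
  induction n with
  | zero => exact ⟨1, by simp⟩
  | succ n ih =>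
    obtain ⟨p, hp, h⟩ := ih
    refine ⟨p * ((φA ((T ^ n) g) : ℂ) * star (φB ((T ^ n) g) : ℂ)), by simp [hp, Circle.norm_coe], ?_⟩
    rw [pow_succ' (mix A B), pow_succ' T, MulAut.mul_apply, Module.End.mul_apply,
      Module.End.mul_apply, h, map_smul, mix_push hA hB, smul_smul]

lemma trace_conj_self (v : Matrix.unitaryGroup κ ℂ) (w : Matrix.unitaryGroup κ' ℂ)
    (X : Matrix κ κ' ℂ) :
    ((v.1 * X * w.1ᴴ)ᴴ * (v.1 * X * w.1ᴴ)).trace = (Xᴴ * X).trace := by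
  rw [Matrix.conjTranspose_mul, Matrix.conjTranspose_mul, Matrix.conjTranspose_conjTranspose]
  calc _ = (w.1 * (Xᴴ * (v.1ᴴ * v.1) * X * w.1ᴴ)).trace := by simp only [Matrix.mul_assoc]
    _ = _ := by
      rw [Matrix.trace_mul_comm, unitary_conjTranspose_mul, Matrix.mul_one, Matrix.mul_assoc,
        unitary_conjTranspose_mul, Matrix.mul_one]

/-- The map `X ↦ v X w†` preserves the Hilbert–Schmidt norm. -/
lemma norm_eq_one_of_conj {v : Matrix.unitaryGroup κ ℂ} {w : Matrix.unitaryGroup κ' ℂ}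
    {X : Matrix κ κ' ℂ} (hX : X ≠ 0) {c : ℂ} (h : v.1 * X * w.1ᴴ = c • X) : ‖c‖ = 1 := by
  have h1 := trace_conj_self v w X
  rw [h, Matrix.conjTranspose_smul, Matrix.smul_mul, Matrix.mul_smul, smul_smul, Matrix.trace_smul,
    smul_eq_mul] at h1
  have h2 : (Xᴴ * X).trace ≠ 0 := fun h0 => hX (Matrix.trace_conjTranspose_mul_self_eq_zero_iff.1 h0)
  have h3 : star c * c = 1 := mul_right_cancel₀ h2 (h1.trans (one_mul _).symm)
  have h4 := congrArg norm h3
  rw [norm_mul, norm_star, norm_one, ← sq] at h4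
  exact (pow_eq_one_iff_of_nonneg (norm_nonneg c) two_ne_zero).1 h4

/-- Push-through data for two tensors whose mixed transfer map has a dominant eigenvector agree up
to a change of phases. -/
lemma exists_match (hA : PushesTo T U vA φA A) (hB : PushesTo T U vB φB B) {N : ℕ} (hN : 1 ≤ N)
    (hT : T ^ N = 1) {μ : ℂ} {y : Matrix κ κ' ℂ} (hμ : μ ≠ 0) (hy : y ≠ 0)
    (hFy : (mix A B ^ N) y = μ • y)
    (hdom : ∀ (ν : ℂ) (z : Matrix κ κ' ℂ), (mix A B ^ N) z = ν • z → ‖ν‖ = ‖μ‖ →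
      ∃ c : ℂ, z = c • y) :
    ∃ z : G → Circle, (∀ g, (vA g).1 * y = (z g : ℂ) • (y * (vB g).1)) ∧
      ∀ g, φB g * z g = φA g * z (T g) := by
  -- As `T^N = 1`, the twisted conjugation sends `y` to an eigenvector of the same power with
  -- eigenvalue of equal modulus, so dominance makes it a multiple of `y`.
  have hz (g : G) : ∃ z : Circle, (vA g).1 * y * (vB g).1ᴴ = (z : ℂ) • y := by
    obtain ⟨p, hp, h⟩ := mix_push_pow hA hB N g y
    rw [hT, MulAut.one_apply, hFy, Matrix.mul_smul, Matrix.smul_mul, smul_smul] at h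
    obtain ⟨c, hc⟩ := hdom _ _ h (by rw [norm_mul, hp, one_mul])
    exact ⟨⟨c, mem_sphere_zero_iff_norm.2 (norm_eq_one_of_conj hy hc)⟩, hc⟩
  choose z hz using hz
  refine ⟨z, fun g => ?_, fun g => ?_⟩
  · rw [← Matrix.smul_mul, ← hz, Matrix.mul_assoc _ _ (vB g).1, unitary_conjTranspose_mul,
      Matrix.mul_one]
  -- The mixed map commutes with its power, so `y` is an eigenvector of a single step too. Pushing
  -- `g` through that one step relates `z g` to `z (T g)`.
  · obtain ⟨ν, hν⟩ := hdom μ (mix A B y)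
      (by rw [← Module.End.mul_apply, ← pow_succ, pow_succ', Module.End.mul_apply, hFy, map_smul])
      rfl
    have hν0 : ν ≠ 0 := by
      rintro rfl
      obtain ⟨m, rfl⟩ := Nat.exists_eq_add_of_le' hN
      rw [pow_succ, Module.End.mul_apply, hν, zero_smul, map_zero] at hFy
      exact (smul_ne_zero hμ hy) hFy.symm
    have h1 := mix_push hA hB g y
    rw [hz, map_smul, hν, Matrix.mul_smul, Matrix.smul_mul, hz, smul_smul, smul_smul,
      smul_smul] at h1
    have h2 := smul_left_injective ℂ hy h1
    have h3 : (z g : ℂ) = (φA g : ℂ) * star (φB g : ℂ) * z (T g) := by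
      refine mul_right_cancel₀ hν0 (h2.trans (by ring))
    ext
    rw [Circle.coe_mul, Circle.coe_mul, h3]
    linear_combination (φA g : ℂ) * z (T g) * star_circle_mul_self (φB g)

/-! ### Uniqueness of push-through data -/

lemma mix_pow_of_step {A : ι → Matrix κ κ ℂ} (X : ℕ → Matrix κ κ ℂ) (a : ℕ → ℂ)
    (h : ∀ j, mix A A (X j) = a j • X (j + 1)) (ha : ∀ j, ‖a j‖ = 1) (n : ℕ) :
    ∃ p : ℂ, ‖p‖ = 1 ∧ (mix A A ^ n) (X 0) = p • X n := by
  induction n with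
  | zero => exact ⟨1, by simp⟩
  | succ n ih =>
    obtain ⟨p, hp, hn⟩ := ih
    exact ⟨p * a n, by simp [hp, ha], by
      rw [pow_succ', Module.End.mul_apply, hn, map_smul, h, smul_smul]⟩

/-- Two periodic sequences of bond unitaries that implement the same operators agree up to a
phase. -/
lemma Primitive.unique_push {ρ : Matrix κ κ ℂ} (hp : Primitive A ρ) {L : ℕ} (hL : 1 ≤ L)
    {V W : ℕ → Matrix.unitaryGroup κ ℂ} {a : ℕ → ℂ} (ha : ∀ j, ‖a j‖ = 1)
    (h : ∀ j s, (V j).1ᴴ * A s * (V (j + 1)).1 = a j • ((W j).1ᴴ * A s * (W (j + 1)).1))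
    {μ ν : ℂ} (hμ : ‖μ‖ = 1) (hν : ‖ν‖ = 1) (hV : (V L).1 = μ • (V 0).1)
    (hW : (W L).1 = ν • (W 0).1) : ∃ c : Circle, (V 0).1 = (c : ℂ) • (W 0).1 := by
  -- These products satisfy `A X_{j+1} = a_j X_j A`, so the dual transfer map shifts them up to
  -- phases. After a period `X 0` is a unimodular eigenvector, hence a scalar.
  let X : ℕ → Matrix κ κ ℂ := fun j => (V j).1 * (W j).1ᴴ
  have hX (j : ℕ) (s : ι) : A s * X (j + 1) = a j • (X j * A s) := by
    have h1 := congrArg (fun Z => (V j).1 * Z * (W (j + 1)).1ᴴ) (h j s)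
    simp only [Matrix.mul_smul, Matrix.smul_mul] at h1
    calc A s * X (j + 1) = ((V j).1 * (V j).1ᴴ) * A s * (V (j + 1)).1 * (W (j + 1)).1ᴴ := by
          rw [unitary_mul_conjTranspose, Matrix.one_mul, Matrix.mul_assoc]
      _ = (V j).1 * ((V j).1ᴴ * A s * (V (j + 1)).1) * (W (j + 1)).1ᴴ := by
          simp only [Matrix.mul_assoc]
      _ = a j • (X j * A s * ((W (j + 1)).1 * (W (j + 1)).1ᴴ)) := by
          rw [h1]
          simp only [X, Matrix.mul_assoc]
      _ = _ := by rw [unitary_mul_conjTranspose, Matrix.mul_one]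
  have hstep (j : ℕ) : mix A A (X j) = star (a j) • X (j + 1) := by
    have h1 : star (a j) * a j = 1 := by
      rw [Complex.star_def, ← Complex.normSq_eq_conj_mul_self, Complex.normSq_eq_norm_sq, ha]
      simp
    calc mix A A (X j) = ∑ s, star (a j) • ((A s)ᴴ * A s * X (j + 1)) := by
          rw [mix_apply]
          refine Finset.sum_congr rfl fun s _ => ?_
          rw [Matrix.mul_assoc (A s)ᴴ (A s), hX, Matrix.mul_smul, smul_smul, h1, one_smul,
            Matrix.mul_assoc]
      _ = _ := by rw [← Finset.smul_sum, ← Matrix.sum_mul, hp.left, Matrix.one_mul]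
  obtain ⟨p, hp1, hpow⟩ := mix_pow_of_step X _ hstep (fun j => by rw [norm_star, ha]) L
  have hXL : X L = (μ * star ν) • X 0 := by
    simp only [X, hV, hW, Matrix.conjTranspose_smul, Matrix.smul_mul, Matrix.mul_smul, smul_smul,
      mul_comm]
  rw [hXL, smul_smul] at hpow
  obtain ⟨c, hc⟩ := hp.eq_smul_one hL (by simp [hp1, hμ, hν]) hpow
  have hV0 : (V 0).1 = c • (W 0).1 := by
    calc (V 0).1 = X 0 * (W 0).1 := by
          simp only [X]
          rw [Matrix.mul_assoc, unitary_conjTranspose_mul, Matrix.mul_one]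
      _ = _ := by rw [hc, Matrix.smul_mul, Matrix.one_mul]
  have hne : (1 : Matrix κ κ ℂ) ≠ 0 := by
    have := hp.nonempty
    exact one_ne_zero
  have hc1 : ‖c‖ = 1 := norm_eq_one_of_conj (v := V 0) (w := W 0) hne (by
    rw [Matrix.mul_one]; exact hc)
  exact ⟨⟨c, mem_sphere_zero_iff_norm.2 hc1⟩, hV0⟩

/-- The projective multiplication law of the bond unitaries. -/
lemma PushesTo.exists_cocycle {ρ : Matrix κ κ ℂ} {U : G →* Matrix.unitaryGroup ι ℂ}
    (hp : Primitive A ρ) {L : ℕ} (hL : 1 ≤ L) (hT : T ^ L = 1) (h : PushesTo T U vA φA A) :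
    ∃ ω : G → G → Circle, (∀ g k, (vA g).1 * (vA k).1 = (ω g k : ℂ) • (vA (g * k)).1) ∧
      IsCocycle ω ∧ Compat T ω φA := by
  have hcomp (g k : G) (s : ι) : ((φA k : ℂ) * φA g) • ((vA k).1ᴴ * ((vA g).1ᴴ * A s *
      (vA (T g)).1) * (vA (T k)).1) =
        (φA (g * k) : ℂ) • ((vA (g * k)).1ᴴ * A s * (vA (T (g * k))).1) := by
    rw [← h (g * k) s, map_mul]
    change _ = physMap ((U g).1 * (U k).1) A s
    rw [physMap_mul, funext (h k), physMap_smul_mul]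
    beta_reduce
    rw [h g s, Matrix.mul_smul, Matrix.smul_mul,
      smul_smul]
  have hω (g k : G) : ∃ c : Circle, (vA g * vA k).1 = (c : ℂ) • (vA (g * k)).1 := by
    -- Both sequences implement the same operators up to phases, since `U` is linear, and both
    -- return to themselves after `L` sites.
    have := hp.unique_push hL (V := fun j => vA ((T ^ j) g) * vA ((T ^ j) k))
      (W := fun j => vA ((T ^ j) (g * k)))
      (a := fun j => star ((φA ((T ^ j) k) : ℂ) * φA ((T ^ j) g)) * φA ((T ^ j) (g * k)))
      (μ := 1) (ν := 1) (by simp [Circle.norm_coe]) (fun j s => ?_) (by simp) (by simp) (by simp [hT]) (by simp [hT])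
    · simpa using this
    · have h1 := hcomp ((T ^ j) g) ((T ^ j) k) s
      rw [← map_mul] at h1
      have h2 : star ((φA ((T ^ j) k) : ℂ) * φA ((T ^ j) g)) *
          ((φA ((T ^ j) k) : ℂ) * φA ((T ^ j) g)) = 1 := by
        rw [← Circle.coe_mul, star_circle_mul_self]
      rw [← smul_smul]
      simp only [pow_succ', MulAut.mul_apply]
      rw [← h1, smul_smul, h2, one_smul]
      change ((vA ((T ^ j) g)).1 * (vA ((T ^ j) k)).1)ᴴ * A s *
        ((vA (T ((T ^ j) g))).1 * (vA (T ((T ^ j) k))).1) = _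
      rw [Matrix.conjTranspose_mul]
      simp only [Matrix.mul_assoc]
  choose ω hω using hω
  have hω' (g k : G) : (vA g).1 * (vA k).1 = (ω g k : ℂ) • (vA (g * k)).1 := hω g k
  have hne := hp.nonempty
  have hv0 (g : G) : (vA g).1 ≠ 0 := fun h0 => by
    have := unitary_mul_conjTranspose (vA g)
    rw [h0, Matrix.zero_mul] at this
    exact zero_ne_one this
  refine ⟨ω, hω', fun a b c => ?_, fun a b => ?_⟩
  · have h1 := Matrix.mul_assoc (vA a).1 (vA b).1 (vA c).1
    rw [hω', hω', Matrix.smul_mul, Matrix.mul_smul, hω', hω', smul_smul, smul_smul,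
      mul_assoc a b c] at h1
    have h2 := smul_left_injective ℂ (hv0 _) h1
    ext
    rw [Circle.coe_mul, Circle.coe_mul, mul_comm (ω (a * b) c : ℂ)]
    exact h2
  -- Comparing coefficients in the composed push-through relation requires one nonzero matrix of the
  -- tensor.
  · obtain ⟨s, hs⟩ : ∃ s, A s ≠ 0 := by
      by_contra! h0
      have := hp.left
      simp [h0] at this
    have h1 := hcomp a b s
    have h2 : (vA b).1ᴴ * (vA a).1ᴴ = star (ω a b : ℂ) • (vA (a * b)).1ᴴ := by
      rw [← Matrix.conjTranspose_mul, hω', Matrix.conjTranspose_smul]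
    have h3 : (vA b).1ᴴ * ((vA a).1ᴴ * A s * (vA (T a)).1) * (vA (T b)).1 =
        ((vA b).1ᴴ * (vA a).1ᴴ) * A s * ((vA (T a)).1 * (vA (T b)).1) := by
      simp only [Matrix.mul_assoc]
    rw [h3, h2, hω', Matrix.smul_mul, Matrix.smul_mul, Matrix.mul_smul, smul_smul, smul_smul,
      ← map_mul] at h1
    have h4 : (vA (a * b)).1ᴴ * A s * (vA (T (a * b))).1 ≠ 0 := fun h0 => hs (by
      calc A s = (vA (a * b)).1 * ((vA (a * b)).1ᴴ * A s * (vA (T (a * b))).1) *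
            (vA (T (a * b))).1ᴴ := by
            simp only [← Matrix.mul_assoc]
            rw [unitary_mul_conjTranspose, Matrix.one_mul, Matrix.mul_assoc,
              unitary_mul_conjTranspose, Matrix.mul_one]
        _ = 0 := by rw [h0, Matrix.mul_zero, Matrix.zero_mul])
    have h5 := smul_left_injective ℂ h4 h1
    beta_reduce at h5
    ext
    push_cast
    rw [← h5]
    linear_combination (φA b : ℂ) * φA a * ω (T a) (T b) * star_circle_mul_self (ω a b)

end Push

/-! ### Existence of push-through data -/

section PushExists

open Filter Topology

variable {ι κ : Type*} [Fintype ι] [Fintype κ] [DecidableEq ι] [DecidableEq κ]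

lemma word_succ (C : ℕ → ι → Matrix κ κ ℂ) {n : ℕ} (s : Fin (n + 1) → ι) :
    word C s = word C (fun i : Fin n => s i.castSucc) * C n (s (Fin.last n)) := by
  rw [word, List.ofFn_succ_last]
  simp [word]

lemma word_physMap (M : ℕ → Matrix ι ι ℂ) (A : ι → Matrix κ κ ℂ) {n : ℕ} (s : Fin n → ι) :
    word (fun j => physMap (M j) A) s =
      ∑ s' : Fin n → ι, (∏ j : Fin n, M j (s j) (s' j)) • word (fun _ => A) s' := by
  induction n with
  | zero => simp [word]
  | succ n ih =>
    rw [word_succ, ih, ← (Fin.snocEquiv fun _ => ι).sum_comp, Fintype.sum_prod_type, Finset.sum_comm,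
      Matrix.sum_mul]
    refine Finset.sum_congr rfl fun s' _ => ?_
    rw [physMap, Matrix.mul_sum]
    refine Finset.sum_congr rfl fun a _ => ?_
    have h : word (fun _ => A) ((Fin.snocEquiv fun _ => ι) (a, s')) =
        word (fun _ => A) s' * A a := by
      rw [word_succ]
      simp [Fin.snocEquiv]
    rw [h, Fin.prod_univ_castSucc, Matrix.smul_mul, Matrix.mul_smul, smul_smul]
    simp [Fin.snocEquiv]

/-- The bond unitaries telescope; only the two outermost ones survive. -/
lemma word_conj (A : ι → Matrix κ κ ℂ) (V : ℕ → Matrix.unitaryGroup κ ℂ) (a : ℕ → ℂ) {n : ℕ}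
    (s : Fin n → ι) :
    word (fun j s => a j • ((V j).1ᴴ * A s * (V (j + 1)).1)) s =
      (∏ j : Fin n, a j) • ((V 0).1ᴴ * word (fun _ => A) s * (V n).1) := by
  induction n with
  | zero =>
    simp only [word, List.ofFn_zero, List.prod_nil, Finset.univ_eq_empty, Finset.prod_empty,
      one_smul, Matrix.mul_one]
    rw [unitary_conjTranspose_mul]
  | succ n ih =>
    rw [word_succ, ih, word_succ (fun _ => A), Fin.prod_univ_castSucc, Matrix.smul_mul,
      Matrix.mul_smul, smul_smul]
    simp only [Fin.val_castSucc, Fin.val_last]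
    congr 1
    calc _ = (V 0).1ᴴ * word (fun _ => A) (fun i : Fin n => s i.castSucc) *
          ((V n).1 * (V n).1ᴴ) * A (s (Fin.last n)) * (V (n + 1)).1 := by
          simp only [Matrix.mul_assoc]
      _ = _ := by
          rw [unitary_mul_conjTranspose, Matrix.mul_one]
          simp only [Matrix.mul_assoc]

variable {G : Type} [Group G] {T : MulAut G} {L : ℕ}

lemma pow_mul_eq_one {M : Type*} [Monoid M] {T : M} (hT : T ^ L = 1) (k : ℕ) : T ^ (k * L) = 1 := by
  rw [mul_comm, pow_mul, hT, one_pow]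

/-- Tensors with push-through data generate symmetric states. -/
lemma PushesTo.isSymmetric {d χ : ℕ} {U : G →* Matrix.unitaryGroup (Fin d) ℂ} {A : MPSTensor d χ}
    {v : G → Matrix.unitaryGroup (Fin χ) ℂ} {φ : G → Circle} (hT : T ^ L = 1)
    (h : PushesTo T U v φ A) : IsSymmetric T L U A := by
  intro k _ g
  refine ⟨∏ j : Fin (k * L), φ ((T ^ (j : ℕ)) g), fun s => ?_⟩
  have h1 := congrArg Matrix.trace (word_physMap (fun j => (U ((T ^ j) g)).1) A s)
  have h2 : (fun j => physMap (U ((T ^ j) g)).1 A) = fun j s =>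
      (φ ((T ^ j) g) : ℂ) • ((v ((T ^ j) g)).1ᴴ * A s * (v ((T ^ (j + 1)) g)).1) := by
    funext j s
    rw [h, pow_succ', MulAut.mul_apply]
  rw [h2, word_conj A (fun j => v ((T ^ j) g)) (fun j => φ ((T ^ j) g)), Matrix.trace_smul,
    pow_mul_eq_one hT, pow_zero, Matrix.trace_mul_comm, ← Matrix.mul_assoc,
    unitary_mul_conjTranspose, Matrix.one_mul, Matrix.trace_sum] at h1
  simp only [Matrix.trace_smul, smul_eq_mul] at h1
  refine h1.symm.trans ?_
  congr 1
  exact (map_prod Circle.coeHom _ _).symm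

/-- The condition at site `j` for `g` is the condition at site `0` for `T^j(g)`. -/
lemma pushThrough_iff {S : SymMPS T L} {v : G → Matrix.unitaryGroup (Fin S.χ) ℂ}
    {φ : G → Circle} : S.PushThrough v φ ↔ PushesTo T S.U v φ S.A := by
  constructor
  · intro h g s
    exact h 0 g s
  · intro h j g s
    have := h ((T ^ j) g) s
    rw [← MulAut.mul_apply, ← pow_succ'] at this
    exact this

/-- For a fixed group element, the modulated symmetry of the states is implemented on the bonds by
a sequence of unitaries. -/
lemma exists_bond_unitaries {d χ : ℕ} {U : G →* Matrix.unitaryGroup (Fin d) ℂ}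
    {A : MPSTensor d χ} {ρ : Matrix (Fin χ) (Fin χ) ℂ} (hp : Primitive A ρ) (hL : 1 ≤ L)
    (hT : T ^ L = 1) (hs : IsSymmetric T L U A) (g : G) :
    ∃ (V : ℕ → Matrix.unitaryGroup (Fin χ) ℂ) (μ : ℂ), ‖μ‖ = 1 ∧
      (∀ j s, physMap (U ((T ^ j) g)).1 A s = (V j).1ᴴ * A s * (V (j + 1)).1) ∧
      ∀ j, (V (L + j)).1 = μ • (V j).1 := by
  let B : ℕ → MPSTensor d χ := fun j => physMap (U ((T ^ j) g)).1 A
  have hBper (j : ℕ) : B (L + j) = B j := by simp only [B, pow_add, hT, one_mul]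
  have hmixB (j : ℕ) : mix (B j) (B j) = mix A A :=
    mix_physMap (unitary_conjTranspose_mul _) A A
  have htrace (k : ℕ) (hk : 1 ≤ k) : ‖LinearMap.trace ℂ _ (mixChain A B L ^ k)‖ =
      ‖LinearMap.trace ℂ _ (mix A A ^ (k * L))‖ := by
    obtain ⟨θ, hθ⟩ := hs k hk g
    have h1 (s : Fin (k * L) → Fin d) :
        (word B s).trace = θ * (word (fun _ => A) s).trace := by
      have h2 := congrArg Matrix.trace (word_physMap (fun j => (U ((T ^ j) g)).1) A s)
      rw [Matrix.trace_sum] at h2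
      simp only [Matrix.trace_smul, smul_eq_mul] at h2
      exact h2.trans (hθ s)
    rw [← mixChain_mul A hBper, ← mixChain_const, trace_mixChain, trace_mixChain]
    simp only [h1, mul_left_comm _ (θ : ℂ)]
    rw [← Finset.mul_sum, norm_mul, Circle.norm_coe, one_mul]
  -- Otherwise the overlaps of the state with its rotated copy would tend to `0`, whereas by
  -- symmetry their modulus is the squared norm, which tends to `1`.
  obtain ⟨μ, x, hx, hxe, hμ⟩ : ∃ (μ : ℂ) (x : Matrix (Fin χ) (Fin χ) ℂ), x ≠ 0 ∧
      mixChain A B L x = μ • x ∧ 1 ≤ ‖μ‖ := by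
    by_contra! hcon
    have h1 : Tendsto (fun k => LinearMap.trace ℂ _ (mixChain A B L ^ k)) atTop (𝓝 0) := by
      simp only [trace_end]
      have h2 := tendsto_finsetSum Finset.univ fun i (_ : i ∈ Finset.univ) =>
        tendsto_finsetSum Finset.univ fun j (_ : j ∈ Finset.univ) =>
          tendsto_entry (tendsto_end_pow_zero (mixChain A B L) hcon (Matrix.single i j 1)) i j
      simpa using h2
    have h2 := (hp.tendsto_trace.comp (tendsto_id.atTop_mul_const' (by omega : 0 < L))).norm
    have h3 := h1.norm
    rw [norm_zero] at h3
    rw [norm_one] at h2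
    refine zero_ne_one (tendsto_nhds_unique h3 (h2.congr' ?_))
    filter_upwards [eventually_ge_atTop 1] with k hk
    exact (htrace k hk).symm
  let Y : ℕ → Matrix (Fin χ) (Fin χ) ℂ := fun j => mixChain A B j x
  have hYsucc (j : ℕ) : mix A (B j) (Y j) = Y (j + 1) := rfl
  have hYper (j : ℕ) : Y (L + j) = μ • Y j := by
    simp only [Y]
    rw [mixChain_add, Module.End.mul_apply, hxe, map_smul, funext hBper]
  let w : ℕ → ℝ := fun j => (ρ * ((Y j)ᴴ * Y j)).trace.re
  have hB (j : ℕ) (Z : Matrix (Fin χ) (Fin χ) ℂ) :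
      (ρ * mix (B j) (B j) Z).trace = (ρ * Z).trace := by rw [hmixB, hp.trace_mul_mix]
  -- The weights cannot increase along the chain, but are multiplied by `‖μ‖² ≥ 1` over a unit cell.
  -- Hence `‖μ‖ = 1` and they are constant, so the Schwarz defect vanishes at every site.
  have hanti : Antitone w := antitone_nat_of_succ_le fun j =>
    trace_weight_mix_le hp.left hp.posDef (hB j) (Y j)
  have hwper (j : ℕ) : w (L + j) = ‖μ‖ ^ 2 * w j := by
    simp only [w]
    rw [hYper, Matrix.conjTranspose_smul]
    simp only [Matrix.smul_mul, Matrix.mul_smul, smul_smul, Matrix.trace_smul, smul_eq_mul]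
    have h1 : star μ * μ = ((‖μ‖ ^ 2 : ℝ) : ℂ) := by
      rw [Complex.star_def, ← Complex.normSq_eq_conj_mul_self, Complex.normSq_eq_norm_sq]
    rw [mul_comm μ, h1, Complex.re_ofReal_mul]
  have hw0 (j : ℕ) : 0 ≤ w j := trace_weight_nonneg hp.posDef (Y j)
  have hY0 : Y 0 = x := rfl
  have hw00 : 0 < w 0 := by
    refine (hw0 0).lt_of_ne' fun h0 => hx ?_
    rw [← hY0]
    exact eq_zero_of_trace_weight hp.posDef h0.le
  have hμ1 : ‖μ‖ = 1 := by
    have h1 := hanti (Nat.zero_le (L + 0))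
    rw [hwper] at h1
    have h2 : ‖μ‖ ^ 2 ≤ 1 := le_of_mul_le_mul_right (by rwa [one_mul]) hw00
    exact le_antisymm (by nlinarith [norm_nonneg μ]) hμ
  have hint (j : ℕ) (s : Fin d) : A s * Y (j + 1) = Y j * B j s := by
    refine mul_mix_eq_of_trace_weight hp.left hp.posDef (hB j) ?_ s
    change w j ≤ w (j + 1)
    have h1 := hwper j
    rw [hμ1, one_pow, one_mul] at h1
    rw [← h1]
    exact hanti (by omega)
  have hsq (j : ℕ) : mix A A ((Y j)ᴴ * Y j) = (Y (j + 1))ᴴ * Y (j + 1) := by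
    rw [← hmixB j, mix_apply]
    calc _ = ∑ s, (Y j * B j s)ᴴ * (Y j * B j s) := by
          simp only [Matrix.conjTranspose_mul, Matrix.mul_assoc]
      _ = ∑ s, (Y (j + 1))ᴴ * ((A s)ᴴ * A s) * Y (j + 1) := by
          simp only [← hint, Matrix.conjTranspose_mul, Matrix.mul_assoc]
      _ = _ := by rw [← Matrix.sum_mul, ← Matrix.mul_sum, hp.left, Matrix.mul_one]
  -- The positive matrices `Y_j† Y_j` follow the dual transfer map and are periodic, hence scalar.
  -- The common scalar is `w 0`, so division by its square root makes the intertwiners unitary.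
  obtain ⟨p, hp1, hpow⟩ := mix_pow_of_step (fun j => (Y j)ᴴ * Y j) (fun _ => 1)
    (fun j => by rw [one_smul]; exact hsq j) (by simp) L
  have hYL : Y L = μ • Y 0 := hYper 0
  rw [hYL, Matrix.conjTranspose_smul, Matrix.smul_mul, Matrix.mul_smul, smul_smul, smul_smul]
    at hpow
  obtain ⟨c, hc⟩ := hp.eq_smul_one hL (by simp [hp1, hμ1]) hpow
  have hcj (j : ℕ) : (Y j)ᴴ * Y j = c • 1 := by
    induction j with
    | zero => exact hc
    | succ j ih => rw [← hsq, ih, map_smul, hp.mix_one]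
  have hcw : c = (w 0 : ℂ) := by
    have h1 : (ρ * ((Y 0)ᴴ * Y 0)).trace = c := by
      rw [hc, Matrix.mul_smul, Matrix.mul_one, Matrix.trace_smul, hp.trace_eq, smul_eq_mul, mul_one]
    obtain ⟨K, K', -, hK⟩ := exists_weight (κ := Fin χ) hp.posDef
    have h2 := hK (Y 0)
    simp only [w]
    rw [h2, Complex.ofReal_re, ← h2, h1]
  have hunit (j : ℕ) : ((((√(w 0))⁻¹ : ℝ) : ℂ) • Y j) ∈ Matrix.unitaryGroup (Fin χ) ℂ := by
    rw [Matrix.mem_unitaryGroup_iff', Matrix.star_eq_conjTranspose, Matrix.conjTranspose_smul,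
      Matrix.smul_mul, Matrix.mul_smul, smul_smul, hcj, smul_smul, hcw, Complex.star_def,
      Complex.conj_ofReal, ← Complex.ofReal_mul, ← Complex.ofReal_mul, ← mul_inv,
      Real.mul_self_sqrt hw00.le, inv_mul_cancel₀ hw00.ne', Complex.ofReal_one, one_smul]
  refine ⟨fun j => ⟨_, hunit j⟩, μ, hμ1, fun j s => ?_, fun j => ?_⟩
  · have h1 := unitary_conjTranspose_mul (⟨_, hunit j⟩ : Matrix.unitaryGroup (Fin χ) ℂ)
    calc B j s = ((((√(w 0))⁻¹ : ℝ) : ℂ) • Y j)ᴴ * ((((√(w 0))⁻¹ : ℝ) : ℂ) • Y j) * B j s := by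
          rw [h1, Matrix.one_mul]
      _ = ((((√(w 0))⁻¹ : ℝ) : ℂ) • Y j)ᴴ * A s * ((((√(w 0))⁻¹ : ℝ) : ℂ) • Y (j + 1)) := by
          simp only [Matrix.mul_smul, Matrix.smul_mul, Matrix.mul_assoc, hint]
  · change _ • Y (L + j) = μ • _ • Y j
    rw [hYper, smul_comm]

/-- Symmetric injective tensors have push-through data. -/
theorem exists_push {d χ : ℕ} {U : G →* Matrix.unitaryGroup (Fin d) ℂ} {A : MPSTensor d χ}
    {ρ : Matrix (Fin χ) (Fin χ) ℂ} (hp : Primitive A ρ) (hL : 1 ≤ L) (hT : T ^ L = 1)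
    (hs : IsSymmetric T L U A) : ∃ v φ, PushesTo T U v φ A := by
  choose V μ hμ hpush hper using exists_bond_unitaries hp hL hT hs
  -- The sequence of `g` from site `1` on and that of `T g` from site `0` on implement the same
  -- operators; the phase between them is `φ(g)`.
  have hc (g : G) : ∃ c : Circle, (V g 1).1 = (c : ℂ) • (V (T g) 0).1 :=
    hp.unique_push hL (V := fun j => V g (j + 1)) (W := fun j => V (T g) j) (a := fun _ => 1)
      (by simp) (fun j s => by
        rw [one_smul, ← hpush, ← hpush, pow_succ, MulAut.mul_apply]) (hμ g) (hμ (T g))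
      (hper g 1) (hper (T g) 0)
  choose φ hφ using hc
  refine ⟨fun g => V g 0, φ, fun g s => ?_⟩
  have h1 := hpush g 0 s
  rw [pow_zero, MulAut.one_apply, zero_add, hφ, Matrix.mul_smul] at h1
  exact h1

end PushExists

/-! ### The crystalline class of a symmetric tensor -/

section Class

open Filter Topology

variable {ι ι' κ κ' : Type*} [Fintype ι] [Fintype ι'] [Fintype κ] [Fintype κ'] [DecidableEq ι]
  [DecidableEq ι'] [DecidableEq κ] [DecidableEq κ']

lemma transferMap_eq_mix (A : ι → Matrix κ κ ℂ) :
    transferMap A = mix (fun s => (A s)ᴴ) (fun s => (A s)ᴴ) := by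
  ext1 X
  simp [transferMap_apply, mix_apply]

lemma transferMap_physMap {M : Matrix ι' ι ℂ} (hM : Mᴴ * M = 1) (A : ι → Matrix κ κ ℂ) :
    transferMap (physMap M A) = transferMap A := by
  have h : (fun s => (physMap M A s)ᴴ) = physMap (M.map star) (fun s => (A s)ᴴ) := by
    funext s
    simp [physMap, Matrix.conjTranspose_sum]
  rw [transferMap_eq_mix, h, mix_physMap, ← transferMap_eq_mix]
  rw [← Matrix.transpose_inj, Matrix.transpose_mul, Matrix.transpose_one]
  ext i j
  have h1 := congrFun (congrFun hM i) j
  simp only [Matrix.mul_apply, Matrix.conjTranspose_apply, Matrix.transpose_apply, Matrix.map_apply,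
    star_star] at h1 ⊢
  exact h1

lemma Primitive.physMap {A : ι → Matrix κ κ ℂ} {ρ : Matrix κ κ ℂ} (h : Primitive A ρ)
    {M : Matrix ι' ι ℂ} (hM : Mᴴ * M = 1) : Primitive (physMap M A) ρ where
  left := by
    have h1 := congrArg (fun f => f 1) (mix_physMap hM A A)
    simpa [mix_apply, h.left] using h1
  posDef := h.posDef
  trace_eq := h.trace_eq
  tendsto := by rw [transferMap_physMap hM]; exact h.tendsto

variable {G : Type} [Group G] {T : MulAut G} {L : ℕ}

lemma PushesTo.physMap {U : G → Matrix.unitaryGroup ι ℂ} {R : G → Matrix.unitaryGroup ι' ℂ}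
    {v : G → Matrix.unitaryGroup κ ℂ} {φ : G → Circle} {A : ι → Matrix κ κ ℂ}
    (h : PushesTo T U v φ A) {M : Matrix ι' ι ℂ} (hM : ∀ g, (R g).1 * M = M * (U g).1) :
    PushesTo T R v φ (physMap M A) := by
  intro g s
  rw [← physMap_mul, hM, physMap_mul]
  have h1 : ModulatedMPS.physMap (U g).1 A = fun s => (φ g : ℂ) • ((v g).1ᴴ * A s * (v (T g)).1) :=
    funext (h g)
  rw [h1, physMap_smul_mul]

/-- The class `x` is encoded in push-through data of `A`. -/
def HasClass (T : MulAut G) (U : G → Matrix.unitaryGroup ι ℂ) (A : ι → Matrix κ κ ℂ)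
    (x : groupCohomology.H2 (U1 (FullGroup T))) : Prop :=
  ∃ (v : G → Matrix.unitaryGroup κ ℂ) (φ : G → Circle) (ω : G → G → Circle), PushesTo T U v φ A ∧
    (∀ g h, (v g).1 * (v h).1 = (ω g h : ℂ) • (v (g * h)).1) ∧ Encodes T x ω φ

lemma HasClass.physMap {U : G → Matrix.unitaryGroup ι ℂ} {R : G → Matrix.unitaryGroup ι' ℂ}
    {A : ι → Matrix κ κ ℂ} {x : groupCohomology.H2 (U1 (FullGroup T))}
    (h : HasClass T U A x) {M : Matrix ι' ι ℂ} (hM : ∀ g, (R g).1 * M = M * (U g).1) :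
    HasClass T R (physMap M A) x := by
  obtain ⟨v, φ, ω, h1, h2, h3⟩ := h
  exact ⟨v, φ, ω, h1.physMap hM, h2, h3⟩

/-- The dominant eigenvector intertwines the two projective bond representations up to the phases
`z`. Evaluating a product of two bond unitaries on it in two ways shows that `z` also relates the
cocycles. -/
lemma HasClass.eq_of_dominant {U : G → Matrix.unitaryGroup ι ℂ} {A : ι → Matrix κ κ ℂ}
    {B : ι → Matrix κ' κ' ℂ} {x x' : groupCohomology.H2 (U1 (FullGroup T))}
    (hA : HasClass T U A x) (hB : HasClass T U B x') {N : ℕ} (hN : 1 ≤ N)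
    (hT : T ^ N = 1) {μ : ℂ} {y : Matrix κ κ' ℂ} (hμ : μ ≠ 0) (hy : y ≠ 0)
    (hFy : (mix A B ^ N) y = μ • y)
    (hdom : ∀ (ν : ℂ) (z : Matrix κ κ' ℂ), (mix A B ^ N) z = ν • z → ‖ν‖ = ‖μ‖ →
      ∃ c : ℂ, z = c • y) : x = x' := by
  obtain ⟨vA, φA, ωA, hA1, hA2, hA3⟩ := hA
  obtain ⟨vB, φB, ωB, hB1, hB2, hB3⟩ := hB
  obtain ⟨z, hz, hz'⟩ := exists_match hA1 hB1 hN hT hμ hy hFy hdom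
  refine (hA3.eq_iff hB3).2 ⟨z, fun a b => ?_, fun a => by rw [← hz', mul_comm]⟩
  have h1 : (vA a).1 * (vA b).1 * y = ((ωA a b : ℂ) * z (a * b)) • (y * (vB (a * b)).1) := by
    rw [hA2, Matrix.smul_mul, hz, smul_smul]
  have h2 : (vA a).1 * (vA b).1 * y =
      ((z a : ℂ) * z b * ωB a b) • (y * (vB (a * b)).1) := by
    rw [Matrix.mul_assoc, hz, Matrix.mul_smul, ← Matrix.mul_assoc, hz, Matrix.smul_mul,
      Matrix.mul_assoc, hB2, Matrix.mul_smul, smul_smul, smul_smul]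
    congr 1
    ring
  have h3 : y * (vB (a * b)).1 ≠ 0 := fun h0 => hy <| by
    rw [← Matrix.mul_one y, ← unitary_mul_conjTranspose (vB (a * b)), ← Matrix.mul_assoc, h0,
      Matrix.zero_mul]
  have h4 := smul_left_injective ℂ h3 (h1.symm.trans h2)
  exact Circle.ext (by push_cast; exact h4)

/-- Equal states have equal overlaps. Injectivity of `A` is not needed, which is what makes the end
points of a deformation accessible. -/
lemma tendsto_trace_mix {A : ι → Matrix κ κ ℂ} {B : ι → Matrix κ' κ' ℂ} {ρ : Matrix κ' κ' ℂ}
    (hB : Primitive B ρ) (h : ∀ n : ℕ, 1 ≤ n → ∀ s : Fin n → ι,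
      (word (fun _ => A) s).trace = (word (fun _ => B) s).trace) :
    Tendsto (fun n => LinearMap.trace ℂ _ (mix A B ^ n)) atTop (𝓝 1) := by
  refine hB.tendsto_trace.congr' ?_
  filter_upwards [eventually_ge_atTop 1] with n hn
  rw [← mixChain_const, ← mixChain_const, trace_mixChain, trace_mixChain]
  simp only [h n hn]

/-- The class does not change under small deformations. -/
lemma eventually_class_eq {U : G → Matrix.unitaryGroup ι ℂ} {A₀ : ι → Matrix κ κ ℂ}
    {B : ι → Matrix κ' κ' ℂ} {ρ : Matrix κ' κ' ℂ} (hL : 1 ≤ L) (hT : T ^ L = 1)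
    (hA : ∑ s, (A₀ s)ᴴ * A₀ s = 1) (hB : Primitive B ρ)
    (h : ∀ n : ℕ, 1 ≤ n → ∀ s : Fin n → ι,
      (word (fun _ => A₀) s).trace = (word (fun _ => B) s).trace) :
    ∀ᶠ A in 𝓝 A₀, ∀ x x', HasClass T U A x → HasClass T U B x' → x = x' := by
  obtain ⟨N, hN, ⟨k, rfl⟩, hev⟩ := exists_dominant_mix hA hB (tendsto_trace_mix hB h) hL
  filter_upwards [hev] with A ⟨μ, y, hμ, hy, hFy, hdom⟩ x x' hx hx'
  exact hx.eq_of_dominant hx' hN (by rw [pow_mul, hT, one_pow]) hμ hy hFy hdom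

lemma HasClass.unique {U : G → Matrix.unitaryGroup ι ℂ} {A : ι → Matrix κ κ ℂ}
    {ρ : Matrix κ κ ℂ} (hp : Primitive A ρ) (hL : 1 ≤ L) (hT : T ^ L = 1)
    {x x' : groupCohomology.H2 (U1 (FullGroup T))} (h : HasClass T U A x)
    (h' : HasClass T U A x') : x = x' :=
  (eventually_class_eq hL hT hp.left hp fun _ _ _ => rfl).self_of_nhds x x' h h'

lemma PushesTo.exists_hasClass {U : G →* Matrix.unitaryGroup ι ℂ} {A : ι → Matrix κ κ ℂ}
    {v : G → Matrix.unitaryGroup κ ℂ} {φ : G → Circle} {ρ : Matrix κ κ ℂ} (hp : Primitive A ρ)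
    (hL : 1 ≤ L) (hT : T ^ L = 1) (h : PushesTo T U v φ A) :
    ∃ ω x, (∀ g h, (v g).1 * (v h).1 = (ω g h : ℂ) • (v (g * h)).1) ∧ Encodes T x ω φ := by
  obtain ⟨ω, h1, h2, h3⟩ := h.exists_cocycle hp hL hT
  obtain ⟨x, hx⟩ := exists_encodes h2 h3
  exact ⟨ω, x, h1, hx⟩

lemma exists_hasClass {d χ : ℕ} {U : G →* Matrix.unitaryGroup (Fin d) ℂ} {A : MPSTensor d χ}
    (hA : IsCanonicalInjective A) (hL : 1 ≤ L) (hT : T ^ L = 1) (hs : IsSymmetric T L U A) :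
    ∃ x, HasClass T U A x := by
  obtain ⟨ρ, hp⟩ := hA.exists_primitive
  obtain ⟨v, φ, h⟩ := exists_push hp hL hT hs
  obtain ⟨ω, x, h1, h2⟩ := h.exists_hasClass hp hL hT
  exact ⟨x, v, φ, ω, h, h1, h2⟩

lemma hasCrystallineClass_iff {S : SymMPS T L} {x : groupCohomology.H2 (U1 (FullGroup T))} :
    S.HasCrystallineClass x ↔ HasClass T S.U S.A x := by
  constructor
  · rintro ⟨v, φ, c, h1, h2, h3, h4⟩
    exact ⟨v, φ, fun g h => phaseOf c (SemidirectProduct.inl g) (SemidirectProduct.inl h),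
      pushThrough_iff.1 h1, h2, _, ⟨c, fun _ _ => rfl, h4⟩, fun _ _ => rfl, h3⟩
  · rintro ⟨v, φ, ω, h1, h2, f, ⟨c, hc, h4⟩, h5, h6⟩
    exact ⟨v, φ, c, pushThrough_iff.2 h1, fun g h => by rw [hc, h5, h2],
      fun g => by rw [hc, hc, h6], h4⟩

end Class

/-! ### Invariance under deformations -/

section Invariance

open Filter Topology Set

variable {G : Type} [Group G] {T : MulAut G} {L : ℕ}

/-- At an end point the tensor is only a limit of injective ones. Left-canonicity survives the
limit, and together with the states it generates this suffices for the comparison with `B`. -/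
lemma class_eq_of_tendsto {d χ χ' : ℕ} {R : G →* Matrix.unitaryGroup (Fin d) ℂ}
    {A : ℝ → MPSTensor d χ} {t₀ : ℝ} (ht₀ : t₀ ∈ Icc (0 : ℝ) 1)
    (hcont : ContinuousOn A (Icc 0 1))
    (hA : ∀ t ∈ Ioo (0 : ℝ) 1, IsCanonicalInjective (A t)) (hL : 1 ≤ L) (hT : T ^ L = 1)
    {B : MPSTensor d χ'} {ρ : Matrix (Fin χ') (Fin χ') ℂ} (hB : Primitive B ρ)
    (hAB : SameStates (A t₀) B) :
    ∀ᶠ t in 𝓝[Ioo 0 1] t₀, ∀ x x', HasClass T R (A t) x → HasClass T R B x' → x = x' := by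
  have htend : Tendsto A (𝓝[Ioo 0 1] t₀) (𝓝 (A t₀)) :=
    (hcont t₀ ht₀).mono_left (nhdsWithin_mono _ Ioo_subset_Icc_self)
  have hne : (𝓝[Ioo (0 : ℝ) 1] t₀).NeBot := by
    rw [← mem_closure_iff_nhdsWithin_neBot, closure_Ioo zero_ne_one]
    exact ht₀
  have hleft : ∑ s, (A t₀ s)ᴴ * A t₀ s = 1 := by
    have hc : Continuous fun C : MPSTensor d χ => ∑ s, (C s)ᴴ * C s :=
      continuous_finsetSum _ fun s _ =>
        (continuous_apply s).matrix_conjTranspose.matrix_mul (continuous_apply s)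
    refine tendsto_nhds_unique ((hc.tendsto _).comp htend) (tendsto_const_nhds.congr' ?_)
    filter_upwards [self_mem_nhdsWithin] with t ht
    exact (hA t ht).left_canonical.symm
  exact htend.eventually (eventually_class_eq hL hT hleft hB hAB)

/-- The class is locally constant on the connected open interval, and near each end it agrees with
that of the embedded state. -/
lemma Deformation.class_eq {S₀ S₁ : SymMPS T L} (h : Deformation S₀ S₁) (hL : 1 ≤ L)
    (hT : T ^ L = 1) {x₀ x₁ : groupCohomology.H2 (U1 (FullGroup T))}
    (h₀ : HasClass T S₀.U S₀.A x₀) (h₁ : HasClass T S₁.U S₁.A x₁) : x₀ = x₁ := by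
  obtain ⟨d, χ, R, J₀, J₁, A, hJ₀, hJ₁, hR₀, hR₁, hcont, hmid, hs₀, hs₁⟩ := h
  have hinj := fun t ht => (hmid t ht).1
  have hex (t : ℝ) (ht : t ∈ Ioo (0 : ℝ) 1) : ∃ x, HasClass T R (A t) x :=
    exists_hasClass (hmid t ht).1 hL hT (hmid t ht).2
  have hmain {t t' : ℝ} (ht : t ∈ Ioo (0 : ℝ) 1) (ht' : t' ∈ Ioo (0 : ℝ) 1) :
      ∀ x x', HasClass T R (A t) x → HasClass T R (A t') x' → x = x' := by
    refine isPreconnected_Ioo.induction₂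
      (fun t t' => ∀ x x', HasClass T R (A t) x → HasClass T R (A t') x' → x = x')
      (fun t ht => ?_) (fun a b c _ hb _ hab hbc x x' hx hx' => ?_)
      (fun a b _ _ hab x x' hx hx' => (hab x' x hx' hx).symm) ht ht'
    · obtain ⟨ρ, hρ⟩ := (hinj t ht).exists_primitive
      filter_upwards [class_eq_of_tendsto (R := R) (Ioo_subset_Icc_self ht) hcont hinj hL hT hρ
        fun _ _ _ => rfl] with t' h x x' hx hx'
      exact (h x' x hx' hx).symm
    · obtain ⟨y, hy⟩ := hex b hb
      exact (hab x y hx hy).trans (hbc y x' hy hx')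
  have hend {t₀ : ℝ} (ht₀ : t₀ ∈ Icc (0 : ℝ) 1) {S : SymMPS T L} {J : Matrix (Fin d) (Fin S.d) ℂ}
      (hJ : Jᴴ * J = 1) (hRJ : ∀ g, (R g).1 * J = J * (S.U g).1)
      (hs : SameStates (A t₀) (physAct J S.A)) {x : groupCohomology.H2 (U1 (FullGroup T))}
      (hx : HasClass T S.U S.A x) : ∃ t ∈ Ioo (0 : ℝ) 1, HasClass T R (A t) x := by
    obtain ⟨ρ, hρ⟩ := S.injective.exists_primitive
    have hne : (𝓝[Ioo (0 : ℝ) 1] t₀).NeBot := by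
      rw [← mem_closure_iff_nhdsWithin_neBot, closure_Ioo zero_ne_one]
      exact ht₀
    obtain ⟨t, h, ht⟩ := ((class_eq_of_tendsto (R := R) ht₀ hcont hinj hL hT (hρ.physMap hJ)
      hs).and self_mem_nhdsWithin).exists
    obtain ⟨y, hy⟩ := hex t ht
    rw [← h y x hy (hx.physMap hRJ)]
    exact ⟨t, ht, hy⟩
  obtain ⟨t, ht, hx⟩ := hend (by simp) hJ₀ hR₀ hs₀ h₀
  obtain ⟨t', ht', hx'⟩ := hend (by simp) hJ₁ hR₁ hs₁ h₁
  exact hmain ht ht' _ _ hx hx'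

/-- The crystalline class as an invariant of phases. -/
theorem exists_kappa (hL : 1 ≤ L) (hT : T ^ L = 1) :
    ∃ k : Phase T L → groupCohomology.H2 (U1 (FullGroup T)),
      ∀ (S : SymMPS T L) x, HasClass T S.U S.A x ↔ k S.phase = x := by
  have hex (S : SymMPS T L) : ∃ x, HasClass T S.U S.A x :=
    exists_hasClass S.injective hL hT S.symmetric
  choose k hk using hex
  refine ⟨Quot.lift k fun S₀ S₁ h => h.class_eq hL hT (hk S₀) (hk S₁), fun S x => ?_⟩
  obtain ⟨ρ, hρ⟩ := S.injective.exists_primitive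
  exact ⟨fun h => (hk S).unique hρ hL hT h, fun h => h ▸ hk S⟩

end Invariance

/-! ### Change of index types -/

section Reindex

open Filter Topology

variable {ι ι' κ κ' : Type*} [Fintype ι] [Fintype ι'] [Fintype κ] [Fintype κ'] [DecidableEq ι]
  [DecidableEq ι'] [DecidableEq κ] [DecidableEq κ']

lemma unitary_ext {v w : Matrix.unitaryGroup κ ℂ} (h : v.1 = w.1) : v = w := Subtype.ext h

/-- Unitary matrices with renamed indices. -/
def reindexUnitary (f : κ' ≃ κ) : Matrix.unitaryGroup κ ℂ →* Matrix.unitaryGroup κ' ℂ where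
  toFun v := ⟨v.1.submatrix f f, by
    rw [Matrix.mem_unitaryGroup_iff, Matrix.star_eq_conjTranspose, Matrix.conjTranspose_submatrix,
      Matrix.submatrix_mul_equiv, unitary_mul_conjTranspose, Matrix.submatrix_one_equiv]⟩
  map_one' := unitary_ext (Matrix.submatrix_one_equiv f)
  map_mul' v w := unitary_ext (Matrix.submatrix_mul_equiv v.1 w.1 f f f).symm

/-- Tensors with renamed physical and bond indices. -/
def reindexTensor (e : ι' ≃ ι) (f : κ' ≃ κ) (A : ι → Matrix κ κ ℂ) : ι' → Matrix κ' κ' ℂ :=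
  fun s => (A (e s)).submatrix f f

lemma submatrix_sum {α : Type*} (t : Finset α) (f : κ' ≃ κ) (M : α → Matrix κ κ ℂ) :
    (∑ a ∈ t, M a).submatrix f f = ∑ a ∈ t, (M a).submatrix f f := by
  ext i j
  simp [Matrix.sum_apply]

lemma trace_submatrix (f : κ' ≃ κ) (M : Matrix κ κ ℂ) : (M.submatrix f f).trace = M.trace :=
  f.sum_comp fun i => M i i

lemma transferMap_reindex (e : ι' ≃ ι) (f : κ' ≃ κ) (A : ι → Matrix κ κ ℂ) (X : Matrix κ κ ℂ) :
    transferMap (reindexTensor e f A) (X.submatrix f f) = (transferMap A X).submatrix f f := by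
  simp only [transferMap_apply, reindexTensor, Matrix.conjTranspose_submatrix,
    Matrix.submatrix_mul_equiv, submatrix_sum]
  exact e.sum_comp fun s => (A s * X * (A s)ᴴ).submatrix f f

lemma Primitive.reindex {A : ι → Matrix κ κ ℂ} {ρ : Matrix κ κ ℂ} (h : Primitive A ρ)
    (e : ι' ≃ ι) (f : κ' ≃ κ) : Primitive (reindexTensor e f A) (ρ.submatrix f f) where
  left := by
    simp only [reindexTensor, Matrix.conjTranspose_submatrix, Matrix.submatrix_mul_equiv]
    rw [e.sum_comp fun s => ((A s)ᴴ * A s).submatrix f f, ← submatrix_sum, h.left,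
      Matrix.submatrix_one_equiv]
  posDef := h.posDef.submatrix f.injective
  trace_eq := by rw [trace_submatrix, h.trace_eq]
  tendsto X := by
    obtain ⟨Y, rfl⟩ : ∃ Y : Matrix κ κ ℂ, X = Y.submatrix f f :=
      ⟨X.submatrix f.symm f.symm, by simp⟩
    have h1 (n : ℕ) : (transferMap (reindexTensor e f A) ^ n) (Y.submatrix f f) =
        ((transferMap A ^ n) Y).submatrix f f := by
      induction n with
      | zero => simp
      | succ n ih =>
        rw [pow_succ', Module.End.mul_apply, ih, transferMap_reindex, ← Module.End.mul_apply,
          ← pow_succ']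
    simp only [h1, trace_submatrix]
    exact ((continuous_id.matrix_submatrix f f).tendsto _).comp (h.tendsto Y)

variable {G : Type} [Group G] {T : MulAut G} {L : ℕ}

lemma PushesTo.reindex {U : G → Matrix.unitaryGroup ι ℂ} {v : G → Matrix.unitaryGroup κ ℂ}
    {φ : G → Circle} {A : ι → Matrix κ κ ℂ} (h : PushesTo T U v φ A) (e : ι' ≃ ι) (f : κ' ≃ κ) :
    PushesTo T (fun g => reindexUnitary e (U g)) (fun g => reindexUnitary f (v g)) φ
      (reindexTensor e f A) := by
  intro g s
  have h1 := congrArg (fun M => Matrix.submatrix M f f) (h g (e s))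
  simp only [Matrix.submatrix_smul, Pi.smul_apply, ModulatedMPS.physMap, submatrix_sum] at h1
  rw [← Matrix.submatrix_mul_equiv _ _ f f f, ← Matrix.submatrix_mul_equiv _ _ f f f] at h1
  simp only [reindexUnitary, reindexTensor, MonoidHom.coe_mk, OneHom.coe_mk, ModulatedMPS.physMap,
    Matrix.conjTranspose_submatrix]
  refine Eq.trans ?_ h1
  rw [← e.sum_comp]
  rfl

lemma word_reindex (e : ι' ≃ ι) (f : κ' ≃ κ) (A : ι → Matrix κ κ ℂ) {n : ℕ} (s : Fin n → ι') :
    word (fun _ => reindexTensor e f A) s = (word (fun _ => A) (e ∘ s)).submatrix f f := by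
  induction n with
  | zero => simp [word]
  | succ n ih =>
    rw [word_succ, ih, word_succ, ← Matrix.submatrix_mul_equiv _ _ f f f]
    rfl

/-- The symmetric MPS given by a primitive tensor with push-through data. -/
def SymMPS.ofTensor (hT : T ^ L = 1) (U : G →* Matrix.unitaryGroup ι ℂ) (A : ι → Matrix κ κ ℂ)
    (hA : ∃ ρ, Primitive A ρ) (hp : ∃ v φ, PushesTo T U v φ A) {d χ : ℕ} (e : Fin d ≃ ι)
    (f : Fin χ ≃ κ) : SymMPS T L where
  d := d
  χ := χ
  U := (reindexUnitary e).comp U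
  A := reindexTensor e f A
  injective := by
    obtain ⟨ρ, h⟩ := hA
    exact (h.reindex e f).isCanonicalInjective
  symmetric := by
    obtain ⟨v, φ, h⟩ := hp
    exact (h.reindex e f).isSymmetric hT

lemma deformation_of_path {S₀ S₁ : SymMPS T L} (hT : T ^ L = 1)
    (R : G →* Matrix.unitaryGroup ι ℂ) (J₀ : Matrix ι (Fin S₀.d) ℂ) (J₁ : Matrix ι (Fin S₁.d) ℂ)
    (A : ℝ → ι → Matrix κ κ ℂ) (hJ₀ : J₀ᴴ * J₀ = 1) (hJ₁ : J₁ᴴ * J₁ = 1)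
    (hR₀ : ∀ g, (R g).1 * J₀ = J₀ * (S₀.U g).1) (hR₁ : ∀ g, (R g).1 * J₁ = J₁ * (S₁.U g).1)
    (hcont : Continuous A) (hprim : ∀ t ∈ Set.Ioo (0 : ℝ) 1, ∃ ρ, Primitive (A t) ρ)
    (hpush : ∀ t ∈ Set.Ioo (0 : ℝ) 1, ∃ v φ, PushesTo T R v φ (A t))
    (hs₀ : ∀ n : ℕ, 1 ≤ n → ∀ s : Fin n → ι,
      (word (fun _ => A 0) s).trace = (word (fun _ => physMap J₀ S₀.A) s).trace)
    (hs₁ : ∀ n : ℕ, 1 ≤ n → ∀ s : Fin n → ι,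
      (word (fun _ => A 1) s).trace = (word (fun _ => physMap J₁ S₁.A) s).trace) :
    Deformation S₀ S₁ := by
  obtain e := (Fintype.equivFin ι).symm
  obtain f := (Fintype.equivFin κ).symm
  have hiso {d : ℕ} {J : Matrix ι (Fin d) ℂ} (hJ : Jᴴ * J = 1) :
      (J.submatrix e id)ᴴ * J.submatrix e id = 1 := by
    rw [Matrix.conjTranspose_submatrix, Matrix.submatrix_mul_equiv, hJ, Matrix.submatrix_id_id]
  have hint {d : ℕ} {J : Matrix ι (Fin d) ℂ} {U : G →* Matrix.unitaryGroup (Fin d) ℂ}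
      (hJ : ∀ g, (R g).1 * J = J * (U g).1) (g : G) :
      (reindexUnitary e (R g)).1 * J.submatrix e id = J.submatrix e id * (U g).1 := by
    simp only [reindexUnitary, MonoidHom.coe_mk, OneHom.coe_mk]
    rw [Matrix.submatrix_mul_equiv, hJ]
    rfl
  have hstates {S : SymMPS T L} {J : Matrix ι (Fin S.d) ℂ} {B : ι → Matrix κ κ ℂ}
      (h : ∀ n : ℕ, 1 ≤ n → ∀ s : Fin n → ι,
        (word (fun _ => B) s).trace = (word (fun _ => physMap J S.A) s).trace) :
      SameStates (reindexTensor e f B) (physAct (J.submatrix e id) S.A) := by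
    intro n hn s
    change (word (fun _ => reindexTensor e f B) s).trace = _
    rw [word_reindex, trace_submatrix, h n hn]
    rfl
  refine ⟨_, _, (reindexUnitary e).comp R, J₀.submatrix e id, J₁.submatrix e id,
    fun t => reindexTensor e f (A t), hiso hJ₀, hiso hJ₁, hint hR₀, hint hR₁, ?_, fun t ht => ?_,
    hstates hs₀, hstates hs₁⟩
  · refine Continuous.continuousOn (continuous_pi fun s => ?_)
    exact (((continuous_apply (e s)).comp hcont)).matrix_submatrix f f
  · obtain ⟨ρ, h⟩ := hprim t ht
    obtain ⟨v, φ, h'⟩ := hpush t ht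
    exact ⟨(h.reindex e f).isCanonicalInjective, (h'.reindex e f).isSymmetric hT⟩

end Reindex

/-! ### Criteria for primitivity -/

section Criteria

open Filter Topology

variable {ι κ : Type*} [Fintype ι] [Fintype κ] [DecidableEq ι] [DecidableEq κ]

/-- A tensor with a positive definite fixed point is primitive if it has no nontrivial
intertwiners. -/
lemma primitive_of_rigid {A : ι → Matrix κ κ ℂ} {ρ : Matrix κ κ ℂ}
    (hA : ∑ s, (A s)ᴴ * A s = 1) (hρ : ρ.PosDef) (htr : ρ.trace = 1) (hfix : transferMap A ρ = ρ)
    (hrig : ∀ (ν : ℂ) (X : Matrix κ κ ℂ), (∀ s, ν • (A s * X) = X * A s) → ∃ c : ℂ, X = c • 1) :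
    Primitive A ρ := by
  have hdual (Z : Matrix κ κ ℂ) : (ρ * mix A A Z).trace = (ρ * Z).trace := by
    rw [Matrix.trace_mul_comm, ← trace_mul_transferMap, hfix, Matrix.trace_mul_comm]
  let P : Module.End ℂ (Matrix κ κ ℂ) :=
    { toFun := fun Z => (ρ * Z).trace • 1
      map_add' := fun Z W => by rw [Matrix.mul_add, Matrix.trace_add, add_smul]
      map_smul' := fun c Z => by
        rw [Matrix.mul_smul, Matrix.trace_smul, smul_assoc, RingHom.id_apply] }
  have hP (Z : Matrix κ κ ℂ) : P Z = (ρ * Z).trace • 1 := rfl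
  have hone : mix A A 1 = 1 := by simpa [mix_apply] using hA
  have hPρ (Z : Matrix κ κ ℂ) : (ρ * P Z).trace = (ρ * Z).trace := by
    rw [hP, Matrix.mul_smul, Matrix.mul_one, Matrix.trace_smul, htr, smul_eq_mul, mul_one]
  -- An eigenvector with `‖μ‖ ≥ 1` satisfies `tr(ρ x) = 0` and is one of `mix A A`. Contraction then
  -- holds with equality, so `x` is an intertwiner, hence scalar by rigidity, hence zero.
  have hzero := tendsto_end_pow_zero (mix A A - P) fun μ x hx hxe => by
    by_contra! hμ
    have h1 : (ρ * x).trace = 0 := by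
      have h2 := congrArg (fun Z => (ρ * Z).trace) hxe
      simp only [LinearMap.sub_apply, Matrix.mul_sub, Matrix.trace_sub, hdual, hPρ, sub_self,
        Matrix.mul_smul, Matrix.trace_smul, smul_eq_mul] at h2
      refine (mul_eq_zero.1 h2.symm).resolve_left fun h0 => ?_
      rw [h0, norm_zero] at hμ
      linarith
    have h2 : mix A A x = μ • x := by
      rw [LinearMap.sub_apply, hP, h1, zero_smul, sub_zero] at hxe
      exact hxe
    have h3 := mul_mix_eq_of_trace_weight hA hρ hdual (X := x) (by
      rw [h2, Matrix.conjTranspose_smul]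
      simp only [Matrix.smul_mul, Matrix.mul_smul, smul_smul, Matrix.trace_smul, smul_eq_mul]
      have h4 : μ * star μ = ((‖μ‖ ^ 2 : ℝ) : ℂ) := by
        rw [Complex.star_def, Complex.mul_conj, Complex.normSq_eq_norm_sq]
      rw [h4, Complex.re_ofReal_mul]
      exact le_mul_of_one_le_left (trace_weight_nonneg hρ x) (one_le_pow₀ hμ))
    rw [h2] at h3
    obtain ⟨c, rfl⟩ := hrig μ x fun s => by rw [← h3, Matrix.mul_smul]
    rw [Matrix.mul_smul, Matrix.mul_one, Matrix.trace_smul, htr, smul_eq_mul, mul_one] at h1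
    exact hx (by rw [h1, zero_smul])
  have hpow (Z : Matrix κ κ ℂ) (n : ℕ) : (mix A A ^ n) Z =
      ((mix A A - P) ^ n) (Z - P Z) + P Z := by
    induction n with
    | zero => simp
    | succ n ih =>
      have h1 (n : ℕ) : (ρ * ((mix A A - P) ^ n) (Z - P Z)).trace = 0 := by
        induction n with
        | zero => rw [pow_zero, Module.End.one_apply, Matrix.mul_sub, Matrix.trace_sub, hPρ, sub_self]
        | succ n ih =>
          rw [pow_succ', Module.End.mul_apply, LinearMap.sub_apply, Matrix.mul_sub,
            Matrix.trace_sub, hdual, hPρ, sub_self]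
      rw [pow_succ', Module.End.mul_apply, ih, map_add, pow_succ', Module.End.mul_apply,
        LinearMap.sub_apply _ P, hP (((mix A A - P) ^ n) (Z - P Z)), h1, zero_smul, sub_zero, hP Z,
        map_smul, hone]
  refine ⟨hA, hρ, htr, fun X => tendsto_pi_nhds.2 fun i => tendsto_pi_nhds.2 fun j => ?_⟩
  have h1 (M : Matrix κ κ ℂ) : (Matrix.single j i 1 * M).trace = M i j := by
    simp [Matrix.trace_single_mul]
  have h2 (n : ℕ) : (transferMap A ^ n) X i j =
      ((mix A A ^ n) (Matrix.single j i 1) * X).trace := by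
    rw [← trace_mul_transferMap_pow, h1]
  have h3 : Tendsto (fun n => (mix A A ^ n) (Matrix.single j i 1)) atTop
      (𝓝 (P (Matrix.single j i 1))) := by
    have := (hzero (Matrix.single j i 1 - P (Matrix.single j i 1))).add_const
      (P (Matrix.single j i 1))
    rw [zero_add] at this
    exact this.congr fun n => (hpow _ n).symm
  have h4 : Continuous fun M : Matrix κ κ ℂ => (M * X).trace := by fun_prop
  have h5 := (h4.tendsto _).comp h3
  simp only [h2]
  refine (h5.congr fun n => rfl).trans_eq ?_
  rw [hP, Matrix.smul_mul, Matrix.one_mul, Matrix.trace_smul, Matrix.trace_mul_comm, h1]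
  simp [mul_comm]

lemma posSemidef_of_tendsto {α : Type*} {l : Filter α} [l.NeBot] {f : α → Matrix κ κ ℂ}
    {M : Matrix κ κ ℂ} (hf : ∀ a, (f a).PosSemidef) (h : Tendsto f l (𝓝 M)) : M.PosSemidef := by
  refine Matrix.PosSemidef.of_dotProduct_mulVec_nonneg ?_ fun x => ?_
  · have h1 := (continuous_id.matrix_conjTranspose.tendsto M).comp h
    exact tendsto_nhds_unique (h1.congr fun a => (hf a).1) h
  · have hc : Continuous fun M : Matrix κ κ ℂ => star x ⬝ᵥ (M *ᵥ x) := by fun_prop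
    exact ge_of_tendsto' ((hc.tendsto M).comp h) fun a => (hf a).dotProduct_mulVec_nonneg x

/-- The resolvent of a primitive transfer map at `1`. -/
lemma Primitive.exists_resolvent {A : ι → Matrix κ κ ℂ} {ρ : Matrix κ κ ℂ} (h : Primitive A ρ)
    {r : ℝ} (h0 : 0 ≤ r) (h1 : r < 1) : ∃ X : Matrix κ κ ℂ, X.PosDef ∧
      X = 1 + (r : ℂ) • transferMap A X ∧ (1 - (r : ℂ)) * X.trace = Fintype.card κ := by
  let f : Module.End ℂ (Matrix κ κ ℂ) := (r : ℂ) • transferMap A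
  have hf (n : ℕ) (X : Matrix κ κ ℂ) : (f ^ n) X = (r : ℂ) ^ n • (transferMap A ^ n) X := by
    simp only [f, smul_pow, LinearMap.smul_apply]
  have hlim (X : Matrix κ κ ℂ) : Tendsto (fun n => (f ^ n) X) atTop (𝓝 0) := by
    simp only [hf]
    have h2 : Tendsto (fun n => (r : ℂ) ^ n) atTop (𝓝 0) :=
      tendsto_pow_atTop_nhds_zero_of_norm_lt_one (by
        rwa [Complex.norm_real, Real.norm_of_nonneg h0])
    simpa using h2.smul (h.tendsto X)
  have hinj : Function.Injective (1 - f : Module.End ℂ (Matrix κ κ ℂ)) := by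
    rw [← LinearMap.ker_eq_bot, LinearMap.ker_eq_bot']
    intro X hX
    have h2 : f X = X := (sub_eq_zero.1 hX).symm
    have h3 (n : ℕ) : (f ^ n) X = X := by
      induction n with
      | zero => rfl
      | succ n ih => rw [pow_succ, Module.End.mul_apply, h2, ih]
    exact tendsto_nhds_unique (tendsto_const_nhds.congr fun n => (h3 n).symm) (hlim X)
  obtain ⟨X, hX⟩ := (LinearMap.injective_iff_surjective.1 hinj) 1
  have hX' : X = 1 + f X := by
    rw [← hX]
    simp
  have hpsd (n : ℕ) : ((f ^ n) 1).PosSemidef := by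
    induction n with
    | zero => exact Matrix.PosSemidef.one
    | succ n ih =>
      rw [pow_succ', Module.End.mul_apply]
      refine Matrix.PosSemidef.smul ?_ (by exact_mod_cast h0 : (0 : ℂ) ≤ (r : ℂ))
      rw [transferMap_apply]
      exact Matrix.posSemidef_sum _ fun s _ => ih.mul_mul_conjTranspose_same (A s)
  have hsum (n : ℕ) : X - (f ^ n) X = ∑ k ∈ Finset.range n, (f ^ k) 1 := by
    induction n with
    | zero => simp
    | succ n ih =>
      have h2 : (f ^ n) X = (f ^ n) 1 + (f ^ (n + 1)) X := by
        rw [pow_succ, Module.End.mul_apply, ← map_add, ← hX']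
      rw [Finset.sum_range_succ, ← ih, h2]
      abel
  refine ⟨X, ?_, hX', ?_⟩
  -- The matrix `f X` is the limit of the images under `f` of the Neumann partial sums, which are
  -- positive semidefinite; adding `1` makes it definite.
  · have h2 : (f X).PosSemidef := by
      refine posSemidef_of_tendsto (l := atTop)
        (f := fun n => f (∑ k ∈ Finset.range n, (f ^ k) 1)) (fun n => ?_) ?_
      · rw [map_sum]
        refine Matrix.posSemidef_sum _ fun k _ => ?_
        rw [← Module.End.mul_apply, ← pow_succ']
        exact hpsd (k + 1)
      · have h3 := ((continuous_end f).tendsto _).comp (tendsto_const_nhds.sub (hlim X) (a := X))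
        rw [sub_zero] at h3
        exact h3.congr fun n => by rw [Function.comp_apply, hsum]
    rw [hX']
    exact Matrix.PosDef.one.add_posSemidef h2
  · have h2 := congrArg Matrix.trace hX'
    simp only [f, LinearMap.smul_apply, Matrix.trace_add, Matrix.trace_one, Matrix.trace_smul,
      trace_transferMap h.left, smul_eq_mul] at h2
    rw [sub_mul, one_mul, sub_eq_iff_eq_add]
    exact h2

end Criteria

/-! ### Rectangular push-through and block tensors -/

section Blocks

variable {ι ι' κ κ' κ₀ κ₁ : Type*} [Fintype ι] [Fintype ι'] [Fintype κ] [Fintype κ'] [Fintype κ₀]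
  [Fintype κ₁] [DecidableEq ι] [DecidableEq ι'] [DecidableEq κ] [DecidableEq κ']
  [DecidableEq κ₀] [DecidableEq κ₁]

variable {G : Type} [Group G] {T : MulAut G} {L : ℕ}

/-- The push-through condition for tensors with different left and right bond spaces. -/
def PushesRect (T : MulAut G) (U : G → Matrix.unitaryGroup ι ℂ) (v : G → Matrix.unitaryGroup κ ℂ)
    (w : G → Matrix.unitaryGroup κ' ℂ) (φ : G → Circle) (M : ι → Matrix κ κ' ℂ) : Prop :=
  ∀ g s, ∑ s', (U g).1 s s' • M s' = (φ g : ℂ) • ((v g).1ᴴ * M s * (w (T g)).1)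

variable {U : G → Matrix.unitaryGroup ι ℂ} {U' : G → Matrix.unitaryGroup ι' ℂ}
  {v : G → Matrix.unitaryGroup κ ℂ} {w : G → Matrix.unitaryGroup κ' ℂ} {φ : G → Circle}

lemma pushesRect_zero : PushesRect T U v w φ (0 : ι → Matrix κ κ' ℂ) := fun g s => by simp

lemma PushesRect.smul {M : ι → Matrix κ κ' ℂ} (h : PushesRect T U v w φ M) (c : ℂ) :
    PushesRect T U v w φ (c • M) := fun g s => by
  simp only [Pi.smul_apply, Matrix.mul_smul, Matrix.smul_mul]
  rw [smul_comm _ c, ← h g s, Finset.smul_sum]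
  exact Finset.sum_congr rfl fun s' _ => smul_comm _ _ _

/-- Block diagonal unitary matrices. -/
def blockUnitary : Matrix.unitaryGroup ι ℂ × Matrix.unitaryGroup ι' ℂ →*
    Matrix.unitaryGroup (ι ⊕ ι') ℂ where
  toFun p := ⟨Matrix.fromBlocks p.1.1 0 0 p.2.1, by
    rw [Matrix.mem_unitaryGroup_iff, Matrix.star_eq_conjTranspose, Matrix.fromBlocks_conjTranspose,
      Matrix.fromBlocks_multiply]
    simp [unitary_mul_conjTranspose, Matrix.fromBlocks_one]⟩
  map_one' := unitary_ext (by simp [Matrix.fromBlocks_one])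
  map_mul' p q := unitary_ext (by simp [Matrix.fromBlocks_multiply])

lemma blockUnitary_val (p : Matrix.unitaryGroup ι ℂ × Matrix.unitaryGroup ι' ℂ) :
    (blockUnitary p).1 = Matrix.fromBlocks p.1.1 0 0 p.2.1 := rfl

lemma PushesRect.sumElim {M : ι → Matrix κ κ' ℂ} {M' : ι' → Matrix κ κ' ℂ}
    (h : PushesRect T U v w φ M) (h' : PushesRect T U' v w φ M') :
    PushesRect T (fun g => blockUnitary (U g, U' g)) v w φ (Sum.elim M M') := by
  rintro g (s | s)
  · simpa [blockUnitary_val] using h g s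
  · simpa [blockUnitary_val] using h' g s

lemma sum_fromBlocks {α : Type*} (t : Finset α) (a : α → Matrix κ κ ℂ) (b : α → Matrix κ κ' ℂ)
    (c : α → Matrix κ' κ ℂ) (d : α → Matrix κ' κ' ℂ) :
    ∑ x ∈ t, Matrix.fromBlocks (a x) (b x) (c x) (d x) =
      Matrix.fromBlocks (∑ x ∈ t, a x) (∑ x ∈ t, b x) (∑ x ∈ t, c x) (∑ x ∈ t, d x) := by
  ext (i | i) (j | j) <;> simp [Matrix.sum_apply]

lemma pushesTo_fromBlocks {a : ι → Matrix κ κ ℂ} {b : ι → Matrix κ κ' ℂ} {c : ι → Matrix κ' κ ℂ}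
    {d : ι → Matrix κ' κ' ℂ} (ha : PushesRect T U v v φ a) (hb : PushesRect T U v w φ b)
    (hc : PushesRect T U w v φ c) (hd : PushesRect T U w w φ d) :
    PushesTo T U (fun g => blockUnitary (v g, w g)) φ
      (fun s => Matrix.fromBlocks (a s) (b s) (c s) (d s)) := by
  intro g s
  simp only [physMap, Matrix.fromBlocks_smul, sum_fromBlocks, ha g s, hb g s, hc g s, hd g s,
    blockUnitary_val, Matrix.fromBlocks_conjTranspose, Matrix.fromBlocks_multiply,
    Matrix.conjTranspose_zero, Matrix.zero_mul, Matrix.mul_zero, add_zero, zero_add]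

/-! ### Matrix units as local tensors -/

/-- The matrix units. -/
def unitTensor (κ κ' : Type*) [DecidableEq κ] [DecidableEq κ'] : κ × κ' → Matrix κ κ' ℂ :=
  fun p => Matrix.single p.1 p.2 1

/-- The unitary `c • (v̄ ⊗ w)`. -/
def bondUnitary (c : Circle) (v : Matrix.unitaryGroup κ ℂ) (w : Matrix.unitaryGroup κ' ℂ) :
    Matrix.unitaryGroup (κ × κ') ℂ :=
  ⟨(c : ℂ) • Matrix.kroneckerMap (· * ·) (v.1.map star) w.1, by
    rw [Matrix.mem_unitaryGroup_iff, Matrix.star_eq_conjTranspose, Matrix.conjTranspose_smul,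
      Matrix.smul_mul, Matrix.mul_smul, smul_smul, Matrix.conjTranspose_kronecker,
      ← Matrix.mul_kronecker_mul, unitary_mul_conjTranspose, mul_comm, star_circle_mul_self,
      one_smul]
    have h1 := unitary_mul_conjTranspose (Matrix.UnitaryGroup.map_star v)
    simp only [Matrix.UnitaryGroup.map_star] at h1
    rw [h1, Matrix.one_kronecker_one]⟩

lemma bondUnitary_val (c : Circle) (v : Matrix.unitaryGroup κ ℂ) (w : Matrix.unitaryGroup κ' ℂ) :
    (bondUnitary c v w).1 = (c : ℂ) • Matrix.kroneckerMap (· * ·) (v.1.map star) w.1 := rfl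

/-- The representation on the physical space of the matrix units, for projective bond
representations `v` and `w` with the same cocycle. -/
def bondRep {ω : G → G → Circle} (hφ : Compat T ω φ)
    (hv : ∀ g h, (v g).1 * (v h).1 = (ω g h : ℂ) • (v (g * h)).1)
    (hw : ∀ g h, (w g).1 * (w h).1 = (ω g h : ℂ) • (w (g * h)).1) :
    G →* Matrix.unitaryGroup (κ × κ') ℂ :=
  MonoidHom.mk' (fun g => bondUnitary (φ g) (v g) (w (T g))) fun g h => unitary_ext <| by
  have h1 : (v g).1.map star * (v h).1.map star =
      star (ω g h : ℂ) • (v (g * h)).1.map star := by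
    have := congrArg (fun M => Matrix.map M (starRingEnd ℂ)) (hv g h)
    simp only [Matrix.map_mul] at this
    refine this.trans ?_
    ext i j
    simp
  have h2 := congrArg (Subtype.val : Circle → ℂ) (hφ g h)
  simp only [Circle.coe_mul] at h2
  rw [Submonoid.coe_mul]
  simp only [bondUnitary_val]
  rw [Matrix.smul_mul, Matrix.mul_smul, ← Matrix.mul_kronecker_mul, h1, hw, Matrix.smul_kronecker,
    Matrix.kronecker_smul, smul_smul, smul_smul, smul_smul, ← map_mul T]
  congr 1
  linear_combination (-(φ (g * h) : ℂ)) * star_circle_mul_self (ω g h) + star (ω g h : ℂ) * h2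

/-- Matrix units span all bond matrices, so any bond transformation is a transformation of their
physical index, and `bondRep` is that transformation. -/
lemma pushesRect_unitTensor {ω : G → G → Circle} (hφ : Compat T ω φ)
    (hv : ∀ g h, (v g).1 * (v h).1 = (ω g h : ℂ) • (v (g * h)).1)
    (hw : ∀ g h, (w g).1 * (w h).1 = (ω g h : ℂ) • (w (g * h)).1) :
    PushesRect T (bondRep hφ hv hw) v w φ (unitTensor κ κ') := by
  rintro g ⟨a, b⟩
  change ∑ s', (bondUnitary (φ g) (v g) (w (T g))).1 (a, b) s' • unitTensor κ κ' s' = _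
  ext i j
  rw [bondUnitary_val, Matrix.sum_apply, Fintype.sum_eq_single (i, j)]
  · simp [unitTensor, Matrix.mul_apply, Matrix.single_apply, ite_and]
  · rintro ⟨i', j'⟩ hne
    rw [unitTensor, Matrix.smul_apply, Matrix.single_apply, if_neg, smul_zero]
    rintro ⟨rfl, rfl⟩
    exact hne rfl

end Blocks

/-! ### Interpolation between two tensors -/

section Interpolation

open Filter Topology

variable {ι₀ ι₁ κ₀ κ₁ : Type*} [Fintype ι₀] [Fintype ι₁] [Fintype κ₀] [Fintype κ₁]
  [DecidableEq ι₀] [DecidableEq ι₁] [DecidableEq κ₀] [DecidableEq κ₁]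

lemma sum_unitTensor_conj (W : Matrix κ₁ κ₁ ℂ) :
    ∑ p, unitTensor κ₀ κ₁ p * W * (unitTensor κ₀ κ₁ p)ᴴ = W.trace • 1 := by
  ext i j
  simp only [unitTensor, Matrix.conjTranspose_single, Matrix.single_mul_mul_single, star_one,
    Fintype.sum_prod_type, Matrix.sum_apply, Matrix.single_apply, one_mul, mul_one, ite_and]
  simp [Matrix.one_apply, Matrix.trace]

lemma sum_unitTensor_star_mul :
    ∑ p, (unitTensor κ₀ κ₁ p)ᴴ * unitTensor κ₀ κ₁ p = (Fintype.card κ₀ : ℂ) • 1 := by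
  ext i j
  simp only [unitTensor, Matrix.conjTranspose_single, Matrix.single_mul_single_same, star_one,
    Fintype.sum_prod_type, Matrix.sum_apply, Matrix.single_apply, mul_one, ite_and]
  by_cases h : i = j <;> simp [h]

/-- The tensors `p A₀` and `r A₁` on two diagonal blocks, and matrix units with weights `q` and
`s` on the off-diagonal blocks. -/
def interpolation (A₀ : ι₀ → Matrix κ₀ κ₀ ℂ) (A₁ : ι₁ → Matrix κ₁ κ₁ ℂ) (p q r s : ℝ) :
    (ι₀ ⊕ κ₀ × κ₁) ⊕ (ι₁ ⊕ κ₁ × κ₀) → Matrix (κ₀ ⊕ κ₁) (κ₀ ⊕ κ₁) ℂ := fun x =>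
  Matrix.fromBlocks (Sum.elim (Sum.elim ((p : ℂ) • A₀) 0) 0 x)
    (Sum.elim (Sum.elim 0 ((q : ℂ) • unitTensor κ₀ κ₁)) 0 x)
    (Sum.elim 0 (Sum.elim 0 ((s : ℂ) • unitTensor κ₁ κ₀)) x)
    (Sum.elim 0 (Sum.elim ((r : ℂ) • A₁) 0) x)

variable {A₀ : ι₀ → Matrix κ₀ κ₀ ℂ} {A₁ : ι₁ → Matrix κ₁ κ₁ ℂ} {p q r s : ℝ}

lemma interpolation_left (h₀ : ∑ s, (A₀ s)ᴴ * A₀ s = 1) (h₁ : ∑ s, (A₁ s)ᴴ * A₁ s = 1)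
    (hps : p ^ 2 + s ^ 2 * Fintype.card κ₁ = 1) (hqr : r ^ 2 + q ^ 2 * Fintype.card κ₀ = 1) :
    ∑ x, (interpolation A₀ A₁ p q r s x)ᴴ * interpolation A₀ A₁ p q r s x = 1 := by
  have hps' : (p : ℂ) * p + s * s * Fintype.card κ₁ = 1 := by
    rw [← pow_two, ← pow_two]; exact_mod_cast hps
  have hqr' : (q : ℂ) * q * Fintype.card κ₀ + r * r = 1 := by
    rw [← pow_two, ← pow_two, add_comm]; exact_mod_cast hqr
  simp only [interpolation, Matrix.fromBlocks_conjTranspose, Matrix.fromBlocks_multiply,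
    sum_fromBlocks, Fintype.sum_sum_type, Sum.elim_inl, Sum.elim_inr, Pi.zero_apply, Pi.smul_apply,
    Matrix.conjTranspose_zero, Matrix.zero_mul, Matrix.mul_zero, add_zero, zero_add,
    Matrix.conjTranspose_smul, Matrix.smul_mul, Matrix.mul_smul, smul_smul, ← Finset.smul_sum, h₀,
    h₁, sum_unitTensor_star_mul, Finset.sum_const_zero, Complex.star_def, Complex.conj_ofReal,
    ← add_smul, hps', hqr', one_smul, smul_zero, Matrix.fromBlocks_one]

/-- Each block receives from the other only a multiple of the identity. The fixed-point equation
therefore decouples into two resolvent equations with source `1`. -/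
lemma transferMap_interpolation (X : Matrix κ₀ κ₀ ℂ) (W : Matrix κ₁ κ₁ ℂ) :
    transferMap (interpolation A₀ A₁ p q r s) (Matrix.fromBlocks X 0 0 W) =
      Matrix.fromBlocks (((p ^ 2 : ℝ) : ℂ) • transferMap A₀ X + (((q ^ 2 : ℝ) : ℂ) * W.trace) • 1) 0 0
        (((r ^ 2 : ℝ) : ℂ) • transferMap A₁ W + (((s ^ 2 : ℝ) : ℂ) * X.trace) • 1) := by
  simp only [transferMap_apply, interpolation, Matrix.fromBlocks_conjTranspose,
    Matrix.fromBlocks_multiply,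
    sum_fromBlocks, Fintype.sum_sum_type, Sum.elim_inl, Sum.elim_inr, Pi.zero_apply, Pi.smul_apply,
    Matrix.conjTranspose_zero, Matrix.zero_mul, Matrix.mul_zero, add_zero, zero_add,
    Matrix.conjTranspose_smul, Matrix.smul_mul, Matrix.mul_smul, smul_smul, ← Finset.smul_sum,
    sum_unitTensor_conj, Finset.sum_const_zero, Complex.star_def, Complex.conj_ofReal,
    Complex.ofReal_mul, pow_two]

lemma eq_smul_one_of_unitTensor {P : Matrix κ₀ κ₀ ℂ} {S : Matrix κ₁ κ₁ ℂ} {ν : ℂ}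
    (h : ∀ x, ν • (unitTensor κ₀ κ₁ x * S) = P * unitTensor κ₀ κ₁ x) (b : κ₁) :
    P = (ν * S b b) • 1 := by
  ext i a
  have h1 := congrFun (congrFun (h (a, b)) i) b
  simp only [unitTensor, Matrix.mul_apply, Matrix.single_apply, Matrix.smul_apply, ite_and,
    smul_eq_mul, ite_mul, one_mul, zero_mul, mul_ite, mul_one, mul_zero, Finset.sum_ite_eq,
    Finset.mem_univ, if_true] at h1
  rw [Matrix.smul_apply, Matrix.one_apply, smul_eq_mul, mul_ite, mul_one, mul_zero]
  by_cases hia : i = a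
  · subst hia
    simpa using h1.symm
  · rw [if_neg hia]
    simpa [Ne.symm hia, hia] using h1.symm

lemma eq_zero_of_mul_unitTensor [Nonempty κ₁] {R : Matrix κ₁ κ₀ ℂ}
    (h : ∀ x, R * unitTensor κ₀ κ₁ x = 0) : R = 0 := by
  obtain ⟨b⟩ := ‹Nonempty κ₁›
  ext i a
  have h1 := congrFun (congrFun (h (a, b)) i) b
  simpa [unitTensor] using h1

/-- The off-diagonal matrix units annihilate the off-diagonal blocks of an intertwiner and make its
diagonal blocks scalar, related by `ν`. A nonzero matrix of `A₀` then forces the two scalars to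
agree. -/
lemma interpolation_rigid [Nonempty κ₀] [Nonempty κ₁] (h₀ : ∑ s, (A₀ s)ᴴ * A₀ s = 1) (hp : p ≠ 0)
    (hq : q ≠ 0) (hs : s ≠ 0) {ν : ℂ} {X : Matrix (κ₀ ⊕ κ₁) (κ₀ ⊕ κ₁) ℂ}
    (h : ∀ x, ν • (interpolation A₀ A₁ p q r s x * X) = X * interpolation A₀ A₁ p q r s x) :
    ∃ c : ℂ, X = c • 1 := by
  obtain ⟨P, Q, R, S, rfl⟩ : ∃ P Q R S, X = Matrix.fromBlocks P Q R S :=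
    ⟨_, _, _, _, (Matrix.fromBlocks_toBlocks X).symm⟩
  have hp' : (p : ℂ) ≠ 0 := Complex.ofReal_ne_zero.2 hp
  have hq' : (q : ℂ) ≠ 0 := Complex.ofReal_ne_zero.2 hq
  have hs' : (s : ℂ) ≠ 0 := Complex.ofReal_ne_zero.2 hs
  have hA (x : ι₀) := h (.inl (.inl x))
  have hE (x : κ₀ × κ₁) := h (.inl (.inr x))
  have hF (x : κ₁ × κ₀) := h (.inr (.inr x))
  simp only [interpolation, Sum.elim_inl, Sum.elim_inr, Pi.zero_apply, Pi.smul_apply,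
    Matrix.fromBlocks_multiply, Matrix.fromBlocks_smul, Matrix.zero_mul, Matrix.mul_zero, add_zero,
    zero_add, smul_zero, Matrix.fromBlocks_inj, Matrix.smul_mul, Matrix.mul_smul, smul_comm ν,
    smul_right_inj hp', smul_right_inj hq', smul_right_inj hs', eq_comm (a := (0 : Matrix _ _ ℂ)),
    smul_eq_zero, hp', hq', hs', false_or] at hA hE hF
  obtain ⟨a⟩ := ‹Nonempty κ₀›
  obtain ⟨b⟩ := ‹Nonempty κ₁›
  have hR : R = 0 := eq_zero_of_mul_unitTensor fun x => (hE x).2.2.2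
  have hQ : Q = 0 := eq_zero_of_mul_unitTensor fun x => (hF x).1
  have hP := eq_smul_one_of_unitTensor (fun x => (hE x).2.1) b
  have hS := eq_smul_one_of_unitTensor (fun x => (hF x).2.2.1) a
  have hx : P a a = ν * S b b := by
    conv_lhs => rw [hP]
    simp
  rw [← hx] at hP
  obtain ⟨x, hAx⟩ : ∃ x, A₀ x ≠ 0 := by
    by_contra! h0
    have h1 := congrFun (congrFun h₀ a) a
    simp [h0] at h1
  have h1 : (ν * P a a) • A₀ x = P a a • A₀ x := by
    have h2 := (hA x).1
    rw [hP] at h2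
    simpa [smul_smul] using h2
  refine ⟨P a a, ?_⟩
  rw [hR, hQ, hS, smul_left_injective ℂ hAx h1, ← Matrix.fromBlocks_one, Matrix.fromBlocks_smul,
    smul_zero, smul_zero, ← hP]

lemma posDef_fromBlocks_diagonal {X : Matrix κ₀ κ₀ ℂ} {W : Matrix κ₁ κ₁ ℂ} (hX : X.PosDef)
    (hW : W.PosDef) : (Matrix.fromBlocks X 0 0 W).PosDef := by
  have := hX.isUnit.invertible
  have h : (Matrix.fromBlocks X 0 0ᴴ W).PosSemidef := by
    rw [Matrix.PosDef.fromBlocks₁₁ _ _ hX]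
    simpa using hW.posSemidef
  rw [Matrix.conjTranspose_zero] at h
  exact h.posDef_iff_isUnit.2 (Matrix.isUnit_fromBlocks_zero₂₁.2 ⟨hX.isUnit, hW.isUnit⟩)

lemma trace_fromBlocks (P : Matrix κ₀ κ₀ ℂ) (Q : Matrix κ₀ κ₁ ℂ) (R : Matrix κ₁ κ₀ ℂ)
    (S : Matrix κ₁ κ₁ ℂ) : (Matrix.fromBlocks P Q R S).trace = P.trace + S.trace := by
  simp [Matrix.trace]

/-- Interpolations of primitive tensors are primitive. -/
lemma primitive_interpolation {ρ₀ : Matrix κ₀ κ₀ ℂ} {ρ₁ : Matrix κ₁ κ₁ ℂ} (h₀ : Primitive A₀ ρ₀)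
    (h₁ : Primitive A₁ ρ₁) {t : ℝ} (ht₀ : 0 < t) (ht₁ : t < 1) :
    ∃ ρ, Primitive (interpolation A₀ A₁ √(1 - t) √((1 - t) / Fintype.card κ₀) √t
      √(t / Fintype.card κ₁)) ρ := by
  have hne₀ := h₀.nonempty
  have hne₁ := h₁.nonempty
  have hc₀ : (0 : ℝ) < Fintype.card κ₀ := by exact_mod_cast Fintype.card_pos
  have hc₁ : (0 : ℝ) < Fintype.card κ₁ := by exact_mod_cast Fintype.card_pos
  have hu : 0 < 1 - t := by linarith
  obtain ⟨X, hX, hXe, hXt⟩ := h₀.exists_resolvent hu.le (by linarith)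
  obtain ⟨W, hW, hWe, hWt⟩ := h₁.exists_resolvent ht₀.le ht₁
  have hq := Real.sq_sqrt (div_nonneg hu.le hc₀.le)
  have hs := Real.sq_sqrt (div_nonneg ht₀.le hc₁.le)
  have hp := Real.sq_sqrt hu.le
  have hr := Real.sq_sqrt ht₀.le
  have hc₀' : (Fintype.card κ₀ : ℂ) ≠ 0 := by exact_mod_cast hc₀.ne'
  have hc₁' : (Fintype.card κ₁ : ℂ) ≠ 0 := by exact_mod_cast hc₁.ne'
  have hXt' : (t : ℂ) * X.trace = Fintype.card κ₀ := by
    rw [← hXt]; push_cast; ring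
  have hWt' : (1 - t : ℂ) * W.trace = Fintype.card κ₁ := hWt
  have hw₀ : ((t * (1 - t) / Fintype.card κ₀ : ℝ) : ℂ) * X.trace = 1 - t := by
    push_cast
    field_simp
    linear_combination (1 - t : ℂ) * hXt'
  have hw₁ : ((t * (1 - t) / Fintype.card κ₁ : ℝ) : ℂ) * W.trace = t := by
    push_cast
    field_simp
    linear_combination hWt'
  -- The blocks of the fixed point are the resolvents at `1 - t` and `t`, scaled so that their
  -- traces are `1 - t` and `t`.
  refine ⟨Matrix.fromBlocks (((t * (1 - t) / Fintype.card κ₀ : ℝ) : ℂ) • X) 0 0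
    (((t * (1 - t) / Fintype.card κ₁ : ℝ) : ℂ) • W), primitive_of_rigid
    (interpolation_left h₀.left h₁.left ?_ ?_) (posDef_fromBlocks_diagonal (hX.smul ?_)
      (hW.smul ?_)) ?_ ?_ fun ν Z hZ => interpolation_rigid h₀.left (Real.sqrt_ne_zero'.2 hu)
        (Real.sqrt_ne_zero'.2 (div_pos hu hc₀)) (Real.sqrt_ne_zero'.2 (div_pos ht₀ hc₁)) hZ⟩
  · rw [hp, hs]
    field_simp
    ring
  · rw [hr, hq]
    field_simp
    ring
  · exact_mod_cast div_pos (mul_pos ht₀ hu) hc₀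
  · exact_mod_cast div_pos (mul_pos ht₀ hu) hc₁
  · rw [trace_fromBlocks, Matrix.trace_smul, Matrix.trace_smul, smul_eq_mul, smul_eq_mul,
      hw₀, hw₁]
    ring
  · rw [transferMap_interpolation, Matrix.trace_smul, Matrix.trace_smul, smul_eq_mul, smul_eq_mul,
      hw₀, hw₁, hp, hq, hr, hs]
    congr 1
    · conv_rhs => rw [hXe]
      rw [map_smul, smul_add, smul_comm, add_comm]
      congr 2
      push_cast
      ring
    · conv_rhs => rw [hWe]
      rw [map_smul, smul_add, smul_comm, add_comm]
      congr 2
      push_cast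
      ring

/-- This identifies the states at an end of the interpolation, where one row of blocks vanishes. The
empty word is excluded because its trace would count both blocks. -/
lemma word_upper (P : ι₀ → Matrix κ₀ κ₀ ℂ) (Q : ι₀ → Matrix κ₀ κ₁ ℂ) {n : ℕ} (hn : 1 ≤ n)
    (s : Fin n → ι₀) : (word (fun _ s => Matrix.fromBlocks (P s) (Q s) 0 0) s).trace =
      (word (fun _ => P) s).trace := by
  suffices h : ∃ Z, word (fun _ s => Matrix.fromBlocks (P s) (Q s) 0 0) s =
      Matrix.fromBlocks (word (fun _ => P) s) Z 0 0 by
    obtain ⟨Z, hZ⟩ := h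
    simp [hZ, trace_fromBlocks]
  induction n, hn using Nat.le_induction with
  | base => exact ⟨Q (s 0), by simp [word]⟩
  | succ n hn ih =>
    obtain ⟨Z, hZ⟩ := ih fun i => s i.castSucc
    rw [word_succ, hZ, word_succ, Matrix.fromBlocks_multiply]
    simp

lemma word_lower (P : ι₀ → Matrix κ₁ κ₁ ℂ) (Q : ι₀ → Matrix κ₁ κ₀ ℂ) {n : ℕ} (hn : 1 ≤ n)
    (s : Fin n → ι₀) : (word (fun _ s => Matrix.fromBlocks 0 0 (Q s) (P s)) s).trace =
      (word (fun _ => P) s).trace := by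
  suffices h : ∃ Z, word (fun _ s => Matrix.fromBlocks 0 0 (Q s) (P s)) s =
      Matrix.fromBlocks 0 0 Z (word (fun _ => P) s) by
    obtain ⟨Z, hZ⟩ := h
    simp [hZ, trace_fromBlocks]
  induction n, hn using Nat.le_induction with
  | base => exact ⟨Q (s 0), by simp [word]⟩
  | succ n hn ih =>
    obtain ⟨Z, hZ⟩ := ih fun i => s i.castSucc
    rw [word_succ, hZ, word_succ, Matrix.fromBlocks_multiply]
    simp

lemma continuous_interpolation {p q r s : ℝ → ℝ} (hp : Continuous p) (hq : Continuous q)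
    (hr : Continuous r) (hs : Continuous s) :
    Continuous fun t => interpolation A₀ A₁ (p t) (q t) (r t) (s t) := by
  refine continuous_pi fun x => Continuous.matrix_fromBlocks ?_ ?_ ?_ ?_ <;>
    rcases x with (x | x) | (x | x) <;>
    simp only [Sum.elim_inl, Sum.elim_inr, Pi.zero_apply, Pi.smul_apply] <;> fun_prop

end Interpolation

/-! ### Tensors with equal push-through data are in the same phase -/

section Connect

variable {G : Type} [Group G] {T : MulAut G} {L : ℕ}

/-- Equal `ω` and `φ` are what allow one physical representation to act consistently on all four
blocks of the interpolation. -/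
theorem deformation_of_push {S₀ S₁ : SymMPS T L} (hT : T ^ L = 1)
    {v₀ : G → Matrix.unitaryGroup (Fin S₀.χ) ℂ} {v₁ : G → Matrix.unitaryGroup (Fin S₁.χ) ℂ}
    {φ : G → Circle} {ω : G → G → Circle} (hφ : Compat T ω φ) (h₀ : PushesTo T S₀.U v₀ φ S₀.A)
    (h₁ : PushesTo T S₁.U v₁ φ S₁.A)
    (hv₀ : ∀ g h, (v₀ g).1 * (v₀ h).1 = (ω g h : ℂ) • (v₀ (g * h)).1)
    (hv₁ : ∀ g h, (v₁ g).1 * (v₁ h).1 = (ω g h : ℂ) • (v₁ (g * h)).1) : Deformation S₀ S₁ := by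
  obtain ⟨ρ₀, hρ₀⟩ := S₀.injective.exists_primitive
  obtain ⟨ρ₁, hρ₁⟩ := S₁.injective.exists_primitive
  let R : G →* Matrix.unitaryGroup
      ((Fin S₀.d ⊕ Fin S₀.χ × Fin S₁.χ) ⊕ (Fin S₁.d ⊕ Fin S₁.χ × Fin S₀.χ)) ℂ :=
    blockUnitary.comp ((blockUnitary.comp (S₀.U.prod (bondRep hφ hv₀ hv₁))).prod
      (blockUnitary.comp (S₁.U.prod (bondRep hφ hv₁ hv₀))))
  have hR (g : G) : (R g).1 = Matrix.fromBlocks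
      (Matrix.fromBlocks (S₀.U g).1 0 0 (bondRep hφ hv₀ hv₁ g).1) 0 0
      (Matrix.fromBlocks (S₁.U g).1 0 0 (bondRep hφ hv₁ hv₀ g).1) := rfl
  refine deformation_of_path hT R (Matrix.fromRows (Matrix.fromRows 1 0) 0)
    (Matrix.fromRows 0 (Matrix.fromRows 1 0))
    (fun t => interpolation S₀.A S₁.A √(1 - t) √((1 - t) / Fintype.card (Fin S₀.χ)) √t
      √(t / Fintype.card (Fin S₁.χ))) ?_ ?_ (fun g => ?_) (fun g => ?_) ?_
      (fun t ht => primitive_interpolation hρ₀ hρ₁ ht.1 ht.2) (fun t _ => ?_)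
      (fun n hn s => ?_) (fun n hn s => ?_)
  · simp [Matrix.conjTranspose_fromRows_eq_fromCols_conjTranspose, Matrix.fromCols_mul_fromRows]
  · simp [Matrix.conjTranspose_fromRows_eq_fromCols_conjTranspose, Matrix.fromCols_mul_fromRows]
  · simp [hR, Matrix.fromBlocks_mul_fromRows, Matrix.fromRows_mul]
  · simp [hR, Matrix.fromBlocks_mul_fromRows, Matrix.fromRows_mul]
  · exact continuous_interpolation (by fun_prop) (by fun_prop) (by fun_prop) (by fun_prop)
  · exact ⟨fun g => blockUnitary (v₀ g, v₁ g), φ, pushesTo_fromBlocks (U := R)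
      (((PushesRect.smul h₀ _).sumElim pushesRect_zero).sumElim pushesRect_zero)
      ((pushesRect_zero.sumElim ((pushesRect_unitTensor hφ hv₀ hv₁).smul _)).sumElim
        pushesRect_zero)
      (pushesRect_zero.sumElim (pushesRect_zero.sumElim
        ((pushesRect_unitTensor hφ hv₁ hv₀).smul _)))
      (pushesRect_zero.sumElim ((PushesRect.smul h₁ _).sumElim pushesRect_zero))⟩
  -- At `t = 0` the weights `r` and `s` vanish, but `q = √(1 / χ₀)` does not; the remaining upper
  -- block does not affect traces.
  · rw [← word_upper _ (Sum.elim (Sum.elim 0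
      ((√(1 / Fintype.card (Fin S₀.χ)) : ℂ) • unitTensor (Fin S₀.χ) (Fin S₁.χ))) 0) hn s]
    congr 2
    funext _ x
    rcases x with (x | x) | (x | x) <;>
      simp [interpolation, physMap, Matrix.one_apply]
  · rw [← word_lower _ (Sum.elim 0 (Sum.elim 0
      ((√(1 / Fintype.card (Fin S₁.χ)) : ℂ) • unitTensor (Fin S₁.χ) (Fin S₀.χ)))) hn s]
    congr 2
    funext _ x
    rcases x with (x | x) | (x | x) <;>
      simp [interpolation, physMap, Matrix.one_apply]

end Connect

/-! ### Rescaling of bond unitaries -/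

section Rescale

variable {ι ι' κ κ' : Type*} [Fintype ι] [Fintype ι'] [Fintype κ] [Fintype κ'] [DecidableEq ι]
  [DecidableEq ι'] [DecidableEq κ] [DecidableEq κ']

variable {G : Type} [Group G] {T : MulAut G} {L : ℕ}

/-- Multiplication of a unitary matrix by a phase. -/
def phaseMul (c : Circle) (v : Matrix.unitaryGroup κ ℂ) : Matrix.unitaryGroup κ ℂ :=
  ⟨(c : ℂ) • v.1, by
    rw [Matrix.mem_unitaryGroup_iff, Matrix.star_eq_conjTranspose, Matrix.conjTranspose_smul,
      Matrix.smul_mul, Matrix.mul_smul, smul_smul, unitary_mul_conjTranspose, mul_comm,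
      star_circle_mul_self, one_smul]⟩

lemma phaseMul_val (c : Circle) (v : Matrix.unitaryGroup κ ℂ) :
    (phaseMul c v).1 = (c : ℂ) • v.1 := rfl

/-- The tensor-level counterpart of `Encodes.twist`. -/
lemma PushesTo.rescale {U : G → Matrix.unitaryGroup ι ℂ} {v : G → Matrix.unitaryGroup κ ℂ}
    {φ : G → Circle} {A : ι → Matrix κ κ ℂ} (h : PushesTo T U v φ A) (z : G → Circle) :
    PushesTo T U (fun g => phaseMul (z g) (v g)) (fun g => φ g * (z g / z (T g))) A := by
  intro g s
  rw [h]
  simp only [phaseMul_val, Matrix.conjTranspose_smul, Matrix.smul_mul, Matrix.mul_smul, smul_smul]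
  congr 1
  have h1 := star_circle_mul_self (z g)
  rw [Circle.coe_mul, Circle.coe_div]
  have h2 := Circle.coe_ne_zero (z (T g))
  field_simp
  linear_combination (-1 : ℂ) * h1

lemma HasClass.reindex {U : G → Matrix.unitaryGroup ι ℂ} {A : ι → Matrix κ κ ℂ}
    {x : groupCohomology.H2 (U1 (FullGroup T))} (h : HasClass T U A x) (e : ι' ≃ ι) (f : κ' ≃ κ) :
    HasClass T (fun g => reindexUnitary e (U g)) (reindexTensor e f A) x := by
  obtain ⟨v, φ, ω, h1, h2, h3⟩ := h
  refine ⟨_, φ, ω, h1.reindex e f, fun a b => ?_, h3⟩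
  have h4 := congrArg (fun M => Matrix.submatrix M f f) (h2 a b)
  simp only [Matrix.submatrix_smul, Pi.smul_apply] at h4
  rw [← Matrix.submatrix_mul_equiv _ _ f f f] at h4
  exact h4

/-- The crystalline class is a complete invariant. -/
lemma HasClass.phase_eq {S₀ S₁ : SymMPS T L} (hT : T ^ L = 1)
    {x : groupCohomology.H2 (U1 (FullGroup T))} (h₀ : HasClass T S₀.U S₀.A x)
    (h₁ : HasClass T S₁.U S₁.A x) : S₀.phase = S₁.phase := by
  obtain ⟨v₀, φ₀, ω₀, hp₀, hv₀, he₀⟩ := h₀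
  obtain ⟨v₁, φ₁, ω₁, hp₁, hv₁, he₁⟩ := h₁
  -- Rescaling the bond unitaries of `S₁` by `z` makes both its phases and its cocycle equal to
  -- those of `S₀`.
  obtain ⟨z, hz, hz'⟩ := (he₀.eq_iff he₁).1 rfl
  have hφ : (fun g => φ₁ g * (z g / z (T g))) = φ₀ := funext fun g => by
    rw [← mul_div_assoc, mul_comm (φ₁ g), ← hz', mul_div_cancel_right]
  have hp := hp₁.rescale z
  rw [hφ] at hp
  refine Quot.sound (deformation_of_push hT he₀.compat hp₀ hp hv₀ fun a b => ?_)
  simp only [phaseMul_val, Matrix.smul_mul, Matrix.mul_smul, smul_smul, hv₁]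
  congr 1
  have := congrArg (Subtype.val : Circle → ℂ) (hz a b)
  simp only [Circle.coe_mul] at this
  rw [this]
  ring

end Rescale

/-! ### Stacking -/

section Stack

open Filter Topology

variable {ι ι' κ κ' : Type*} [Fintype ι] [Fintype ι'] [Fintype κ] [Fintype κ'] [DecidableEq ι]
  [DecidableEq ι'] [DecidableEq κ] [DecidableEq κ']

/-- The tensor product on physical and virtual legs. -/
def stackTensor (A : ι → Matrix κ κ ℂ) (B : ι' → Matrix κ' κ' ℂ) :
    ι × ι' → Matrix (κ × κ') (κ × κ') ℂ :=
  fun p => Matrix.kroneckerMap (· * ·) (A p.1) (B p.2)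

/-- The Kronecker product of unitary matrices. -/
def kroneckerUnitary : Matrix.unitaryGroup κ ℂ × Matrix.unitaryGroup κ' ℂ →*
    Matrix.unitaryGroup (κ × κ') ℂ where
  toFun p := ⟨Matrix.kroneckerMap (· * ·) p.1.1 p.2.1, Matrix.kronecker_mem_unitary p.1.2 p.2.2⟩
  map_one' := unitary_ext Matrix.one_kronecker_one
  map_mul' _ _ := unitary_ext (Matrix.mul_kronecker_mul _ _ _ _)

lemma sum_stackTensor (A : ι → Matrix κ κ ℂ) (B : ι' → Matrix κ' κ' ℂ) :
    ∑ p, stackTensor A B p = Matrix.kroneckerMap (· * ·) (∑ s, A s) (∑ s, B s) := by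
  ext i j
  simp only [stackTensor, Matrix.sum_apply, Matrix.kroneckerMap_apply, Fintype.sum_prod_type,
    Finset.sum_mul_sum]

lemma transferMap_stack (A : ι → Matrix κ κ ℂ) (B : ι' → Matrix κ' κ' ℂ) (X : Matrix κ κ ℂ)
    (Y : Matrix κ' κ' ℂ) : transferMap (stackTensor A B) (Matrix.kroneckerMap (· * ·) X Y) =
      Matrix.kroneckerMap (· * ·) (transferMap A X) (transferMap B Y) := by
  rw [transferMap_apply, transferMap_apply, transferMap_apply, ← sum_stackTensor]
  simp only [stackTensor, Matrix.conjTranspose_kronecker, ← Matrix.mul_kronecker_mul]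

/-- The transfer map of the stack factorizes, so convergence holds on Kronecker products, and these
span. -/
lemma Primitive.stack {A : ι → Matrix κ κ ℂ} {B : ι' → Matrix κ' κ' ℂ} {ρ : Matrix κ κ ℂ}
    {σ : Matrix κ' κ' ℂ} (hA : Primitive A ρ) (hB : Primitive B σ) :
    Primitive (stackTensor A B) (Matrix.kroneckerMap (· * ·) ρ σ) where
  left := by
    have h := sum_stackTensor (fun s => (A s)ᴴ * A s) (fun s => (B s)ᴴ * B s)
    rw [hA.left, hB.left, Matrix.one_kronecker_one] at h
    rw [← h]
    simp only [stackTensor, Matrix.conjTranspose_kronecker, ← Matrix.mul_kronecker_mul]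
  posDef := hA.posDef.kronecker hB.posDef
  trace_eq := by rw [Matrix.trace_kronecker, hA.trace_eq, hB.trace_eq, one_mul]
  tendsto Z := by
    have hpow (X : Matrix κ κ ℂ) (Y : Matrix κ' κ' ℂ) (n : ℕ) :
        (transferMap (stackTensor A B) ^ n) (Matrix.kroneckerMap (· * ·) X Y) =
          Matrix.kroneckerMap (· * ·) ((transferMap A ^ n) X) ((transferMap B ^ n) Y) := by
      induction n with
      | zero => rfl
      | succ n ih => simp only [pow_succ', Module.End.mul_apply, ih, transferMap_stack]
    have hprod (X : Matrix κ κ ℂ) (Y : Matrix κ' κ' ℂ) :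
        Tendsto (fun n => (transferMap (stackTensor A B) ^ n) (Matrix.kroneckerMap (· * ·) X Y)) atTop
          (𝓝 ((Matrix.kroneckerMap (· * ·) X Y).trace • Matrix.kroneckerMap (· * ·) ρ σ)) := by
      simp only [hpow]
      refine tendsto_pi_nhds.2 fun i => tendsto_pi_nhds.2 fun j => ?_
      have h := (tendsto_entry (hA.tendsto X) i.1 j.1).mul (tendsto_entry (hB.tendsto Y) i.2 j.2)
      refine h.trans_eq ?_
      rw [Matrix.trace_kronecker]
      simp only [Matrix.smul_apply, Matrix.kroneckerMap_apply, smul_eq_mul]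
      congr 1
      ring
    have hZ : Z = ∑ i, ∑ j, Z i j • Matrix.kroneckerMap (· * ·) (Matrix.single i.1 j.1 1)
        (Matrix.single i.2 j.2 1) := by
      conv_lhs => rw [Matrix.matrix_eq_sum_single Z]
      refine Finset.sum_congr rfl fun i _ => Finset.sum_congr rfl fun j _ => ?_
      rw [Matrix.single_kronecker_single]
      simp
    rw [hZ]
    simp only [map_sum, map_smul, Matrix.trace_sum, Matrix.trace_smul, Finset.sum_smul, smul_assoc]
    exact tendsto_finsetSum _ fun i _ => tendsto_finsetSum _ fun j _ => (hprod _ _).const_smul _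

variable {G : Type} [Group G] {T : MulAut G} {L : ℕ}

lemma PushesTo.stack {U : G → Matrix.unitaryGroup ι ℂ} {U' : G → Matrix.unitaryGroup ι' ℂ}
    {v : G → Matrix.unitaryGroup κ ℂ} {v' : G → Matrix.unitaryGroup κ' ℂ} {φ φ' : G → Circle}
    {A : ι → Matrix κ κ ℂ} {B : ι' → Matrix κ' κ' ℂ} (hA : PushesTo T U v φ A)
    (hB : PushesTo T U' v' φ' B) : PushesTo T (fun g => kroneckerUnitary (U g, U' g))
      (fun g => kroneckerUnitary (v g, v' g)) (fun g => φ g * φ' g) (stackTensor A B) := by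
  rintro g ⟨s, s'⟩
  have h := sum_stackTensor (fun r => (U g).1 s r • A r) (fun r => (U' g).1 s' r • B r)
  have h1 : ∑ r, (U g).1 s r • A r = _ := hA g s
  have h2 : ∑ r, (U' g).1 s' r • B r = _ := hB g s'
  rw [h1, h2, Matrix.smul_kronecker, Matrix.kronecker_smul, smul_smul,
    Matrix.mul_kronecker_mul, Matrix.mul_kronecker_mul, ← Matrix.conjTranspose_kronecker] at h
  rw [Circle.coe_mul]
  refine Eq.trans ?_ h
  refine Finset.sum_congr rfl fun p _ => ?_
  change _ = Matrix.kroneckerMap (· * ·) ((U g).1 s p.1 • A p.1) ((U' g).1 s' p.2 • B p.2)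
  rw [Matrix.smul_kronecker, Matrix.kronecker_smul, smul_smul]
  rfl

lemma reindex_stackTensor {δ χ : Type*} [Fintype δ] [Fintype χ] [DecidableEq δ] [DecidableEq χ]
    (e : ι × ι' ≃ δ) (f : κ × κ' ≃ χ) (A : ι → Matrix κ κ ℂ) (B : ι' → Matrix κ' κ' ℂ)
    (a : ι) (b : ι') (i : κ) (k : κ') (j : κ) (l : κ') :
    reindexTensor e.symm f.symm (stackTensor A B) (e (a, b)) (f (i, k)) (f (j, l)) =
      A a i j * B b k l := by
  simp [reindexTensor, stackTensor]

lemma reindex_kroneckerUnitary {δ : Type*} [Fintype δ] [DecidableEq δ] (e : ι × ι' ≃ δ)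
    (U : Matrix.unitaryGroup ι ℂ) (U' : Matrix.unitaryGroup ι' ℂ) (a : ι) (b : ι') (a' : ι)
    (b' : ι') : (reindexUnitary e.symm (kroneckerUnitary (U, U'))).1 (e (a, b)) (e (a', b')) =
      U.1 a a' * U'.1 b b' := by
  simp [reindexUnitary, kroneckerUnitary]

lemma IsStack.tensor_eq {S₁ S₂ S : SymMPS T L} {e : Fin S₁.d × Fin S₂.d ≃ Fin S.d}
    {f : Fin S₁.χ × Fin S₂.χ ≃ Fin S.χ}
    (h : ∀ a b i k j l, S.A (e (a, b)) (f (i, k)) (f (j, l)) = S₁.A a i j * S₂.A b k l) :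
    reindexTensor e.symm f.symm (stackTensor S₁.A S₂.A) = S.A := by
  funext s
  ext i j
  obtain ⟨⟨a, b⟩, rfl⟩ := e.surjective s
  obtain ⟨⟨i, k⟩, rfl⟩ := f.surjective i
  obtain ⟨⟨j, l⟩, rfl⟩ := f.surjective j
  rw [h, reindex_stackTensor]

lemma IsStack.rep_eq {S₁ S₂ S : SymMPS T L} {e : Fin S₁.d × Fin S₂.d ≃ Fin S.d}
    (h : ∀ g a b a' b',
      (S.U g).1 (e (a, b)) (e (a', b')) = (S₁.U g).1 a a' * (S₂.U g).1 b b') (g : G) :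
    reindexUnitary e.symm (kroneckerUnitary (S₁.U g, S₂.U g)) = S.U g := by
  refine unitary_ext ?_
  ext i j
  obtain ⟨⟨a, b⟩, rfl⟩ := e.surjective i
  obtain ⟨⟨a', b'⟩, rfl⟩ := e.surjective j
  rw [h, reindex_kroneckerUnitary]

/-- Push-through data multiply under stacking. -/
lemma IsStack.exists_push {S₁ S₂ S : SymMPS T L} (h : IsStack S₁ S₂ S)
    (v₁ : G →* Matrix.unitaryGroup (Fin S₁.χ) ℂ) (v₂ : G →* Matrix.unitaryGroup (Fin S₂.χ) ℂ)
    {φ₁ φ₂ : G → Circle} (h₁ : S₁.PushThrough v₁ φ₁) (h₂ : S₂.PushThrough v₂ φ₂) :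
    ∃ v : G →* Matrix.unitaryGroup (Fin S.χ) ℂ, S.PushThrough v fun g => φ₁ g * φ₂ g := by
  obtain ⟨e, f, hA, hU⟩ := h
  have h3 := ((pushThrough_iff.1 h₁).stack (pushThrough_iff.1 h₂)).reindex e.symm f.symm
  rw [IsStack.tensor_eq hA, funext (IsStack.rep_eq hU)] at h3
  exact ⟨((reindexUnitary f.symm).comp kroneckerUnitary).comp (v₁.prod v₂), pushThrough_iff.2 h3⟩

theorem exists_isStack (hL : 1 ≤ L) (hT : T ^ L = 1) (S₁ S₂ : SymMPS T L) :
    ∃ S, IsStack S₁ S₂ S := by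
  obtain ⟨ρ₁, h₁⟩ := S₁.injective.exists_primitive
  obtain ⟨ρ₂, h₂⟩ := S₂.injective.exists_primitive
  obtain ⟨v₁, φ₁, hp₁⟩ := ModulatedMPS.exists_push h₁ hL hT S₁.symmetric
  obtain ⟨v₂, φ₂, hp₂⟩ := ModulatedMPS.exists_push h₂ hL hT S₂.symmetric
  refine ⟨SymMPS.ofTensor hT (kroneckerUnitary.comp (S₁.U.prod S₂.U)) (stackTensor S₁.A S₂.A)
    ⟨_, h₁.stack h₂⟩ ⟨_, _, hp₁.stack hp₂⟩ finProdFinEquiv.symm finProdFinEquiv.symm,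
    finProdFinEquiv, finProdFinEquiv, fun a b i k j l => ?_, fun g a b a' b' => ?_⟩
  · exact reindex_stackTensor _ _ _ _ a b i k j l
  · exact reindex_kroneckerUnitary _ _ _ a b a' b'

end Stack

/-! ### Realization of classes -/

section Realization

variable {G : Type} [Group G] {T : MulAut G} {L : ℕ}

lemma ofTensor_hasClass {ι κ : Type*} [Fintype ι] [Fintype κ] [DecidableEq ι] [DecidableEq κ]
    (hT : T ^ L = 1) {U : G →* Matrix.unitaryGroup ι ℂ} {A : ι → Matrix κ κ ℂ}
    {ρ : Matrix κ κ ℂ} (hA : Primitive A ρ) {x : groupCohomology.H2 (U1 (FullGroup T))}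
    (h : HasClass T U A x) : ∃ S : SymMPS T L, HasClass T S.U S.A x := by
  have h' := h
  obtain ⟨v, φ, -, hp, -⟩ := h'
  exact ⟨SymMPS.ofTensor hT U A ⟨ρ, hA⟩ ⟨v, φ, hp⟩ (Fintype.equivFin ι).symm
    (Fintype.equivFin κ).symm, h.reindex _ _⟩

/-- Product states carrying a character. -/
lemma exists_hasClass_character (hT : T ^ L = 1) (φ : G →* Circle)
    {x : groupCohomology.H2 (U1 (FullGroup T))} (hx : Encodes T x (fun _ _ => 1) φ) :
    ∃ S : SymMPS T L, HasClass T S.U S.A x := by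
  have hA : Primitive (fun _ : Unit => (1 : Matrix Unit Unit ℂ)) 1 :=
    primitive_of_rigid (by simp) Matrix.PosDef.one (by simp) (by simp [transferMap_apply])
      fun ν X _ => ⟨X () (), by ext; simp⟩
  refine ofTensor_hasClass hT (U := MonoidHom.mk' (fun g => phaseMul (φ g) 1) fun g h =>
    unitary_ext ?_) hA ⟨fun _ => 1, φ, _, fun g s => ?_, fun g h => ?_, hx⟩
  · ext
    simp [phaseMul_val, mul_comm]
  · ext
    simp [phaseMul_val, physMap]
  · simp

/-- The left regular representation twisted by a cocycle. -/
lemma exists_twisted_regular [Fintype G] [DecidableEq G] {ω : G → G → Circle}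
    (hω : IsCocycle ω) : ∃ v : G → Matrix.unitaryGroup G ℂ,
      ∀ g h, (v g).1 * (v h).1 = (ω g h : ℂ) • (v (g * h)).1 := by
  let M : G → Matrix G G ℂ := fun g => Matrix.of fun k h => if k = g * h then (ω g h : ℂ) else 0
  have hM (g : G) : M g ∈ Matrix.unitaryGroup G ℂ := by
    rw [Matrix.mem_unitaryGroup_iff', Matrix.star_eq_conjTranspose]
    ext i j
    by_cases hij : i = j
    · subst hij
      simpa [M, Matrix.mul_apply] using star_circle_mul_self (ω g i)
    · simp [M, Matrix.mul_apply, hij, Ne.symm hij]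
  refine ⟨fun g => ⟨M g, hM g⟩, fun g h => ?_⟩
  ext k j
  have h1 := congrArg (Subtype.val : Circle → ℂ) (hω g h j)
  simp only [Circle.coe_mul] at h1
  by_cases hk : k = g * (h * j)
  · subst hk
    simpa [M, Matrix.mul_apply, mul_assoc, mul_comm] using h1.symm
  · simp [M, Matrix.mul_apply, mul_assoc, hk]

/-- Finiteness supplies a finite-dimensional projective representation with any prescribed cocycle.
Normalized matrix units on its bond space form a primitive tensor with push-through data `(v, φ)`.
-/
theorem exists_hasClass_of_finite [Finite G] (hT : T ^ L = 1)
    (x : groupCohomology.H2 (U1 (FullGroup T))) : ∃ S : SymMPS T L, HasClass T S.U S.A x := by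
  classical
  have := Fintype.ofFinite G
  obtain ⟨ω, φ, hω, hφ, hx⟩ := exists_encodes_of_class x
  obtain ⟨v, hv⟩ := exists_twisted_regular hω
  have hc : (0 : ℝ) < Fintype.card G := by exact_mod_cast Fintype.card_pos
  let c : ℂ := (√(1 / Fintype.card G) : ℝ)
  have hcc : c * c * Fintype.card G = 1 := by
    rw [← Complex.ofReal_mul, Real.mul_self_sqrt (by positivity)]
    push_cast
    exact one_div_mul_cancel (by exact_mod_cast hc.ne')
  have hcs : star c = c := Complex.conj_ofReal _
  have hc0 : c ≠ 0 := fun h0 => by simp [h0] at hcc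
  have hA : Primitive (c • unitTensor G G) ((c * c) • (1 : Matrix G G ℂ)) := by
    refine primitive_of_rigid ?_ (Matrix.PosDef.one.smul ?_) ?_ ?_ fun ν X hX => ?_
    · simp only [Pi.smul_apply, Matrix.conjTranspose_smul, Matrix.smul_mul, Matrix.mul_smul,
        smul_smul, ← Finset.smul_sum, sum_unitTensor_star_mul, hcs, hcc, one_smul]
    · rw [← Complex.ofReal_mul, Real.mul_self_sqrt (by positivity)]
      exact_mod_cast one_div_pos.2 hc
    · rw [Matrix.trace_smul, Matrix.trace_one, smul_eq_mul, hcc]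
    · rw [transferMap_apply]
      simp only [Pi.smul_apply, Matrix.conjTranspose_smul, Matrix.smul_mul (a := c),
        Matrix.mul_smul _ c, smul_smul, ← Finset.smul_sum, hcs]
      rw [sum_unitTensor_conj, Matrix.trace_smul, Matrix.trace_one, smul_eq_mul, hcc, one_smul]
    · simp only [Pi.smul_apply, Matrix.smul_mul, Matrix.mul_smul, smul_comm ν] at hX
      exact ⟨_, eq_smul_one_of_unitTensor (fun x => smul_right_injective _ hc0 (hX x)) 1⟩
  exact ofTensor_hasClass hT (U := bondRep hφ hv hv) hA
    ⟨v, φ, ω, (pushesRect_unitTensor hφ hv hv).smul c, hv, hx⟩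

end Realization

/-! ### Weak indices -/

section WeakIndex

variable {G : Type} [Group G] {T : MulAut G} {L : ℕ}

/-- The push-through phases of a linear bond representation form a character. -/
lemma exists_character_of_linear (hL : 1 ≤ L) (hT : T ^ L = 1) {S : SymMPS T L}
    {v : G →* Matrix.unitaryGroup (Fin S.χ) ℂ} {φ : G → Circle} (h : S.PushThrough v φ) :
    ∃ (χ : G →* Circle) (x : groupCohomology.H2 (U1 (FullGroup T))), φ = χ ∧
      HasClass T S.U S.A x ∧ Encodes T x (fun _ _ => 1) χ := by
  obtain ⟨ρ, hρ⟩ := S.injective.exists_primitive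
  have hp := pushThrough_iff.1 h
  obtain ⟨ω, x, hω, hx⟩ := hp.exists_hasClass hρ hL hT
  have hne : Nonempty (Fin S.χ) := hρ.nonempty
  -- The cocycle is determined by `v`, because unitaries on a nonzero space do not vanish.
  have hω1 : ω = fun _ _ => 1 := by
    funext a b
    have h1 : (1 : ℂ) • (v (a * b)).1 = (ω a b : ℂ) • (v (a * b)).1 := by
      rw [one_smul, ← hω, map_mul, Submonoid.coe_mul]
    have h2 : (v (a * b)).1 ≠ 0 := fun h0 => by
      have := unitary_mul_conjTranspose (v (a * b))
      rw [h0, Matrix.zero_mul] at this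
      exact zero_ne_one this
    exact Circle.ext (smul_left_injective ℂ h2 h1).symm
  subst hω1
  refine ⟨MonoidHom.mk' φ fun a b => ?_, x, rfl, ⟨_, φ, _, hp, hω, hx⟩, hx⟩
  simpa using hx.compat a b

variable {k : Phase T L → groupCohomology.H2 (U1 (FullGroup T))}
  {ι : Additive (WeakSPTGroup T) →+ groupCohomology.H2 (U1 (FullGroup T))}

lemma SymMPS.HasWeakIndex.isWeak {S : SymMPS T L} {x : WeakSPTGroup T} (h : S.HasWeakIndex x) :
    S.IsWeak := by
  obtain ⟨v, φ, h, -⟩ := h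
  exact ⟨v, φ, h⟩

lemma SymMPS.IsWeak.exists_index (hL : 1 ≤ L) (hT : T ^ L = 1) {S : SymMPS T L} (h : S.IsWeak) :
    ∃ x, S.HasWeakIndex x := by
  obtain ⟨v, φ, h⟩ := h
  obtain ⟨χ, -, rfl, -⟩ := exists_character_of_linear hL hT h
  exact ⟨_, v, χ, h, rfl⟩

/-- For the converse direction, a class in the image of `ι` restricts trivially to `G`. The bond
cocycle is then a coboundary, and rescaling by its trivialization makes `v` linear and `φ` a
character. -/
lemma hasWeakIndex_iff (hL : 1 ≤ L) (hT : T ^ L = 1)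
    (hk : ∀ (S : SymMPS T L) x, HasClass T S.U S.A x ↔ k S.phase = x)
    (hι : ∀ φ : G →* Circle,
      Encodes T (ι (Additive.ofMul (QuotientGroup.mk φ))) (fun _ _ => 1) φ)
    {S : SymMPS T L} {x : WeakSPTGroup T} :
    S.HasWeakIndex x ↔ k S.phase = ι (Additive.ofMul x) := by
  constructor
  · rintro ⟨v, φ, h, rfl⟩
    obtain ⟨χ, x, hχ, hx, he⟩ := exists_character_of_linear hL hT h
    rw [(hk S x).1 hx]
    rw [← hχ] at he
    exact (he.eq_iff (hι φ)).2 ⟨fun _ => 1, by simp, by simp⟩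
  · intro h
    obtain ⟨v, φ, ω, hp, hv, he⟩ := (hk S _).2 rfl
    obtain ⟨z, χ, hz, hχ, he'⟩ :=
      he.exists_character (((iota_exact hι).2.1 _).2 ⟨_, h.symm⟩)
    have hp' := hp.rescale z
    rw [← show (χ : G → Circle) = _ from funext hχ] at hp'
    refine ⟨MonoidHom.mk' (fun g => phaseMul (z g) (v g)) fun a b => unitary_ext ?_, χ,
      pushThrough_iff.2 hp', ?_⟩
    · rw [Submonoid.coe_mul]
      simp only [phaseMul_val, Matrix.smul_mul, Matrix.mul_smul, smul_smul, hv, ← hz,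
        Circle.coe_mul]
      congr 1
      ring
    · refine Additive.ofMul.injective ((iota_exact hι).1 ?_)
      rw [← h]
      exact ((hι χ).eq_iff he').2 ⟨fun _ => 1, by simp, by simp⟩

/-- Weak phases are classified by the weak index. -/
lemma exists_weak_equiv (hL : 1 ≤ L) (hT : T ^ L = 1)
    (hk : ∀ (S : SymMPS T L) x, HasClass T S.U S.A x ↔ k S.phase = x)
    (hk' : Function.Injective k)
    (hι : ∀ φ : G →* Circle,
      Encodes T (ι (Additive.ofMul (QuotientGroup.mk φ))) (fun _ _ => 1) φ) :
    ∃ w : WeakPhase T L ≃ WeakSPTGroup T, ∀ p, k p.1 = ι (Additive.ofMul (w p)) := by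
  have hex (p : WeakPhase T L) : ∃ y, k p.1 = ι (Additive.ofMul y) := by
    obtain ⟨S, hS, hp⟩ := p.2
    obtain ⟨y, hy⟩ := hS.exists_index hL hT
    exact ⟨y, hp ▸ (hasWeakIndex_iff hL hT hk hι).1 hy⟩
  choose w hw using hex
  refine ⟨Equiv.ofBijective w ⟨fun p q hpq => ?_, fun y => ?_⟩, hw⟩
  · exact Subtype.ext (hk' (by rw [hw, hw, hpq]))
  · obtain ⟨φ, rfl⟩ := QuotientGroup.mk_surjective y
    obtain ⟨S, hS⟩ := exists_hasClass_character hT φ (hι φ)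
    have hS' := (hk S _).1 hS
    refine ⟨S.weakPhase ((hasWeakIndex_iff hL hT hk hι).2 hS').isWeak,
      Additive.ofMul.injective ((iota_exact hι).1 ?_)⟩
    rw [← hw]
    exact hS'

end WeakIndex

end ModulatedMPS

end

theorem mainTheorem10 {G : Type} [Group G] (T : MulAut G) (L : ℕ) (hL : 1 ≤ L)
    (hT : T ^ L = 1) :
    -- generalized push-through: every symmetric injective MPS has push-through data
    (∀ S : SymMPS T L, ∃ v φ, S.PushThrough v φ) ∧
    -- being a weak SPT (trivial strong class) only depends on the phase
    (∀ S S' : SymMPS T L, S.phase = S'.phase → (S.IsWeak ↔ S'.IsWeak)) ∧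
    -- stacking is always possible
    (∀ S₁ S₂ : SymMPS T L, ∃ S, IsStack S₁ S₂ S) ∧
    ∃ (w : WeakPhase T L ≃ WeakSPTGroup T)
      (κ : Phase T L → groupCohomology.H2 (U1 (FullGroup T)))
      (ι : Additive (WeakSPTGroup T) →+ groupCohomology.H2 (U1 (FullGroup T))),
      -- weak SPT phases are classified by the quotient, through the push-through phases
      (∀ (S : SymMPS T L) (h : S.IsWeak) (x : WeakSPTGroup T),
        S.HasWeakIndex x ↔ w (S.weakPhase h) = x) ∧
      -- the group law of the quotient is stacking
      (∀ S₁ S₂ S : SymMPS T L, IsStack S₁ S₂ S → ∀ (h₁ : S₁.IsWeak) (h₂ : S₂.IsWeak),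
        ∃ h : S.IsWeak,
          w (S.weakPhase h) = w (S₁.weakPhase h₁) * w (S₂.weakPhase h₂)) ∧
      -- all phases are classified by the crystalline class in `H²(G ⋊ ℤ, U(1))`
      (∀ (S : SymMPS T L) (x : groupCohomology.H2 (U1 (FullGroup T))),
        S.HasCrystallineClass x ↔ κ S.phase = x) ∧
      Function.Injective κ ∧
      (Finite G → Function.Surjective κ) ∧
      -- on weak phases it is given by `ι`, and there is an exact sequence
      -- `0 → H¹(G, U(1))/∼ → H²(G ⋊ ℤ, U(1)) → H²(G, U(1))^T → 0`
      (∀ (S : SymMPS T L) (h : S.IsWeak),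
        κ S.phase = ι (Additive.ofMul (w (S.weakPhase h)))) ∧
      Function.Injective ι ∧
      (∀ x : groupCohomology.H2 (U1 (FullGroup T)),
        H2pullback (SemidirectProduct.inl : G →* FullGroup T) x = 0 ↔ ∃ y, ι y = x) ∧
      (∀ z : groupCohomology.H2 (U1 G),
        H2pullback T.toMonoidHom z = z ↔
          ∃ x, H2pullback (SemidirectProduct.inl : G →* FullGroup T) x = z) := by
  obtain ⟨k, hk⟩ := exists_kappa hL hT
  obtain ⟨ι, hι⟩ := exists_iota T
  -- Tensors with the same class are joined by a single elementary deformation.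
  have hk' : Function.Injective k := by
    rintro ⟨S⟩ ⟨S'⟩ h
    exact ((hk S _).2 h).phase_eq hT ((hk S' _).2 rfl)
  obtain ⟨w, hw⟩ := exists_weak_equiv hL hT hk hk' hι
  obtain ⟨h₁, h₂, h₃⟩ := iota_exact hι
  have hindex (S : SymMPS T L) (h : S.IsWeak) (x : WeakSPTGroup T) :
      S.HasWeakIndex x ↔ w (S.weakPhase h) = x := by
    rw [hasWeakIndex_iff hL hT hk hι]
    change k (S.weakPhase h).1 = _ ↔ _
    rw [hw]
    exact h₁.eq_iff.trans Additive.ofMul.injective.eq_iff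
  -- Being weak means that the class lies in the image of `ι`, a condition on the phase alone.
  have hweak (S S' : SymMPS T L) (h : S.phase = S'.phase) (hS : S.IsWeak) : S'.IsWeak := by
    obtain ⟨x, hx⟩ := hS.exists_index hL hT
    rw [hasWeakIndex_iff hL hT hk hι, h] at hx
    exact ((hasWeakIndex_iff hL hT hk hι).2 hx).isWeak
  refine ⟨fun S => ?_, fun S S' h => ⟨hweak S S' h, hweak S' S h.symm⟩, exists_isStack hL hT,
    w, k, ι, hindex, fun S₁ S₂ S hS hS₁ hS₂ => ?_, fun S x => by rw [hasCrystallineClass_iff, hk],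
    hk', fun _ x => ?_, fun S h => hw (S.weakPhase h), h₁, h₂, h₃⟩
  · obtain ⟨ρ, hρ⟩ := S.injective.exists_primitive
    obtain ⟨v, φ, h⟩ := exists_push hρ hL hT S.symmetric
    exact ⟨v, φ, pushThrough_iff.2 h⟩
  · obtain ⟨x₁, hx₁⟩ := hS₁.exists_index hL hT
    obtain ⟨x₂, hx₂⟩ := hS₂.exists_index hL hT
    rw [(hindex S₁ hS₁ x₁).1 hx₁, (hindex S₂ hS₂ x₂).1 hx₂]
    obtain ⟨v₁, φ₁, hp₁, rfl⟩ := hx₁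
    obtain ⟨v₂, φ₂, hp₂, rfl⟩ := hx₂
    obtain ⟨v, hv⟩ := hS.exists_push v₁ v₂ hp₁ hp₂
    exact ⟨⟨v, _, hv⟩, (hindex S _ _).1 ⟨v, φ₁ * φ₂, hv, rfl⟩⟩
  · obtain ⟨S, hS⟩ := exists_hasClass_of_finite hT x
    exact ⟨S.phase, (hk S x).1 hS⟩
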